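/- **Setting.** Let $\Omega=(0,1)^2$, let $f$ be a bounded measurable function on $\bar\Omega$ (defined pointwise, so that its nodal values make sense), and let $u\in H^1_0(\Omega)$ be the weak solution of $-\triangle u=f$ in $\Omega$, $u=0$ on $\partial\Omega$. Let $\mathcal T$ be a conforming triangulation of $\bar\Omega$ into closed triangles, with set of nodes $\mathcal N$ and set of edges $\mathcal S$, let $S_h$ be the space of continuous functions on $\bar\Omega$ that are affine on every $T\in\mathcal T$ and vanish on $\partial\Omega$, and let $u_h\in S_h$ satisfy $\langle\nabla u_h,\nabla v_h\rangle=\langle f,v_h\rangle$ for all $v_h\in S_h$, where $\langle\cdot,\cdot\rangle$ is the $L_2(\Omega)$ inner product. Let $f^I$ be the continuous piecewise-linear function on $\mathcal T$ that equals $f$ at all nodes. Write $H_T=\operatorname{diam}T$, $h_T=2|T|/H_T$; for $z\in\mathcal N$ let $\omega_z$ be the union of the elements containing $z$, $H_z=\operatorname{diam}\omega_z$, $h_z=|\omega_z|/H_z$; for $S\in\mathcal S$ let $\omega_S$ be the union of the elements having $S$ as an edge, and for $S\not\subset\partial\Omega$ let $J_S$ be the jump of the normal derivative of $u_h$ across $S$.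 Let $\operatorname{osc}(f;T)=\sup_Tf-\inf_Tf$, and for an open set $\mathcal D\subset\Omega$ let $$ \mathcal E_{\mathcal D}=\Bigl\{\sum_{S\in\mathcal S\cap\mathcal D}|\omega_S|J_S^2+\|h_Tf^I\|_{2;\mathcal D}^2\Bigr\}^{1/2},\qquad \mathcal Y_{\mathcal D}=\|\nabla(u_h-u)\|_{2;\mathcal D}+\|H_T\operatorname{osc}(f;T)\|_{2;\mathcal D}, $$ where $\mathcal S\cap\mathcal D$ is the set of edges whose relative interior lies in $\mathcal D$, and $h_T$, $H_T$, $\operatorname{osc}(f;T)$ are understood as piecewise-constant functions. **Mesh assumptions.** Let $\alpha_0<\pi$, $M\in\mathbb N$, $K\in\mathbb R$, $c_0>0$, and suppose that * every angle of every $T\in\mathcal T$ is at most $\alpha_0$, and every node belongs to at most $M$ elements; * there is a mesh $0=x_0<x_1<\dots<x_n=1$ such that each $T\in\mathcal T$ has, for some $i$, its shortest edge on the segment $\{x=x_i,\ 0\le y\le1\}$ and a vertex on $\{x=x_{i+1}\}$ or $\{x=x_{i-1}\}$; * for every $z\in\mathcal N$ one has $h_z<c_0H_z$, and $|\omega_z|\le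 K|T|$ for all elements $T\subset\omega_z$; * for every $z\in\mathcal N$ there is a rectangle $\omega_z^*\supset\omega_z$ with sides parallel to the coordinate axes such that $|\omega_z^*|\le K|\omega_z|$. Let $\Omega_i=(x_{i-1},x_{i+1})\times(0,1)$ for $i=0,\dots,n$, where $x_{-1}:=x_0$ and $x_{n+1}:=x_n$. **Claim.** There is a constant $C>0$, depending only on $\alpha_0$, $M$, $K$ and $c_0$ (in particular not on $f$, $n$, or the diameters and aspect ratios of the elements), such that in this setting $$ \mathcal E_{\Omega_i}\le C\,\mathcal Y_{\Omega_i}\quad\text{for all }i=0,\dots,n,\qquad\text{and}\qquad \mathcal E_{\Omega}\le C\,\mathcal Y_{\Omega}. $$ -/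

import Mathlib

open MeasureTheory Filter Topology
open scoped ContDiff RealInnerProductSpace

namespace AnisoFEM

noncomputable section

/-- The Euclidean plane; the coordinates of a point `p` are `x = p 0` and `y = p 1`. -/
abbrev Plane : Type := EuclideanSpace ℝ (Fin 2)

/-- The (two-dimensional Lebesgue) area of a set. -/
def area (D : Set Plane) : ℝ := (volume : Measure Plane).real D

/-- The open square `(0,1)²`. -/
def unitSquare : Set Plane := {p | 0 < p 0 ∧ p 0 < 1 ∧ 0 < p 1 ∧ p 1 < 1}

/-! ### The continuous problem -/

/-- `u ∈ H¹₀(Ω)` with weak gradient `g`: the pair `(u, g)` is the limit in `L²(Ω)` of pairs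
`(φ, ∇φ)` with `φ ∈ C_c^∞(Ω)`. -/
def IsH10 (Ω : Set Plane) (u : Plane → ℝ) (g : Plane → Plane) : Prop :=
  MemLp u 2 (volume.restrict Ω) ∧ MemLp g 2 (volume.restrict Ω) ∧
  ∃ φ : ℕ → Plane → ℝ,
    (∀ k, ContDiff ℝ ∞ (φ k) ∧ HasCompactSupport (φ k) ∧ tsupport (φ k) ⊆ Ω) ∧
    Tendsto (fun k => eLpNorm (fun p => u p - φ k p) 2 (volume.restrict Ω)) atTop (𝓝 0) ∧
    Tendsto (fun k => eLpNorm (fun p => g p - gradient (φ k) p) 2 (volume.restrict Ω))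
      atTop (𝓝 0)

/-- `u`, with weak gradient `gu`, is the weak solution of `-Δu = f` in `Ω`, `u = 0` on `∂Ω`. -/
def IsWeakSolution (Ω : Set Plane) (f u : Plane → ℝ) (gu : Plane → Plane) : Prop :=
  IsH10 Ω u gu ∧
  ∀ (v : Plane → ℝ) (gv : Plane → Plane), IsH10 Ω v gv →
    ∫ p in Ω, ⟪gu p, gv p⟫ = ∫ p in Ω, f p * v p

/-! ### Triangulations -/

/-- The closed convex hull of a finite set of points: the closed triangle (or closed edge)
with these vertices. -/
def hull (t : Finset Plane) : Set Plane := convexHull ℝ (t : Set Plane)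

/-- A conforming triangulation of the closure of `Ω`.  An element is given by its three
vertices; two elements intersect in the hull of their common vertices. -/
structure Triangulation (Ω : Set Plane) where
  elements : Finset (Finset Plane)
  card_eq : ∀ t ∈ elements, t.card = 3
  indep : ∀ t ∈ elements, AffineIndependent ℝ (fun a : t => (a : Plane))
  conforming : ∀ t ∈ elements, ∀ t' ∈ elements,
    hull t ∩ hull t' = convexHull ℝ ((t : Set Plane) ∩ (t' : Set Plane))
  covers : ⋃ t ∈ elements, hull t = closure Ω

/-- `H_T`, the diameter of the triangle. -/
def bigH (t : Finset Plane) : ℝ := Metric.diam (hull t)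

/-- `h_T = 2 |T| / H_T`. -/
def smallH (t : Finset Plane) : ℝ := 2 * area (hull t) / bigH t

/-- The barycentre of a finite set of points. -/
def bary (t : Finset Plane) : Plane := (t.card : ℝ)⁻¹ • ∑ a ∈ t, a

/-- The outward unit normal to the triangle `t` along its edge `e`: the normalised component
orthogonal to `e` of the vector from the barycentre of `t` to the midpoint of `e`. -/
def outwardNormal (t e : Finset Plane) : Plane :=
  let w := (vectorSpan ℝ (e : Set Plane))ᗮ.starProjection (bary e - bary t)
  ‖w‖⁻¹ • w

namespace Triangulation

variable {Ω : Set Plane} (𝒯 : Triangulation Ω)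

/-- The set of mesh nodes. -/
def nodes : Set Plane := {z | ∃ t ∈ 𝒯.elements, z ∈ t}

open Classical in
/-- The set of edges, an edge being given by its two endpoints. -/
def edges : Finset (Finset Plane) := 𝒯.elements.biUnion fun t => t.powersetCard 2

/-- `ω_z`, the patch of elements surrounding the node `z`. -/
def nodePatch (z : Plane) : Set Plane := ⋃ t ∈ 𝒯.elements, ⋃ _ : z ∈ t, hull t

/-- `ω_S`, the patch of elements sharing the edge `S`. -/
def edgePatch (S : Finset Plane) : Set Plane := ⋃ t ∈ 𝒯.elements, ⋃ _ : S ⊆ t, hull t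

open Classical in
/-- The edges in the open set `D`: those whose relative interior lies in `D`.  For `D = Ω`
these are the edges not on `∂Ω`. -/
def edgesIn (D : Set Plane) : Finset (Finset Plane) :=
  𝒯.edges.filter fun S => hull S \ (S : Set Plane) ⊆ D

/-- `H_z = diam ω_z`. -/
def nodeBigH (z : Plane) : ℝ := Metric.diam (𝒯.nodePatch z)

/-- `h_z = |ω_z| / H_z`. -/
def nodeSmallH (z : Plane) : ℝ := (𝒯.nodeBigH z)⁻¹ * area (𝒯.nodePatch z)

/-! ### Finite element functions -/

/-- Continuous functions on the closure of `Ω` that are affine on every element. -/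
def IsPiecewiseLinear (v : Plane → ℝ) : Prop :=
  ContinuousOn v (closure Ω) ∧
  ∀ t ∈ 𝒯.elements, ∃ A : Plane →ᵃ[ℝ] ℝ, Set.EqOn v A (hull t)

/-- The finite element space `S_h` (piecewise linears that vanish on `∂Ω`). -/
def IsFEFunction (v : Plane → ℝ) : Prop :=
  𝒯.IsPiecewiseLinear v ∧ ∀ p ∈ frontier Ω, v p = 0

/-- `fI` is the piecewise-linear Lagrange interpolant of `f`. -/
def IsLagrangeInterpolant (f fI : Plane → ℝ) : Prop :=
  𝒯.IsPiecewiseLinear fI ∧ ∀ z ∈ 𝒯.nodes, fI z = f z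

/-- `uh ∈ S_h` and `⟨∇uh, ∇vh⟩ = ⟨f, vh⟩` for all `vh ∈ S_h`. -/
def IsFESolution (f uh : Plane → ℝ) : Prop :=
  𝒯.IsFEFunction uh ∧
  ∀ vh : Plane → ℝ, 𝒯.IsFEFunction vh →
    ∫ p in Ω, ⟪gradient uh p, gradient vh p⟫ = ∫ p in Ω, f p * vh p

open Classical in
/-- `J_S`, the jump across the edge `S` of the normal derivative of the piecewise-linear
function `v`: the sum over the elements having the edge `S` of the outward normal derivatives.
The gradient of `v` on an element is constant, and is taken at the barycentre. -/
def jump (v : Plane → ℝ) (S : Finset Plane) : ℝ :=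
  ∑ t ∈ 𝒯.elements with S ⊆ t, ⟪gradient v (bary t), outwardNormal t S⟫

/-! ### The estimator and the error -/

/-- `osc(f; D) = sup_D f - inf_D f`. -/
def _root_.AnisoFEM.osc (f : Plane → ℝ) (D : Set Plane) : ℝ := sSup (f '' D) - sInf (f '' D)

/-- The estimator `{∑_{S ∈ 𝒮 ∩ D} |ω_S| J_S² + ‖h_T fI‖²_{2;D}}^{1/2}`. -/
def estimator (uh fI : Plane → ℝ) (D : Set Plane) : ℝ :=
  Real.sqrt (∑ S ∈ 𝒯.edgesIn D, area (𝒯.edgePatch S) * 𝒯.jump uh S ^ 2 +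
    ∑ t ∈ 𝒯.elements, smallH t ^ 2 * ∫ p in hull t ∩ D, fI p ^ 2)

/-- The error plus data oscillation `‖∇(uh - u)‖_{2;D} + ‖H_T osc(f; T)‖_{2;D}`, where `gu` is
the weak gradient of `u`. -/
def errorOsc (f uh : Plane → ℝ) (gu : Plane → Plane) (D : Set Plane) : ℝ :=
  Real.sqrt (∫ p in D, ‖gradient uh p - gu p‖ ^ 2) +
    Real.sqrt (∑ t ∈ 𝒯.elements, bigH t ^ 2 * osc f (hull t) ^ 2 * area (hull t ∩ D))

end Triangulation

/-! ### Partially structured anisotropic meshes -/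

/-- The vertical segment `{x = x_i, y ∈ [0,1]}`. -/
def gridLine (x : ℕ → ℝ) (i : ℕ) : Set Plane := {p | p 0 = x i ∧ 0 ≤ p 1 ∧ p 1 ≤ 1}

/-- `Ω_i = (x_{i-1}, x_{i+1}) × (0,1)`, where `x_{-1} := x_0` and `x_{n+1} := x_n`
(for `i = 0` the natural number `i - 1` is `0`). -/
def strip (n : ℕ) (x : ℕ → ℝ) (i : ℕ) : Set Plane :=
  {p | x (i - 1) < p 0 ∧ p 0 < x (min (i + 1) n) ∧ 0 < p 1 ∧ p 1 < 1}

/-- The axis-parallel rectangle `[a,b] × [c,d]`. -/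
def rectangle (a b c d : ℝ) : Set Plane := {p | a ≤ p 0 ∧ p 0 ≤ b ∧ c ≤ p 1 ∧ p 1 ≤ d}

/-- The assumptions on a partially structured anisotropic triangulation of `(0,1)²`, with the
constants in them made explicit: `α₀` bounds the angles, `M` the number of elements at a node,
`K` is the constant in the relations `|T| ∼ |ω_z|` and `|ω*_z| ∼ |ω_z|` (of which the other
halves are trivial), and `a ≪ b` means `a < c₀ * b`. -/
structure IsStructuredMesh (α₀ : ℝ) (M : ℕ) (K c₀ : ℝ) (n : ℕ) (x : ℕ → ℝ)
    (𝒯 : Triangulation unitSquare) : Prop where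
  maxAngle : ∀ t ∈ 𝒯.elements, ∀ a ∈ t, ∀ b ∈ t, ∀ c ∈ t, a ≠ b → b ≠ c → a ≠ c →
    EuclideanGeometry.angle a b c ≤ α₀
  valence : ∀ z ∈ 𝒯.nodes, {t | t ∈ 𝒯.elements ∧ z ∈ t}.ncard ≤ M
  /-- `0 = x_0 < x_1 < ⋯ < x_n = 1`. -/
  grid_zero : x 0 = 0
  grid_last : x n = 1
  grid_strictMono : ∀ i < n, x i < x (i + 1)
  /-- Each element has its shortest edge on some segment `{x = x_i}` and a vertex on a
  neighbouring one. -/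
  structured : ∀ t ∈ 𝒯.elements, ∃ i ≤ n, ∃ a b c : Plane, (t : Set Plane) = {a, b, c} ∧
    a ∈ gridLine x i ∧ b ∈ gridLine x i ∧ dist a b ≤ dist a c ∧ dist a b ≤ dist b c ∧
    ((i + 1 ≤ n ∧ c ∈ gridLine x (i + 1)) ∨ (1 ≤ i ∧ c ∈ gridLine x (i - 1)))
  /-- All nodes are anisotropic. -/
  anisotropic : ∀ z ∈ 𝒯.nodes, 𝒯.nodeSmallH z < c₀ * 𝒯.nodeBigH z
  comparable : ∀ z ∈ 𝒯.nodes, ∀ t ∈ 𝒯.elements, z ∈ t →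
    area (𝒯.nodePatch z) ≤ K * area (hull t)
  /-- Global element orientation condition. -/
  orientation : ∀ z ∈ 𝒯.nodes, ∃ a b c d : ℝ, 𝒯.nodePatch z ⊆ rectangle a b c d ∧
    area (rectangle a b c d) ≤ K * area (𝒯.nodePatch z)

end

end AnisoFEM

/-! Lower bounds come from inserting test functions `v` in the residual equation. With `G = ∇u_h`,
constant on each element, one has `∑_T (∫_T f v - ∫_T ∇v·G) = ∑_T ∫_T ∇v·(∇u - G)`, and the right
side is at most `∑_T sup_T |∇v| |T|^(1/2) η_T`, where `η_T²` is `etaSq`, the local error plus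
oscillation (`IsTest.residual_le`). The test functions are piecewise polynomial and Lipschitz, hence
admissible by `isH10_of_lipschitz`.

The usual bubbles `λ_a λ_b λ_c` and `λ_a λ_b` have gradients of size at most about `H_T/|T|`, that
is `1/h_T`. This suffices for `h_T f^I` (`element_residual_estimate`) and for edges of length
comparable to `H_T` (`long_edge_estimate`), but loses a factor `H_T/h_T` on short edges. On a
structured mesh each element has exactly one vertical edge, its shortest one, and its other edges
are long, so the whole difficulty sits on the grid lines.

An inner line `x = x_i` is treated by a single test function, `lineTest`. Its nodal value `J(z)` is
the jump across some vertical edge at `z`, so on the line its product with the actual jumps has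
integral close to `∑ |S| J_S²`. A polynomial factor makes its mean vanish on every element, so that
`f` enters only through its oscillation; with `f` itself the factor `H_T/h_T` would reappear. Away
from the line the function varies on the scale of the slab width `w`, as desired. Along the line its
derivative is `(J(b) - J(a))/|ab|`, and this is dangerous because `|ab|` is small.

Two facts control it. First, summing the `x`-component of the gradient jumps around a node gives
zero; tangential continuity turns this into a linear relation between the normal jumps
(`sum_neighbours_eq_zero`), by which two vertical jumps at a node differ by at most the slopes of
the long edges times the long-edge jumps (`abs_jump_sub_jump_le`). Secondly, the patch of a node
lies in an axis-parallel rectangle of comparable area, so these slopes are at most of order `|ab|/w`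
(`slope_le`). Together they give a gradient of order `1/w` times quantities already under control
(`line_gradient_le`). Young's inequality absorbs the vertical jumps on the right, whence
`line_estimate`.

All bounds are local with finite overlap, so that summation over the edges, lines and elements of a
strip, or of the whole square, gives the claim (`estimator_le`). -/

namespace AnisoFEM

noncomputable section

/-! ### Plane geometry -/

/-- The cross product with a fixed vector of the plane. -/
def cross (u : Plane) : Plane →L[ℝ] ℝ :=
  u 0 • EuclideanSpace.proj (1 : Fin 2) - u 1 • EuclideanSpace.proj (0 : Fin 2)

lemma cross_apply (u v : Plane) : cross u v = u 0 * v 1 - u 1 * v 0 := by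
  simp [cross]

/-- Twice the signed area of the triangle `a b c`. -/
def dblArea (a b c : Plane) : ℝ := cross (b - a) (c - a)

lemma dblArea_eq (a b c : Plane) :
    dblArea a b c = (b 0 - a 0) * (c 1 - a 1) - (b 1 - a 1) * (c 0 - a 0) := by
  simp [dblArea, cross_apply]

lemma dblArea_rotate (a b c : Plane) : dblArea b c a = dblArea a b c := by
  simp only [dblArea_eq]; ring

lemma dblArea_swap (a b c : Plane) : dblArea b a c = - dblArea a b c := by
  simp only [dblArea_eq]; ring

lemma dblArea_swap_right (a b c : Plane) : dblArea a c b = - dblArea a b c := by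
  simp only [dblArea_eq]; ring

/-- The differential of the barycentric coordinate of the triangle `a b c` with respect to `a`. -/
def dcoord (a b c : Plane) : Plane →L[ℝ] ℝ := (dblArea a b c)⁻¹ • cross (c - b)

/-- The barycentric coordinate of the triangle `a b c` with respect to `a`. -/
def coord (a b c p : Plane) : ℝ := dcoord a b c (p - b)

lemma dcoord_apply (a b c v : Plane) :
    dcoord a b c v = ((c 0 - b 0) * v 1 - (c 1 - b 1) * v 0) / dblArea a b c := by
  simp [dcoord, cross_apply]; ring

lemma coord_eq (a b c p : Plane) :
    coord a b c p =
      ((c 0 - b 0) * (p 1 - b 1) - (c 1 - b 1) * (p 0 - b 0)) / dblArea a b c := by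
  simp [coord, dcoord_apply]

lemma coord_swap (a b c p : Plane) : coord a c b p = coord a b c p := by
  rw [coord_eq, coord_eq, dblArea_swap_right, div_neg, ← neg_div]; congr 1; ring

lemma hasFDerivAt_coord (a b c p : Plane) : HasFDerivAt (coord a b c) (dcoord a b c) p := by
  exact (dcoord a b c).hasFDerivAt (x := p - b) |>.comp p ((hasFDerivAt_id p).sub_const b)

lemma continuous_coord (a b c : Plane) : Continuous (coord a b c) := by
  unfold coord; fun_prop

section coords

variable {a b c : Plane}

lemma coord_self (h : dblArea a b c ≠ 0) : coord a b c a = 1 := by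
  rw [coord_eq, div_eq_one_iff_eq h, dblArea_eq]; ring

lemma coord_left (a b c : Plane) : coord a b c b = 0 := by
  rw [coord_eq]; simp

lemma coord_right (a b c : Plane) : coord a b c c = 0 := by
  rw [coord_eq]; ring

lemma coord_add (h : dblArea a b c ≠ 0) (p : Plane) :
    coord a b c p + coord b c a p + coord c a b p = 1 := by
  simp only [coord_eq, dblArea_rotate a b c, dblArea_rotate c a b]
  rw [← dblArea_rotate c a b] at *
  rw [← add_div, ← add_div, div_eq_one_iff_eq h, dblArea_eq]; ring

lemma dcoord_add (h : dblArea a b c ≠ 0) :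
    dcoord a b c + dcoord b c a + dcoord c a b = 0 := by
  ext v
  have h1 := coord_add h v
  have h2 := coord_add h 0
  simp only [coord, map_sub, map_zero] at h1 h2
  simp only [add_apply, zero_apply]
  linarith

lemma plane_ext {p q : Plane} (h0 : p 0 = q 0) (h1 : p 1 = q 1) : p = q := by
  ext i; fin_cases i <;> assumption

lemma eq_coord_smul (h : dblArea a b c ≠ 0) (p : Plane) :
    p = coord a b c p • a + coord b c a p • b + coord c a b p • c := by
  have h' := h
  rw [dblArea_eq] at h'
  apply plane_ext <;>
  · simp only [coord_eq, dblArea_rotate a b c, dblArea_rotate c a b, PiLp.add_apply,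
      PiLp.smul_apply, smul_eq_mul]
    rw [← dblArea_rotate c a b]
    rw [dblArea_eq]
    field_simp
    ring

lemma coord_combo (h : dblArea a b c ≠ 0) {r s t : ℝ} (hs : r + s + t = 1) :
    coord a b c (r • a + s • b + t • c) = r := by
  rw [coord_eq, div_eq_iff h, dblArea_eq]
  simp only [PiLp.add_apply, PiLp.smul_apply, smul_eq_mul]
  obtain rfl : r = 1 - s - t := by linarith
  ring

lemma mem_triangle_iff_exists {p : Plane} : p ∈ convexHull ℝ ({a, b, c} : Set Plane) ↔
    ∃ r s t : ℝ, 0 ≤ r ∧ 0 ≤ s ∧ 0 ≤ t ∧ r + s + t = 1 ∧ p = r • a + s • b + t • c := by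
  constructor
  · intro hp
    have hconv : Convex ℝ {p : Plane | ∃ r s t : ℝ, 0 ≤ r ∧ 0 ≤ s ∧ 0 ≤ t ∧ r + s + t = 1 ∧
        p = r • a + s • b + t • c} := by
      rintro _ ⟨r, s, t, hr, hs, ht, h1, rfl⟩ _ ⟨r', s', t', hr', hs', ht', h1', rfl⟩ α β hα hβ hαβ
      refine ⟨α * r + β * r', α * s + β * s', α * t + β * t', by positivity, by positivity,
        by positivity, ?_, by module⟩
      calc _ = α * (r + s + t) + β * (r' + s' + t') := by ring
        _ = 1 := by rw [h1, h1']; linarith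
    refine convexHull_min ?_ hconv hp
    rintro _ (rfl | rfl | rfl)
    · exact ⟨1, 0, 0, by norm_num, by norm_num, by norm_num, by norm_num, by simp⟩
    · exact ⟨0, 1, 0, by norm_num, by norm_num, by norm_num, by norm_num, by simp⟩
    · exact ⟨0, 0, 1, by norm_num, by norm_num, by norm_num, by norm_num, by simp⟩
  · rintro ⟨r, s, t, hr, hs, ht, h1, rfl⟩
    have hc := convex_convexHull ℝ ({a, b, c} : Set Plane)
    have := hc.sum_mem (t := Finset.univ) (w := ![r, s, t]) (z := ![a, b, c])
      (by intro i _; fin_cases i <;> simpa) (by simp [Fin.sum_univ_three, h1])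
      (by intro i _; fin_cases i <;> exact subset_convexHull ℝ _ (by simp))
    simpa [Fin.sum_univ_three] using this

lemma mem_triangle_iff (h : dblArea a b c ≠ 0) {p : Plane} :
    p ∈ convexHull ℝ ({a, b, c} : Set Plane) ↔
      0 ≤ coord a b c p ∧ 0 ≤ coord b c a p ∧ 0 ≤ coord c a b p := by
  rw [mem_triangle_iff_exists]
  constructor
  · rintro ⟨r, s, t, hr, hs, ht, h1, rfl⟩
    refine ⟨by rwa [coord_combo h h1], ?_, ?_⟩
    · rw [show r • a + s • b + t • c = s • b + t • c + r • a by module,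
        coord_combo (by rwa [dblArea_rotate]) (by linarith)]
      exact hs
    · rw [show r • a + s • b + t • c = t • c + r • a + s • b by module,
        coord_combo (by rwa [← dblArea_rotate]) (by linarith)]
      exact ht
  · rintro ⟨h1, h2, h3⟩
    exact ⟨_, _, _, h1, h2, h3, coord_add h p, eq_coord_smul h p⟩

lemma coord_le_one (h : dblArea a b c ≠ 0) {p : Plane}
    (hp : p ∈ convexHull ℝ ({a, b, c} : Set Plane)) : coord a b c p ≤ 1 := by
  have := (mem_triangle_iff h).1 hp
  linarith [coord_add h p]

lemma mem_interior_triangle (h : dblArea a b c ≠ 0) {p : Plane}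
    (h1 : 0 < coord a b c p) (h2 : 0 < coord b c a p) (h3 : 0 < coord c a b p) :
    p ∈ interior (convexHull ℝ ({a, b, c} : Set Plane)) := by
  rw [mem_interior]
  refine ⟨{q | 0 < coord a b c q} ∩ {q | 0 < coord b c a q} ∩ {q | 0 < coord c a b q}, ?_, ?_, ?_⟩
  · rintro q ⟨⟨hq1, hq2⟩, hq3⟩
    exact (mem_triangle_iff h).2 ⟨le_of_lt hq1, le_of_lt hq2, le_of_lt hq3⟩
  · exact ((isOpen_lt continuous_const (continuous_coord _ _ _)).inter
      (isOpen_lt continuous_const (continuous_coord _ _ _))).inter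
      (isOpen_lt continuous_const (continuous_coord _ _ _))
  · exact ⟨⟨h1, h2⟩, h3⟩

lemma affineMap_combo (A : Plane →ᵃ[ℝ] ℝ) {r s t : ℝ} (h : r + s + t = 1) :
    A (r • a + s • b + t • c) = r * A a + s * A b + t * A c := by
  have e : r • a + s • b + t • c = AffineMap.lineMap a b s +ᵥ (t • (c - a)) := by
    simp only [AffineMap.lineMap_apply_module', vadd_eq_add]
    obtain rfl : r = 1 - s - t := by linarith
    module
  have hl : ∀ p q : Plane, A.linear (p - q) = A p - A q := fun p q => by
    simpa using A.linearMap_vsub p q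
  have e2 : r • a + s • b + t • c = (s • (b - a) + t • (c - a)) +ᵥ a := by
    obtain rfl : r = 1 - s - t := by linarith
    simp only [vadd_eq_add]; module
  rw [e2, A.map_vadd, map_add, map_smul, map_smul, hl, hl]
  obtain rfl : r = 1 - s - t := by linarith
  simp; ring

lemma affineMap_eq_coord (h : dblArea a b c ≠ 0) (A : Plane →ᵃ[ℝ] ℝ) (p : Plane) :
    A p = coord a b c p * A a + coord b c a p * A b + coord c a b p * A c := by
  conv_lhs => rw [eq_coord_smul h p]
  exact affineMap_combo A (coord_add h p)

end coords

/-- The affine coordinate function as an affine map. -/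
def coordAffine (a b c : Plane) : Plane →ᵃ[ℝ] ℝ :=
  (dcoord a b c).toLinearMap.toAffineMap - AffineMap.const ℝ Plane (dcoord a b c b)

lemma coordAffine_apply (a b c p : Plane) : coordAffine a b c p = coord a b c p := by
  simp [coordAffine, coord]

/-! ### Integration over triangles -/

/-- The reference triangle. -/
def refTri : Set Plane := {q | 0 ≤ q 0 ∧ 0 ≤ q 1 ∧ q 0 + q 1 ≤ 1}

lemma measurableSet_refTri : MeasurableSet refTri := by
  have : IsClosed refTri := by
    have e : refTri = {q | 0 ≤ q 0} ∩ ({q | 0 ≤ q 1} ∩ {q | q 0 + q 1 ≤ 1}) := rfl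
    rw [e]
    refine (isClosed_le ?_ ?_).inter ((isClosed_le ?_ ?_).inter (isClosed_le ?_ ?_)) <;> fun_prop
  exact this.measurableSet

lemma integral_refTri (F : ℝ → ℝ → ℝ) (hF : Continuous (fun z : ℝ × ℝ => F z.1 z.2)) :
    ∫ q in refTri, F (q 0) (q 1) = ∫ s in (0:ℝ)..1, ∫ r in (0:ℝ)..(1 - s), F s r := by
  let e : Plane ≃ᵐ ℝ × ℝ := (MeasurableEquiv.toLp 2 (Fin 2 → ℝ)).symm.trans
    MeasurableEquiv.finTwoArrow
  have he : MeasurePreserving e volume volume :=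
    (EuclideanSpace.volume_preserving_symm_measurableEquiv_toLp (Fin 2)).trans
      (volume_preserving_finTwoArrow ℝ)
  let R : Set (ℝ × ℝ) := {z | 0 ≤ z.1 ∧ 0 ≤ z.2 ∧ z.1 + z.2 ≤ 1}
  have hRc : IsClosed R := by
    have e : R = {z | 0 ≤ z.1} ∩ ({z | 0 ≤ z.2} ∩ {z | z.1 + z.2 ≤ 1}) := rfl
    rw [e]
    refine (isClosed_le ?_ ?_).inter ((isClosed_le ?_ ?_).inter (isClosed_le ?_ ?_)) <;> fun_prop
  have hRK : R ⊆ Set.Icc 0 1 ×ˢ Set.Icc 0 1 := by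
    rintro ⟨s, r⟩ ⟨h1, h2, h3⟩
    simp only at h1 h2 h3
    exact ⟨⟨h1, by simp only; linarith⟩, ⟨h2, by simp only; linarith⟩⟩
  have hRcomp : IsCompact R := (isCompact_Icc.prod isCompact_Icc).of_isClosed_subset hRc hRK
  have h1 : ∫ q in refTri, F (q 0) (q 1) = ∫ z in R, F z.1 z.2 := by
    have := he.setIntegral_preimage_emb e.measurableEmbedding (fun z => F z.1 z.2) R
    rw [← this]; rfl
  rw [h1, ← integral_indicator hRc.measurableSet, Measure.volume_eq_prod,
    integral_prod _ ((hF.continuousOn.integrableOn_compact hRcomp).integrable_indicator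
      hRc.measurableSet), intervalIntegral.integral_of_le zero_le_one,
      ← integral_Icc_eq_integral_Ioc, ← integral_indicator measurableSet_Icc]
  congr 1
  ext s
  by_cases hs : s ∈ Set.Icc (0:ℝ) 1
  · rw [Set.indicator_of_mem hs, intervalIntegral.integral_of_le (by linarith [hs.2]),
      ← integral_Icc_eq_integral_Ioc, ← integral_indicator measurableSet_Icc]
    congr 1
    ext r
    simp only [Set.indicator]
    congr 1
    simp only [R, Set.mem_ofPred_eq, Set.mem_Icc, eq_iff_iff]
    exact ⟨fun h => ⟨h.2.1, by linarith⟩, fun h => ⟨hs.1, h.1, by linarith⟩⟩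
  · rw [Set.indicator_of_notMem hs]
    have : ∀ r, R.indicator (fun z : ℝ × ℝ => F z.1 z.2) (s, r) = 0 := by
      intro r
      refine Set.indicator_of_notMem (fun h => hs ?_) _
      exact (hRK h).1
    simp [this]

lemma integral_quartic (c0 c1 c2 c3 c4 T I : ℝ)
    (hI : I = c0 * T + c1 * (T ^ 2 / 2) + c2 * (T ^ 3 / 3) + c3 * (T ^ 4 / 4) + c4 * (T ^ 5 / 5)) :
    ∫ x in (0:ℝ)..T, (c0 + c1 * x + c2 * x ^ 2 + c3 * x ^ 3 + c4 * x ^ 4) = I := by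
  have hd : ∀ x ∈ Set.uIcc 0 T, HasDerivAt (fun x : ℝ => c0 * x + c1 * (x ^ 2 / 2) +
      c2 * (x ^ 3 / 3) + c3 * (x ^ 4 / 4) + c4 * (x ^ 5 / 5))
      (c0 + c1 * x + c2 * x ^ 2 + c3 * x ^ 3 + c4 * x ^ 4) x := by
    intro x _
    have := (((((hasDerivAt_id x).const_mul c0).add
        (((hasDerivAt_pow 2 x).div_const 2).const_mul c1)).add
        (((hasDerivAt_pow 3 x).div_const 3).const_mul c2)).add
        (((hasDerivAt_pow 4 x).div_const 4).const_mul c3)).add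
        (((hasDerivAt_pow 5 x).div_const 5).const_mul c4)
    refine this.congr_deriv ?_
    norm_num
  rw [intervalIntegral.integral_eq_sub_of_hasDerivAt hd
    (Continuous.intervalIntegrable (by fun_prop) _ _), hI]
  simp

/-- Every integral over an element that is evaluated exactly below has an integrand of degree at
most three in two barycentric coordinates, so this one formula serves for all of them. -/
lemma integral_refTri_cubic (k0 k1 k2 k3 k4 k5 k6 k7 k8 k9 : ℝ) :
    ∫ q in refTri, (k0 + k1 * q 0 + k2 * q 1 + k3 * q 0 ^ 2 + k4 * (q 0 * q 1) + k5 * q 1 ^ 2 +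
      k6 * q 0 ^ 3 + k7 * (q 0 ^ 2 * q 1) + k8 * (q 0 * q 1 ^ 2) + k9 * q 1 ^ 3) =
    (1 / 2) * (k0 + k1 / 3 + k2 / 3 + k3 / 6 + k4 / 12 + k5 / 6 + k6 / 10 + k7 / 30 + k8 / 30 +
      k9 / 10) := by
  rw [integral_refTri (fun s r => k0 + k1 * s + k2 * r + k3 * s ^ 2 + k4 * (s * r) + k5 * r ^ 2 +
      k6 * s ^ 3 + k7 * (s ^ 2 * r) + k8 * (s * r ^ 2) + k9 * r ^ 3) (by fun_prop)]
  have inner : ∀ s : ℝ, ∫ r in (0:ℝ)..(1 - s), (k0 + k1 * s + k2 * r + k3 * s ^ 2 +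
      k4 * (s * r) + k5 * r ^ 2 + k6 * s ^ 3 + k7 * (s ^ 2 * r) + k8 * (s * r ^ 2) + k9 * r ^ 3) =
      (k0 + k1 * s + k3 * s ^ 2 + k6 * s ^ 3) * (1 - s) +
      (k2 + k4 * s + k7 * s ^ 2) * ((1 - s) ^ 2 / 2) + (k5 + k8 * s) * ((1 - s) ^ 3 / 3) +
      k9 * ((1 - s) ^ 4 / 4) := by
    intro s
    refine Eq.trans ?_ (integral_quartic (k0 + k1 * s + k3 * s ^ 2 + k6 * s ^ 3) (k2 + k4 * s + k7 * s ^ 2)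
      (k5 + k8 * s) k9 0 (1 - s) _ (by ring))
    congr 1
    ext r
    ring
  simp_rw [inner]
  -- The arguments are the coefficients of the powers of `s` in the expanded inner integral.
  refine Eq.trans ?_ (integral_quartic (k0 + k2 / 2 + k5 / 3 + k9 / 4)
    (k1 - k0 + k4 / 2 - k2 + k8 / 3 - k5 - k9)
    (k3 - k1 + k7 / 2 - k4 + k2 / 2 - k8 + k5 + k9 * (3 / 2))
    (k6 - k3 - k7 + k4 / 2 + k8 - k5 / 3 - k9)
    (-k6 + k7 / 2 - k8 / 3 + k9 / 4) 1 _ (by ring))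
  congr 1
  ext r
  ring

/-- The parametrisation of the triangle `a b c` by the reference triangle. -/
def refMap (a b c q : Plane) : Plane := c + (q 0 • (a - c) + q 1 • (b - c))

/-- The linear part of the parametrisation `refMap`. -/
def refLin (a b c : Plane) : Plane →L[ℝ] Plane :=
  (EuclideanSpace.proj (0 : Fin 2) : Plane →L[ℝ] ℝ).smulRight (a - c) +
    (EuclideanSpace.proj (1 : Fin 2) : Plane →L[ℝ] ℝ).smulRight (b - c)

lemma det_refLin (a b c : Plane) : (refLin a b c).det = dblArea a b c := by
  rw [ContinuousLinearMap.det,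
    ← LinearMap.det_toMatrix (EuclideanSpace.basisFun (Fin 2) ℝ).toBasis, Matrix.det_fin_two]
  simp [LinearMap.toMatrix_apply, refLin, dblArea_eq]
  ring

lemma hasFDerivAt_refMap (a b c q : Plane) : HasFDerivAt (refMap a b c) (refLin a b c) q := by
  have := ((refLin a b c).hasFDerivAt (x := q)).const_add c
  exact this

lemma coord_refMap {a b c : Plane} (h : dblArea a b c ≠ 0) (q : Plane) :
    coord a b c (refMap a b c q) = q 0 ∧ coord b c a (refMap a b c q) = q 1 := by
  have e : refMap a b c q = q 0 • a + q 1 • b + (1 - q 0 - q 1) • c := by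
    unfold refMap; module
  have e' : refMap a b c q = q 1 • b + (1 - q 0 - q 1) • c + q 0 • a := by
    unfold refMap; module
  refine ⟨?_, ?_⟩
  · rw [e]; exact coord_combo h (by ring)
  · rw [e']; exact coord_combo (by rwa [dblArea_rotate]) (by ring)

lemma integral_triangle {a b c : Plane} (h : dblArea a b c ≠ 0) (F : Plane → ℝ) :
    ∫ p in convexHull ℝ ({a, b, c} : Set Plane), F p =
      |dblArea a b c| * ∫ q in refTri, F (refMap a b c q) := by
  have himg : convexHull ℝ ({a, b, c} : Set Plane) = refMap a b c '' refTri := by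
    ext p
    constructor
    · intro hp
      obtain ⟨r, s, t, hr, hs, ht, h1, rfl⟩ := mem_triangle_iff_exists.1 hp
      refine ⟨!₂[r, s], ⟨by simpa, by simpa, by simp; linarith⟩, ?_⟩
      obtain rfl : t = 1 - r - s := by linarith
      simp only [refMap, Matrix.cons_val_zero, Matrix.cons_val_one]
      module
    · rintro ⟨q, ⟨h0, h1, h2⟩, rfl⟩
      refine mem_triangle_iff_exists.2 ⟨q 0, q 1, 1 - q 0 - q 1, h0, h1, by linarith, by ring, ?_⟩
      unfold refMap; module
  have hinj : Set.InjOn (refMap a b c) refTri := by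
    intro q _ q' _ hqq
    apply plane_ext
    · rw [← (coord_refMap h q).1, ← (coord_refMap h q').1, hqq]
    · rw [← (coord_refMap h q).2, ← (coord_refMap h q').2, hqq]
  rw [himg, integral_image_eq_integral_abs_det_fderiv_smul volume measurableSet_refTri
    (fun q _ => (hasFDerivAt_refMap a b c q).hasFDerivWithinAt) hinj]
  simp only [det_refLin, smul_eq_mul]
  rw [integral_const_mul]

lemma area_triangle {a b c : Plane} (h : dblArea a b c ≠ 0) :
    area (convexHull ℝ ({a, b, c} : Set Plane)) = |dblArea a b c| / 2 := by
  have h1 := integral_triangle h (fun _ => 1)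
  have h2 := integral_refTri_cubic 1 0 0 0 0 0 0 0 0 0
  simp only [zero_mul, add_zero, zero_div, mul_one] at h2
  rw [h2, setIntegral_const] at h1
  simp only [smul_eq_mul, mul_one] at h1
  rw [area, h1]; ring

lemma integral_triangle_cubic {a b c : Plane} (h : dblArea a b c ≠ 0)
    (k0 k1 k2 k3 k4 k5 k6 k7 k8 k9 : ℝ) :
    ∫ p in convexHull ℝ ({a, b, c} : Set Plane), (k0 + k1 * coord a b c p + k2 * coord b c a p +
      k3 * coord a b c p ^ 2 + k4 * (coord a b c p * coord b c a p) + k5 * coord b c a p ^ 2 +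
      k6 * coord a b c p ^ 3 + k7 * (coord a b c p ^ 2 * coord b c a p) +
      k8 * (coord a b c p * coord b c a p ^ 2) + k9 * coord b c a p ^ 3) =
    area (convexHull ℝ ({a, b, c} : Set Plane)) *
    (k0 + k1 / 3 + k2 / 3 + k3 / 6 + k4 / 12 + k5 / 6 + k6 / 10 + k7 / 30 + k8 / 30 +
      k9 / 10) := by
  rw [integral_triangle h, area_triangle h]
  simp only [(coord_refMap h _).1, (coord_refMap h _).2]
  rw [integral_refTri_cubic]; ring

/-! ### Lipschitz functions vanishing outside the square belong to `H¹₀` -/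

/-- Restricted to a segment, the function has right slopes at most `L` times the speed along some
sequence of parameters, because one of the finitely many closed pieces contains points of the
segment arbitrarily close on the right. The mean value inequality for lower right slopes then loses
nothing in the constant. -/
lemma lipschitzWith_of_closed_cover {E : Type*} [NormedAddCommGroup E] [NormedSpace ℝ E]
    {L : NNReal} {v : E → ℝ} {𝒜 : Set (Set E)} (hfin : 𝒜.Finite) (hcov : ⋃₀ 𝒜 = Set.univ)
    (hcl : ∀ A ∈ 𝒜, IsClosed A) (hL : ∀ A ∈ 𝒜, LipschitzOnWith L v A) : LipschitzWith L v := by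
  have hcont : Continuous v := by
    have : Finite 𝒜 := hfin
    refine LocallyFinite.continuous (f := fun A : 𝒜 => (A : Set E)) (locallyFinite_of_finite _)
      (by rw [← Set.sUnion_eq_iUnion, hcov]) (fun A => hcl A A.2) (fun A => (hL A A.2).continuousOn)
  refine LipschitzWith.of_le_add_mul L fun y x => ?_
  let γ : ℝ → E := fun s => x + s • (y - x)
  have hγ : Continuous γ := by fun_prop
  have hd : ∀ s z : ℝ, dist (γ z) (γ s) = |z - s| * dist y x := fun s z => by
    rw [dist_eq_norm, dist_eq_norm, show γ z - γ s = (z - s) • (y - x) by simp only [γ]; module,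
      norm_smul, Real.norm_eq_abs]
  have key := image_le_of_liminf_slope_right_le_deriv_boundary
    (a := 0) (b := 1) (f := fun s => v (γ s))
    (B := fun s => v x + L * dist y x * s) (B' := fun _ => L * dist y x)
    (hcont.comp hγ).continuousOn (by simp [γ]) (by fun_prop)
    (fun s _ => by
      have := ((hasDerivAt_id s).const_mul (L * dist y x)).const_add (v x)
      simpa using this.hasDerivWithinAt)
    ?_ (x := 1) (by simp)
  · simpa [γ] using key
  intro s hs r hr
  have h1 : ∃ᶠ z in 𝓝[>] s, ∃ A ∈ 𝒜, γ z ∈ A := by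
    refine Eventually.frequently (Eventually.of_forall fun z => ?_)
    have : γ z ∈ ⋃₀ 𝒜 := by rw [hcov]; trivial
    simpa using this
  -- Pigeonhole: were each piece eventually avoided, finiteness would make all of them eventually
  -- avoided at once, against the covering.
  have h2 : ∃ A ∈ 𝒜, ∃ᶠ z in 𝓝[>] s, γ z ∈ A := by
    by_contra hcon
    push Not at hcon
    apply h1
    have := (hfin.eventually_all (l := 𝓝[>] s) (p := fun A z => γ z ∉ A)).2
      (fun A hA => hcon A hA)
    filter_upwards [this] with z hz
    rintro ⟨A, hA, hzA⟩
    exact hz A hA hzA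
  obtain ⟨A, hA, hfr⟩ := h2
  have hsA : γ s ∈ A := by
    by_contra hsA
    apply hfr
    have : ∀ᶠ z in 𝓝 s, γ z ∈ Aᶜ :=
      hγ.continuousAt.eventually ((hcl A hA).isOpen_compl.mem_nhds hsA)
    exact this.filter_mono nhdsWithin_le_nhds
  refine (hfr.and_eventually self_mem_nhdsWithin).mono ?_
  rintro z ⟨hz, hzs⟩
  have hzs' : 0 < z - s := sub_pos.2 hzs
  refine lt_of_le_of_lt ?_ hr
  rw [slope_def_field, div_le_iff₀ hzs']
  have := (hL A hA).dist_le_mul _ hz _ hsA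
  rw [Real.dist_eq, hd, abs_of_pos hzs'] at this
  linarith [le_abs_self (v (γ z) - v (γ s))]

/-- Convolution with a mollifier. -/
def mollify (ρ v : Plane → ℝ) (x : Plane) : ℝ := ∫ t, ρ t * v (x - t)

section mollify

variable {ρ v : Plane → ℝ} {ε : ℝ}

lemma integrable_mul_of_bump (hρ : Continuous ρ) (hc : HasCompactSupport ρ) {F : Plane → ℝ}
    (hF : Continuous F) : Integrable (fun t => ρ t * F t) :=
  (hρ.mul hF).integrable_of_hasCompactSupport hc.mul_right

lemma abs_integral_bump_le (hρ : Continuous ρ) (hc : HasCompactSupport ρ) (h0 : ∀ t, 0 ≤ ρ t)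
    (h1 : ∫ t, ρ t = 1) (hsupp : Function.support ρ ⊆ Metric.ball 0 ε) {F : Plane → ℝ} {C : ℝ}
    (hF : ∀ t ∈ Metric.ball (0 : Plane) ε, |F t| ≤ C) : |∫ t, ρ t * F t| ≤ C := by
  calc |∫ t, ρ t * F t| ≤ ∫ t, ρ t * C := by
        rw [← Real.norm_eq_abs]
        refine norm_integral_le_of_norm_le ((hρ.integrable_of_hasCompactSupport hc).mul_const C) ?_
        refine Eventually.of_forall fun t => ?_
        rw [Real.norm_eq_abs, abs_mul, abs_of_nonneg (h0 t)]
        by_cases ht : ρ t = 0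
        · simp [ht]
        · exact mul_le_mul_of_nonneg_left (hF t (hsupp ht)) (h0 t)
    _ = C := by rw [integral_mul_const, h1, one_mul]

/-- The constant `c` passes under the integral since `ρ` has mass one. It is later the increment of
the derivative, so that strict differentiability can be applied to each translate. -/
lemma mollify_sub (hρ : Continuous ρ) (hc : HasCompactSupport ρ) (h1 : ∫ t, ρ t = 1)
    (hv : Continuous v) (x y : Plane) (c : ℝ) :
    mollify ρ v x - mollify ρ v y - c = ∫ t, ρ t * (v (x - t) - v (y - t) - c) := by
  have e : ∀ t, ρ t * (v (x - t) - v (y - t) - c) =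
      ρ t * v (x - t) - ρ t * v (y - t) - ρ t * c := fun t => by ring
  simp_rw [e]
  have i1 : Integrable (fun t => ρ t * v (x - t) - ρ t * v (y - t)) :=
    (integrable_mul_of_bump hρ hc (by fun_prop)).sub (integrable_mul_of_bump hρ hc (by fun_prop))
  rw [integral_sub i1 (integrable_mul_of_bump hρ hc (by fun_prop)),
    integral_sub (integrable_mul_of_bump hρ hc (by fun_prop))
    (integrable_mul_of_bump hρ hc (by fun_prop)), integral_mul_const, h1, one_mul]
  rfl

lemma mollify_sub_self (hρ : Continuous ρ) (hc : HasCompactSupport ρ) (h1 : ∫ t, ρ t = 1)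
    (hv : Continuous v) (x : Plane) (c : ℝ) :
    mollify ρ v x - c = ∫ t, ρ t * (v (x - t) - c) := by
  simp_rw [mul_sub]
  rw [integral_sub (integrable_mul_of_bump hρ hc (by fun_prop))
    (integrable_mul_of_bump hρ hc (by fun_prop)), integral_mul_const, h1, one_mul]
  rfl

lemma contDiff_mollify (hρ : ContDiff ℝ ∞ ρ) (hc : HasCompactSupport ρ) (hv : Continuous v) :
    ContDiff ℝ ∞ (mollify ρ v) := by
  have := hc.contDiff_convolution_left (n := ⊤) (ContinuousLinearMap.lsmul ℝ ℝ) hρ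
    (hv.locallyIntegrable (μ := volume))
  exact this

end mollify

lemma tendsto_eLpNorm_two_zero {E : Type*} [NormedAddCommGroup E] {Ω : Set Plane}
    (hΩ : volume Ω ≠ ⊤) {F : ℕ → Plane → E} {C : ℝ}
    (hm : ∀ k, AEStronglyMeasurable (F k) (volume.restrict Ω)) (hb : ∀ k p, ‖F k p‖ ≤ C)
    (hl : ∀ᵐ p ∂(volume.restrict Ω), Tendsto (fun k => F k p) atTop (𝓝 0)) :
    Tendsto (fun k => eLpNorm (F k) 2 (volume.restrict Ω)) atTop (𝓝 0) := by
  have h2 : ∀ k, eLpNorm (F k) 2 (volume.restrict Ω) =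
      (∫⁻ p in Ω, ‖F k p‖ₑ ^ (2:ℝ)) ^ (1 / (2:ℝ)) := fun k => by
    rw [eLpNorm_eq_lintegral_rpow_enorm_toReal (by norm_num) (by norm_num)]; simp
  simp_rw [h2]
  have h3 : Tendsto (fun k => ∫⁻ p in Ω, ‖F k p‖ₑ ^ (2:ℝ)) atTop (𝓝 0) := by
    have := tendsto_lintegral_of_dominated_convergence' (μ := volume.restrict Ω)
      (F := fun k p => ‖F k p‖ₑ ^ (2:ℝ)) (f := fun _ => 0) (fun _ => ENNReal.ofReal C ^ (2:ℝ))
      (fun k => (hm k).enorm.pow_const _) (fun k => Eventually.of_forall fun p => ?_) ?_ ?_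
    · simpa using this
    · refine ENNReal.rpow_le_rpow ?_ (by norm_num)
      rw [← ofReal_norm]
      exact ENNReal.ofReal_le_ofReal (hb k p)
    · rw [lintegral_const]
      refine ENNReal.mul_ne_top (ENNReal.rpow_ne_top_of_nonneg (by norm_num) ENNReal.ofReal_ne_top) ?_
      simpa using hΩ
    · filter_upwards [hl] with p hp
      have h4 : Tendsto (fun k => ‖F k p‖ₑ) atTop (𝓝 0) := by
        simpa [Function.comp_def] using (continuous_enorm.tendsto (0 : E)).comp hp
      have := (ENNReal.continuous_rpow_const (y := (2:ℝ))).tendsto 0 |>.comp h4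
      simpa [Function.comp_def] using this
  have := (ENNReal.continuous_rpow_const (y := 1 / (2:ℝ))).tendsto 0 |>.comp h3
  simpa [Function.comp_def] using this

lemma unitSquare_subset_closedBall : unitSquare ⊆ Metric.closedBall (0 : Plane) 2 := by
  rintro p ⟨h1, h2, h3, h4⟩
  rw [mem_closedBall_zero_iff, EuclideanSpace.norm_eq, Fin.sum_univ_two, Real.norm_eq_abs,
    Real.norm_eq_abs, sq_abs, sq_abs]
  refine Real.sqrt_le_iff.2 ⟨by norm_num, by nlinarith⟩

lemma isOpen_unitSquare : IsOpen unitSquare := by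
  have e : unitSquare = {p | 0 < p 0} ∩ ({p | p 0 < 1} ∩ ({p | 0 < p 1} ∩ {p | p 1 < 1})) := rfl
  rw [e]
  refine (isOpen_lt ?_ ?_).inter ((isOpen_lt ?_ ?_).inter ((isOpen_lt ?_ ?_).inter
    (isOpen_lt ?_ ?_))) <;> fun_prop

lemma volume_unitSquare_ne_top : volume unitSquare ≠ ⊤ :=
  ((measure_mono unitSquare_subset_closedBall).trans_lt measure_closedBall_lt_top).ne

/-- Centre of the unit square. -/
def squareCenter : Plane := !₂[1 / 2, 1 / 2]

/-- The approximations are mollifications of `v` composed with a slight expansion about the centre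
of the square, which pulls the support strictly inside. Their gradients are uniformly bounded by the
Lipschitz constant and converge wherever `v` is strictly differentiable, so dominated convergence
gives convergence in `L²`. -/
theorem isH10_of_lipschitz {v : Plane → ℝ} {L : NNReal} (hL : LipschitzWith L v)
    (h0 : ∀ p ∉ unitSquare, v p = 0)
    (hs : ∀ᵐ p, ∃ v' : Plane →L[ℝ] ℝ, HasStrictFDerivAt v v' p) :
    IsH10 unitSquare v (gradient v) := by
  have hv : Continuous v := hL.continuous
  let ε : ℕ → ℝ := fun k => 1 / ((k : ℝ) + 1)
  have hε : ∀ k, 0 < ε k := fun k => by positivity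
  have hε1 : ∀ k, ε k ≤ 1 := fun k => by
    simp only [ε]; rw [div_le_one (by positivity)]; linarith [(Nat.cast_nonneg k : (0:ℝ) ≤ k)]
  have hεt : Tendsto ε atTop (𝓝 0) := tendsto_one_div_add_atTop_nhds_zero_nat
  let b : ∀ k, ContDiffBump (0 : Plane) := fun k =>
    ⟨ε k / 2, ε k, half_pos (hε k), half_lt_self (hε k)⟩
  let ρ : ℕ → Plane → ℝ := fun k => (b k).normed volume
  have hρs : ∀ k, ContDiff ℝ ∞ (ρ k) := fun k => (b k).contDiff_normed
  have hρc : ∀ k, Continuous (ρ k) := fun k => (hρs k).continuous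
  have hρk : ∀ k, HasCompactSupport (ρ k) := fun k => (b k).hasCompactSupport_normed
  have hρ0 : ∀ k t, 0 ≤ ρ k t := fun k t => (b k).nonneg_normed t
  have hρ1 : ∀ k, ∫ t, ρ k t = 1 := fun k => (b k).integral_normed
  have hρb : ∀ k, Function.support (ρ k) ⊆ Metric.ball 0 (ε k) := fun k => by
    rw [(b k).support_normed_eq]
  -- Mollification enlarges the half-width `1/2` by `ε`, and division by the expansion factor must
  -- bring it below `1/2`: `1/2 + ε < (1 + 4ε)/2`.
  let r : ℕ → ℝ := fun k => 1 + 4 * ε k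
  have hr : ∀ k, 0 < r k := fun k => by have := hε k; positivity
  have hr5 : ∀ k, r k ≤ 5 := fun k => by have := hε1 k; simp only [r]; linarith
  have hrt : Tendsto r atTop (𝓝 1) := by simpa using (hεt.const_mul 4).const_add 1
  let ψ : ℕ → Plane → Plane := fun k x => squareCenter + r k • (x - squareCenter)
  have hψ : ∀ k x y, ψ k x - ψ k y = r k • (x - y) := fun k x y => by simp only [ψ]; module
  have hψt : ∀ x, Tendsto (fun k => ψ k x) atTop (𝓝 x) := fun x => by
    have := (hrt.smul_const (x - squareCenter)).const_add squareCenter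
    simpa using this
  let φ : ℕ → Plane → ℝ := fun k x => mollify (ρ k) v (ψ k x)
  have hφs : ∀ k, ContDiff ℝ ∞ (φ k) := fun k =>
    (contDiff_mollify (hρs k) (hρk k) hv).comp (by fun_prop)
  -- differences of the approximations
  have hdiff : ∀ k x y (c C : ℝ), (∀ t ∈ Metric.ball (0 : Plane) (ε k),
      |v (ψ k x - t) - v (ψ k y - t) - c| ≤ C) → |φ k x - φ k y - c| ≤ C := by
    intro k x y c C h
    simp only [φ]
    rw [mollify_sub (hρc k) (hρk k) (hρ1 k) hv]
    exact abs_integral_bump_le (hρc k) (hρk k) (hρ0 k) (hρ1 k) (hρb k) h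
  have hφL : ∀ k x y, |φ k x - φ k y| ≤ L * r k * ‖x - y‖ := by
    intro k x y
    have := hdiff k x y 0 (L * r k * ‖x - y‖) (fun t _ => ?_)
    · simpa using this
    · have h := hL.dist_le_mul (ψ k x - t) (ψ k y - t)
      rw [Real.dist_eq, dist_eq_norm, sub_sub_sub_cancel_right, hψ, norm_smul, Real.norm_eq_abs,
        abs_of_pos (hr k)] at h
      rw [sub_zero]; linarith
  have hφv : ∀ k x, |φ k x - v x| ≤ L * (‖ψ k x - x‖ + ε k) := by
    intro k x
    simp only [φ]
    rw [mollify_sub_self (hρc k) (hρk k) (hρ1 k) hv]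
    refine abs_integral_bump_le (hρc k) (hρk k) (hρ0 k) (hρ1 k) (hρb k) fun t ht => ?_
    have h := hL.dist_le_mul (ψ k x - t) x
    rw [Real.dist_eq, dist_eq_norm] at h
    refine h.trans (mul_le_mul_of_nonneg_left ?_ L.2)
    have e : ψ k x - t - x = (ψ k x - x) - t := by abel
    rw [e]
    have ht' : ‖t‖ < ε k := by simpa using ht
    linarith [norm_sub_le (ψ k x - x) t]
  -- support
  have hsq : ∀ k x, x ∈ tsupport (φ k) → ∀ i, |x i - 1 / 2| ≤ (1 / 2 + ε k) / r k := by
    intro k x hx i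
    have hcl : IsClosed {x : Plane | |x i - 1 / 2| ≤ (1 / 2 + ε k) / r k} :=
      isClosed_le (by fun_prop) continuous_const
    refine closure_minimal (fun y hy => ?_) hcl hx
    by_contra hcon
    apply hy
    have hcon : (1 / 2 + ε k) / r k < |y i - 1 / 2| := not_le.1 hcon
    rw [div_lt_iff₀ (hr k)] at hcon
    have h1 : |φ k y - 0| ≤ 0 := by
      simp only [φ]
      rw [mollify_sub_self (hρc k) (hρk k) (hρ1 k) hv]
      refine abs_integral_bump_le (hρc k) (hρk k) (hρ0 k) (hρ1 k) (hρb k) fun t ht => ?_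
      rw [h0 _ ?_]; · simp
      intro hmem
      have ht' : |t i| < ε k := lt_of_le_of_lt (by
        simpa using EuclideanSpace.norm_eq t ▸ Real.abs_le_sqrt (by
          rw [Fin.sum_univ_two]; fin_cases i <;> simp <;> positivity)) (by simpa using ht)
      have h2 : (ψ k y - t) i = 1 / 2 + r k * (y i - 1 / 2) - t i := by
        simp only [ψ, squareCenter]; fin_cases i <;> simp
      have h3 : 0 < (ψ k y - t) i ∧ (ψ k y - t) i < 1 := by
        obtain ⟨a1, a2, a3, a4⟩ := hmem
        fin_cases i
        · exact ⟨a1, a2⟩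
        · exact ⟨a3, a4⟩
      rw [h2] at h3
      have h4 : |y i - 1 / 2| * r k = |r k * (y i - 1 / 2)| := by
        rw [abs_mul, abs_of_pos (hr k), mul_comm]
      rw [h4] at hcon
      rcases abs_lt.1 ht' with ⟨t1, t2⟩
      rcases lt_abs.1 hcon with h5 | h5 <;> linarith
    simpa using h1
  have hrat : ∀ k, (1 / 2 + ε k) / r k < 1 / 2 := fun k => by
    rw [div_lt_iff₀ (hr k)]; have := hε k; simp only [r]; linarith
  have hφsub : ∀ k, tsupport (φ k) ⊆ unitSquare := by
    intro k x hx
    have a0 := (hsq k x hx 0).trans_lt (hrat k)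
    have a1 := (hsq k x hx 1).trans_lt (hrat k)
    rw [abs_lt] at a0 a1
    exact ⟨by linarith, by linarith, by linarith, by linarith⟩
  have hφc : ∀ k, HasCompactSupport (φ k) := fun k => by
    refine (isCompact_closedBall (0 : Plane) 2).of_isClosed_subset (isClosed_tsupport _) ?_
    exact (hφsub k).trans unitSquare_subset_closedBall
  -- gradient convergence
  have hgradb : ∀ k p, ‖fderiv ℝ (φ k) p‖ ≤ L * 5 := fun k p => by
    have hd := ((hφs k).differentiable (by simp)).differentiableAt (x := p) |>.hasFDerivAt
    refine (hd.le_of_lip' (C := L * r k) (mul_nonneg L.2 (hr k).le)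
      (Eventually.of_forall fun x => hφL k x p)).trans ?_
    exact mul_le_mul_of_nonneg_left (hr5 k) L.2
  have hgradv : ∀ p, ‖fderiv ℝ v p‖ ≤ L := fun p => norm_fderiv_le_of_lipschitz ℝ hL
  have hconv : ∀ p, (∃ v' : Plane →L[ℝ] ℝ, HasStrictFDerivAt v v' p) →
      Tendsto (fun k => fderiv ℝ (φ k) p) atTop (𝓝 (fderiv ℝ v p)) := by
    rintro p ⟨v', hv'⟩
    rw [hv'.hasFDerivAt.fderiv]
    have hrv : Tendsto (fun k => r k • v') atTop (𝓝 v') := by simpa using hrt.smul_const v'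
    have hzero : Tendsto (fun k => fderiv ℝ (φ k) p - r k • v') atTop (𝓝 0) := by
      rw [Metric.tendsto_nhds]
      intro η hη
      -- Since `r k ≤ 5`, the error `η / 10 * r k` stays below `η`.
      have hη₀ : 0 < η / 10 := by positivity
      obtain ⟨s, hs, hap⟩ := hv'.approximates_deriv_on_nhds (c := ⟨η / 10, hη₀.le⟩)
        (Or.inr (by exact_mod_cast hη₀))
      obtain ⟨δ, hδ, hball⟩ := Metric.mem_nhds_iff.1 hs
      have e1 : ∀ᶠ k in atTop, ε k < δ / 2 := hεt.eventually (gt_mem_nhds (half_pos hδ))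
      have e2 : ∀ᶠ k in atTop, dist (ψ k p) p < δ / 2 :=
        (hψt p).eventually (Metric.ball_mem_nhds p (half_pos hδ))
      filter_upwards [e1, e2] with k hk1 hk2
      rw [dist_zero_right]
      refine lt_of_le_of_lt (b := η / 10 * r k) ?_ (by have := hr5 k; nlinarith)
      have hd := ((hφs k).differentiable (by simp)).differentiableAt (x := p) |>.hasFDerivAt
      have hd2 : HasFDerivAt (fun x => φ k x - r k * v' x) (fderiv ℝ (φ k) p - r k • v') p :=
        hd.sub (v'.hasFDerivAt.const_mul (r k))
      refine hd2.le_of_lip' (mul_nonneg hη₀.le (hr k).le) ?_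
      have hψc : Continuous (ψ k) := by fun_prop
      have e3 : ∀ᶠ x in 𝓝 p, dist (ψ k x) p < δ / 2 :=
        hψc.continuousAt.eventually (Metric.isOpen_ball.mem_nhds hk2)
      filter_upwards [e3] with x hx
      have := hdiff k x p (r k * v' (x - p)) (η / 10 * r k * ‖x - p‖) (fun t ht => ?_)
      · rw [Real.norm_eq_abs]
        rw [map_sub, mul_sub] at this
        convert this using 2
        ring
      · have ht' : ‖t‖ < δ / 2 := lt_trans (by simpa using ht) hk1
        have hin : ∀ y : Plane, dist (ψ k y) p < δ / 2 → ψ k y - t ∈ s := fun y hy => by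
          apply hball
          rw [Metric.mem_ball, dist_eq_norm, show ψ k y - t - p = (ψ k y - p) - t by abel]
          rw [dist_eq_norm] at hy
          linarith [norm_sub_le (ψ k y - p) t]
        have h := hap _ (hin x hx) _ (hin p hk2)
        rw [sub_sub_sub_cancel_right, hψ, map_smul, norm_smul, smul_eq_mul, Real.norm_eq_abs,
          Real.norm_eq_abs, abs_of_pos (hr k)] at h
        refine h.trans (le_of_eq ?_)
        change η / 10 * (r k * ‖x - p‖) = _
        ring
    simpa using hzero.add hrv
  have hgrad_norm : ∀ (w : Plane → ℝ) p, ‖gradient w p‖ = ‖fderiv ℝ w p‖ := fun w p => by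
    simp [gradient]
  have hgconv : ∀ᵐ p, Tendsto (fun k => gradient (φ k) p) atTop (𝓝 (gradient v p)) := by
    filter_upwards [hs] with p hp
    exact ((InnerProductSpace.toDual ℝ Plane).symm.continuous.tendsto _).comp (hconv p hp)
  have hgm : ∀ k, AEStronglyMeasurable (gradient (φ k)) (volume.restrict unitSquare) := fun k => by
    have : Continuous (gradient (φ k)) :=
      (InnerProductSpace.toDual ℝ Plane).symm.continuous.comp ((hφs k).continuous_fderiv (by simp))
    exact this.aestronglyMeasurable
  have hgvm : AEStronglyMeasurable (gradient v) (volume.restrict unitSquare) :=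
    aestronglyMeasurable_of_tendsto_ae atTop hgm (ae_restrict_of_ae hgconv)
  have : IsFiniteMeasure (volume.restrict unitSquare) :=
    ⟨by simpa using volume_unitSquare_ne_top.lt_top⟩
  have hvb : ∃ B, ∀ p, ‖v p‖ ≤ B := by
    have hc : HasCompactSupport v :=
      (HasCompactSupport.intro (isCompact_closedBall (0 : Plane) 2)) fun p hp =>
        h0 p fun h => hp (unitSquare_subset_closedBall h)
    exact hc.exists_bound_of_continuous hv
  obtain ⟨B, hB⟩ := hvb
  have hφ0 : ∀ k p, p ∉ unitSquare → φ k p = 0 := fun k p hp => by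
    by_contra h
    exact hp (hφsub k (subset_tsupport _ h))
  refine ⟨MemLp.of_bound hv.aestronglyMeasurable B (Eventually.of_forall hB),
    MemLp.of_bound hgvm L (Eventually.of_forall fun p => (hgrad_norm v p).trans_le (hgradv p)), φ,
    fun k => ⟨hφs k, hφc k, hφsub k⟩, ?_, ?_⟩
  · refine tendsto_eLpNorm_two_zero volume_unitSquare_ne_top (C := L * (4 * (2 + ‖squareCenter‖) + 1))
      (fun k => (hv.sub (hφs k).continuous).aestronglyMeasurable) (fun k p => ?_) ?_
    · by_cases hp : p ∈ unitSquare
      · rw [norm_sub_rev, Real.norm_eq_abs]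
        refine (hφv k p).trans (mul_le_mul_of_nonneg_left ?_ L.2)
        have e : ψ k p - p = (4 * ε k) • (p - squareCenter) := by simp only [ψ, r]; module
        rw [e, norm_smul, Real.norm_eq_abs, abs_of_pos (by have := hε k; positivity)]
        have h1 : ‖p - squareCenter‖ ≤ 2 + ‖squareCenter‖ := by
          have := unitSquare_subset_closedBall hp
          rw [mem_closedBall_zero_iff] at this
          linarith [norm_sub_le p squareCenter]
        have h2 := hε1 k
        have h3 := (hε k).le
        have h4 := norm_nonneg (p - squareCenter)
        nlinarith
      · rw [h0 p hp, hφ0 k p hp]; simp only [sub_zero, norm_zero]; positivity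
    · refine Eventually.of_forall fun p => ?_
      rw [tendsto_zero_iff_norm_tendsto_zero]
      refine squeeze_zero (fun _ => norm_nonneg _) (fun k => ?_)
        (g := fun k => L * (‖ψ k p - p‖ + ε k)) ?_
      · rw [norm_sub_rev]; exact hφv k p
      · have h1 : Tendsto (fun k => ‖ψ k p - p‖) atTop (𝓝 0) := by
          simpa using ((hψt p).sub_const p).norm
        simpa using (h1.add hεt).const_mul (L : ℝ)
  · refine tendsto_eLpNorm_two_zero volume_unitSquare_ne_top (C := L + L * 5)
      (fun k => hgvm.sub (hgm k)) (fun k p => ?_) ?_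
    · refine (norm_sub_le _ _).trans ?_
      rw [hgrad_norm, hgrad_norm]
      exact add_le_add (hgradv p) (hgradb k p)
    · refine ae_restrict_of_ae ?_
      filter_upwards [hgconv] with p hp
      simpa using hp.const_sub (gradient v p)

/-! ### Triangles with ordered vertices -/

/-- `a`, `b`, `c` are the vertices of the nondegenerate triangle `t`. -/
structure IsTri (t : Finset Plane) (a b c : Plane) : Prop where
  coe : (t : Set Plane) = {a, b, c}
  ne : dblArea a b c ≠ 0

namespace IsTri

variable {t : Finset Plane} {a b c : Plane}

lemma rotate (h : IsTri t a b c) : IsTri t b c a :=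
  ⟨by rw [h.coe]; ext x; simp; tauto, by rw [dblArea_rotate]; exact h.ne⟩

lemma swap (h : IsTri t a b c) : IsTri t b a c :=
  ⟨by rw [h.coe]; ext x; simp; tauto, by rw [dblArea_swap]; exact neg_ne_zero.2 h.ne⟩

lemma swap_right (h : IsTri t a b c) : IsTri t a c b :=
  ⟨by rw [h.coe]; ext x; simp; tauto, by rw [dblArea_swap_right]; exact neg_ne_zero.2 h.ne⟩

lemma mem_iff (h : IsTri t a b c) {p : Plane} : p ∈ t ↔ p = a ∨ p = b ∨ p = c := by
  rw [← Finset.mem_coe, h.coe]; simp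

lemma left_mem (h : IsTri t a b c) : a ∈ t := h.mem_iff.2 (Or.inl rfl)

lemma hull_eq (h : IsTri t a b c) : hull t = convexHull ℝ ({a, b, c} : Set Plane) := by
  rw [hull, h.coe]

lemma left_ne (h : IsTri t a b c) : a ≠ b := by
  rintro rfl
  apply h.ne; rw [dblArea_eq]; ring

lemma left_ne_right (h : IsTri t a b c) : a ≠ c := h.swap_right.left_ne

lemma mid_ne (h : IsTri t a b c) : b ≠ c := h.rotate.left_ne

open Classical in
lemma eq_insert (h : IsTri t a b c) : t = {a, b, c} := by
  ext p; rw [h.mem_iff]; simp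

lemma sum_eq {E : Type*} [AddCommMonoid E] (h : IsTri t a b c) (F : Plane → E) :
    ∑ p ∈ t, F p = F a + F b + F c := by
  classical
  rw [h.eq_insert, Finset.sum_insert (by simp [h.left_ne, h.left_ne_right]),
    Finset.sum_pair h.mid_ne, add_assoc]

lemma card_eq (h : IsTri t a b c) : t.card = 3 := by
  classical
  rw [h.eq_insert]
  exact Finset.card_eq_three.2 ⟨a, b, c, h.left_ne, h.left_ne_right, h.mid_ne, rfl⟩

lemma bary_eq (h : IsTri t a b c) : bary t = (3 : ℝ)⁻¹ • (a + b + c) := by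
  rw [bary, h.card_eq, h.sum_eq]; norm_num

lemma mem_hull_iff (h : IsTri t a b c) {p : Plane} : p ∈ hull t ↔
    0 ≤ coord a b c p ∧ 0 ≤ coord b c a p ∧ 0 ≤ coord c a b p := by
  rw [h.hull_eq, mem_triangle_iff h.ne]

lemma area_eq (h : IsTri t a b c) : area (hull t) = |dblArea a b c| / 2 := by
  rw [h.hull_eq, area_triangle h.ne]

lemma area_pos (h : IsTri t a b c) : 0 < area (hull t) := by
  rw [h.area_eq]; exact half_pos (abs_pos.2 h.ne)

lemma bary_mem_interior (h : IsTri t a b c) : bary t ∈ interior (hull t) := by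
  rw [h.hull_eq, h.bary_eq]
  have e1 : (3 : ℝ)⁻¹ • (a + b + c) = (1/3 : ℝ) • a + (1/3 : ℝ) • b + (1/3 : ℝ) • c := by module
  have e2 : (3 : ℝ)⁻¹ • (a + b + c) = (1/3 : ℝ) • b + (1/3 : ℝ) • c + (1/3 : ℝ) • a := by module
  have e3 : (3 : ℝ)⁻¹ • (a + b + c) = (1/3 : ℝ) • c + (1/3 : ℝ) • a + (1/3 : ℝ) • b := by module
  refine mem_interior_triangle h.ne ?_ ?_ ?_
  · rw [e1, coord_combo h.ne (by norm_num)]; norm_num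
  · rw [e2, coord_combo h.rotate.ne (by norm_num)]; norm_num
  · rw [e3, coord_combo h.rotate.rotate.ne (by norm_num)]; norm_num

lemma exists_third (h : IsTri t a b c) {p q : Plane} (hp : p ∈ t) (hq : q ∈ t) (hpq : p ≠ q) :
    ∃ r, IsTri t p q r := by
  rcases h.mem_iff.1 hp with rfl | rfl | rfl <;> rcases h.mem_iff.1 hq with rfl | rfl | rfl
  · exact absurd rfl hpq
  · exact ⟨_, h⟩
  · exact ⟨_, h.swap_right⟩
  · exact ⟨_, h.swap⟩
  · exact absurd rfl hpq
  · exact ⟨_, h.rotate⟩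
  · exact ⟨_, h.rotate.rotate⟩
  · exact ⟨_, h.rotate.swap⟩
  · exact absurd rfl hpq

end IsTri

lemma isClosed_hull (t : Finset Plane) : IsClosed (hull t) :=
  (t.finite_toSet.isCompact_convexHull ℝ).isClosed

lemma isCompact_hull (t : Finset Plane) : IsCompact (hull t) :=
  t.finite_toSet.isCompact_convexHull ℝ

lemma convex_hull (t : Finset Plane) : Convex ℝ (hull t) := convex_convexHull ℝ _

lemma subset_hull (t : Finset Plane) : (t : Set Plane) ⊆ hull t := subset_convexHull ℝ _

lemma volume_frontier_hull (t : Finset Plane) : volume (frontier (hull t)) = 0 :=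
  (convex_hull t).addHaar_frontier volume

lemma exists_isTri_of_affineIndependent {t : Finset Plane} (hc : t.card = 3)
    (hi : AffineIndependent ℝ (fun a : t => (a : Plane))) : ∃ a b c, IsTri t a b c := by
  classical
  obtain ⟨a, b, c, hab, hac, hbc, rfl⟩ := Finset.card_eq_three.1 hc
  refine ⟨a, b, c, by simp, fun hD => ?_⟩
  let ia : ({a, b, c} : Finset Plane) := ⟨a, by simp⟩
  let ib : ({a, b, c} : Finset Plane) := ⟨b, by simp⟩
  let ic : ({a, b, c} : Finset Plane) := ⟨c, by simp⟩
  have hiab : ia ≠ ib := fun h => hab (congrArg Subtype.val h)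
  have hiac : ia ≠ ic := fun h => hac (congrArg Subtype.val h)
  have hibc : ib ≠ ic := fun h => hbc (congrArg Subtype.val h)
  have key : ∀ β γ : ℝ, β • (b - a) + γ • (c - a) = 0 → β = 0 ∧ γ = 0 := by
    intro β γ h
    have := affineIndependent_iff.1 hi {ia, ib, ic}
      (fun i => if i = ia then -(β + γ) else if i = ib then β else γ)
    rw [Finset.sum_insert (by simp [hiab, hiac]), Finset.sum_pair hibc,
      Finset.sum_insert (by simp [hiab, hiac]), Finset.sum_pair hibc] at this
    simp only [if_true, hiab.symm, hiac.symm, hibc.symm, if_false] at this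
    have h3 := this (by ring) (by rw [← h]; simp only [ia, ib, ic]; module)
    have hb := h3 ib (by simp)
    have hc := h3 ic (by simp)
    simp only [hiab.symm, hiac.symm, hibc.symm, if_false, if_true] at hb hc
    exact ⟨hb, hc⟩
  rw [dblArea_eq] at hD
  have h1 := key (c 1 - a 1) (-(b 1 - a 1)) (by
    apply plane_ext <;> simp <;> linarith)
  have h0 := key (c 0 - a 0) (-(b 0 - a 0)) (by
    apply plane_ext <;> simp <;> linarith)
  have e : (b : Plane) - a = 0 := by
    apply plane_ext
    · have := h0.2
      simp only [PiLp.sub_apply, PiLp.zero_apply]; linarith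
    · have := h1.2
      simp only [PiLp.sub_apply, PiLp.zero_apply]; linarith
  have := (key 1 0 (by simp [e])).1
  norm_num at this

namespace Triangulation

variable {Ω : Set Plane} (𝒯 : Triangulation Ω)

lemma exists_isTri {t : Finset Plane} (ht : t ∈ 𝒯.elements) : ∃ a b c, IsTri t a b c :=
  exists_isTri_of_affineIndependent (𝒯.card_eq t ht) (𝒯.indep t ht)

lemma exists_isTri_of_mem {t : Finset Plane} (ht : t ∈ 𝒯.elements) {p q : Plane} (hp : p ∈ t)
    (hq : q ∈ t) (hpq : p ≠ q) : ∃ r, IsTri t p q r := by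
  obtain ⟨a, b, c, h⟩ := 𝒯.exists_isTri ht
  exact h.exists_third hp hq hpq

lemma exists_isTri_of_mem_left {t : Finset Plane} (ht : t ∈ 𝒯.elements) {p : Plane} (hp : p ∈ t) :
    ∃ q r, IsTri t p q r := by
  obtain ⟨a, b, c, h⟩ := 𝒯.exists_isTri ht
  rcases h.mem_iff.1 hp with rfl | rfl | rfl
  · exact ⟨_, _, h⟩
  · exact ⟨_, _, h.rotate⟩
  · exact ⟨_, _, h.rotate.rotate⟩

lemma hull_subset {t : Finset Plane} (ht : t ∈ 𝒯.elements) : hull t ⊆ closure Ω := by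
  rw [← 𝒯.covers]; exact Set.subset_biUnion_of_mem (u := fun t => hull t) ht

lemma exists_mem_hull {p : Plane} (hp : p ∈ closure Ω) : ∃ t ∈ 𝒯.elements, p ∈ hull t := by
  rw [← 𝒯.covers] at hp; simpa using hp

/-! ### Finite element functions with prescribed nodal values -/

/-- The affine interpolants on two elements agree on the common vertices, hence on their affine
span, and by conformity the intersection of the elements lies in it. The values are therefore well
defined. -/
lemma exists_fe (g : Plane → ℝ) : ∃ v : Plane → ℝ, (∀ p ∉ closure Ω, v p = 0) ∧
    ∀ t ∈ 𝒯.elements, ∀ a b c, IsTri t a b c → ∀ p ∈ hull t,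
      v p = coord a b c p * g a + coord b c a p * g b + coord c a b p * g c := by
  classical
  have hA : ∀ t ∈ 𝒯.elements, ∃ A : Plane →ᵃ[ℝ] ℝ, ∀ a ∈ t, A a = g a := by
    intro t ht
    obtain ⟨a, b, c, h⟩ := 𝒯.exists_isTri ht
    refine ⟨g a • coordAffine a b c + g b • coordAffine b c a + g c • coordAffine c a b, ?_⟩
    have e : ∀ p, (g a • coordAffine a b c + g b • coordAffine b c a +
        g c • coordAffine c a b) p = g a * coord a b c p + g b * coord b c a p +
          g c * coord c a b p := fun p => by
      simp [coordAffine_apply]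
    intro p hp
    rw [e]
    rcases h.mem_iff.1 hp with rfl | rfl | rfl
    · rw [coord_self h.ne, coord_right, coord_left]; ring
    · rw [coord_left, coord_self h.rotate.ne, coord_right]; ring
    · rw [coord_right, coord_left, coord_self h.rotate.rotate.ne]; ring
  choose! A hA using hA
  have hAA : ∀ t ∈ 𝒯.elements, ∀ t' ∈ 𝒯.elements, ∀ p ∈ hull t, p ∈ hull t' → A t p = A t' p := by
    intro t ht t' ht' p hp hp'
    have h1 : p ∈ convexHull ℝ ((t : Set Plane) ∩ t') := by
      rw [← 𝒯.conforming t ht t' ht']; exact ⟨hp, hp'⟩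
    refine AffineMap.eqOn_affineSpan (s := (t : Set Plane) ∩ t') (fun a ha => ?_)
      (convexHull_subset_affineSpan _ h1)
    rw [hA t ht a ha.1, hA t' ht' a ha.2]
  refine ⟨fun p => if h : ∃ t ∈ 𝒯.elements, p ∈ hull t then A h.choose p else 0, ?_, ?_⟩
  · intro p hp
    refine dif_neg ?_
    rintro ⟨t, ht, hpt⟩
    exact hp (𝒯.hull_subset ht hpt)
  · intro t ht a b c h p hp
    have hex : ∃ t ∈ 𝒯.elements, p ∈ hull t := ⟨t, ht, hp⟩
    simp only [dif_pos hex]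
    rw [hAA _ hex.choose_spec.1 t ht p hex.choose_spec.2 hp, affineMap_eq_coord h.ne,
      hA t ht a h.left_mem, hA t ht b h.rotate.left_mem, hA t ht c h.rotate.rotate.left_mem]

/-- The continuous piecewise linear function with nodal values `g`, extended by zero. -/
def fe (g : Plane → ℝ) : Plane → ℝ := (𝒯.exists_fe g).choose

lemma fe_of_notMem (g : Plane → ℝ) {p : Plane} (hp : p ∉ closure Ω) : 𝒯.fe g p = 0 :=
  (𝒯.exists_fe g).choose_spec.1 p hp

lemma fe_eq (g : Plane → ℝ) {t : Finset Plane} (ht : t ∈ 𝒯.elements) {a b c : Plane}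
    (h : IsTri t a b c) {p : Plane} (hp : p ∈ hull t) :
    𝒯.fe g p = coord a b c p * g a + coord b c a p * g b + coord c a b p * g c :=
  (𝒯.exists_fe g).choose_spec.2 t ht a b c h p hp

/-! ### Decomposition of integrals -/

/-- Some vertex of `t` is not one of `t'`. Its barycentric coordinate vanishes on the common
vertices, so their affine span is a proper subspace and has measure zero. -/
lemma volume_inter_hull {t t' : Finset Plane} (ht : t ∈ 𝒯.elements) (ht' : t' ∈ 𝒯.elements)
    (hne : t ≠ t') : volume (hull t ∩ hull t') = 0 := by
  have : ∃ a ∈ t, a ∉ t' := by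
    by_contra hcon
    push Not at hcon
    exact hne (Finset.eq_of_subset_of_card_le hcon (by rw [𝒯.card_eq t ht, 𝒯.card_eq t' ht']))
  obtain ⟨a, ha, ha'⟩ := this
  obtain ⟨b, c, h⟩ := 𝒯.exists_isTri_of_mem_left ht ha
  rw [𝒯.conforming t ht t' ht']
  have hzero : Set.EqOn (coordAffine a b c) (AffineMap.const ℝ Plane (0 : ℝ))
      ((t : Set Plane) ∩ t') := by
    rintro p ⟨hp, hp'⟩
    rcases h.mem_iff.1 hp with rfl | rfl | rfl
    · exact absurd hp' ha'
    · simp [coordAffine_apply, coord_left]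
    · simp [coordAffine_apply, coord_right]
  have hspan := AffineMap.eqOn_affineSpan hzero
  refine measure_mono_null (convexHull_subset_affineSpan _)
    (Measure.addHaar_affineSubspace volume _ fun htop => ?_)
  have h1 := hspan (show a ∈ ((affineSpan ℝ ((t : Set Plane) ∩ t') : AffineSubspace ℝ Plane) :
    Set Plane) by rw [htop]; trivial)
  simp [coordAffine_apply, coord_self h.ne] at h1

lemma integral_biUnion_hull {U : Finset (Finset Plane)} (hU : U ⊆ 𝒯.elements) {F : Plane → ℝ}
    (hF : IntegrableOn F (⋃ t ∈ U, hull t)) :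
    ∫ p in ⋃ t ∈ U, hull t, F p = ∑ t ∈ U, ∫ p in hull t, F p := by
  have e : ⋃ t ∈ U, hull t = ⋃ t : U, hull (t : Finset Plane) := by
    ext; simp
  rw [e] at hF ⊢
  rw [integral_iUnion_ae (fun t => (isClosed_hull _).measurableSet.nullMeasurableSet) ?_ hF,
    tsum_fintype, ← Finset.sum_coe_sort U (fun t => ∫ p in hull t, F p)]
  intro t t' htt
  exact 𝒯.volume_inter_hull (hU t.2) (hU t'.2) fun h => htt (Subtype.ext h)

end Triangulation

/-! ### Elements up to null sets -/

lemma interior_hull_ae_eq (t : Finset Plane) : (interior (hull t) : Set Plane) =ᵐ[volume] hull t :=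
  interior_ae_eq_of_null_frontier (volume_frontier_hull t)

lemma hull_ae_le {t : Finset Plane} {D : Set Plane} (h : interior (hull t) ⊆ D) :
    (hull t : Set Plane) ≤ᵐ[volume] D :=
  (interior_hull_ae_eq t).symm.le.trans h.eventuallyLE

lemma convex_unitSquare : Convex ℝ unitSquare := by
  rintro p ⟨h1, h2, h3, h4⟩ q ⟨h1', h2', h3', h4'⟩ α β hα hβ hαβ
  obtain rfl : β = 1 - α := by linarith
  refine ⟨?_, ?_, ?_, ?_⟩ <;> simp only [PiLp.add_apply, PiLp.smul_apply, smul_eq_mul] <;>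
    rcases hα.eq_or_lt with rfl | hα' <;> nlinarith

lemma volume_frontier_unitSquare : volume (frontier unitSquare) = 0 :=
  convex_unitSquare.addHaar_frontier volume

namespace Triangulation

section decomposition

variable {Ω : Set Plane} (𝒯 : Triangulation Ω)

lemma sum_setIntegral_hull_le {U : Finset (Finset Plane)} (hU : U ⊆ 𝒯.elements) {D : Set Plane}
    (hD : ∀ t ∈ U, interior (hull t) ⊆ D) {F : Plane → ℝ} (h0 : ∀ p, 0 ≤ F p)
    (hF : IntegrableOn F D) : ∑ t ∈ U, ∫ p in hull t, F p ≤ ∫ p in D, F p := by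
  have hle : (⋃ t ∈ U, hull t : Set Plane) ≤ᵐ[volume] D := by
    have : ∀ᵐ p : Plane, ∀ t ∈ U, p ∈ hull t → p ∈ D :=
      (Filter.eventually_all_finset U).2 fun t ht => hull_ae_le (hD t ht)
    filter_upwards [this] with p hp hp'
    obtain ⟨t, ht, hpt⟩ := Set.mem_iUnion₂.1 hp'
    exact hp t ht hpt
  rw [← 𝒯.integral_biUnion_hull hU (hF.mono_set_ae hle)]
  exact setIntegral_mono_set hF (Eventually.of_forall h0) hle

end decomposition

variable (𝒯 : Triangulation unitSquare)

lemma unitSquare_ae_eq : (⋃ t ∈ 𝒯.elements, hull t : Set Plane) =ᵐ[volume] unitSquare := by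
  rw [𝒯.covers]
  refine (closure_ae_eq_of_null_frontier ?_)
  exact volume_frontier_unitSquare

lemma setIntegral_unitSquare {F : Plane → ℝ} (hF : IntegrableOn F unitSquare) :
    ∫ p in unitSquare, F p = ∑ t ∈ 𝒯.elements, ∫ p in hull t, F p := by
  rw [← 𝒯.integral_biUnion_hull subset_rfl (hF.mono_set_ae 𝒯.unitSquare_ae_eq.le)]
  exact (setIntegral_congr_set 𝒯.unitSquare_ae_eq).symm

lemma restrict_hull_le {t : Finset Plane} (ht : t ∈ 𝒯.elements) :
    volume.restrict (hull t) ≤ volume.restrict unitSquare := by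
  refine Measure.restrict_mono_ae ?_
  have h : (hull t : Set Plane) ≤ᵐ[volume] (⋃ t ∈ 𝒯.elements, hull t : Set Plane) :=
    (Set.subset_biUnion_of_mem (u := fun t => hull t) ht).eventuallyLE
  exact h.trans 𝒯.unitSquare_ae_eq.le

end Triangulation

lemma setIntegral_le_sqrt_mul_sqrt {s : Set Plane} (hs : volume s ≠ ⊤) {F : Plane → ℝ}
    (hF : MemLp F 2 (volume.restrict s)) (h0 : ∀ p, 0 ≤ F p) :
    ∫ p in s, F p ≤ Real.sqrt (area s) * Real.sqrt (∫ p in s, F p ^ 2) := by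
  have : IsFiniteMeasure (volume.restrict s) := ⟨by simpa using hs.lt_top⟩
  have := integral_mul_le_Lp_mul_Lq_of_nonneg (μ := volume.restrict s) Real.HolderConjugate.two_two
    (f := fun _ => 1) (g := F) (Eventually.of_forall fun _ => zero_le_one)
    (Eventually.of_forall h0) (by simpa using memLp_const 1) (by simpa using hF)
  rw [area, Real.sqrt_eq_rpow, Real.sqrt_eq_rpow]
  simpa using this

/-! ### Gradients of piecewise linear functions -/

lemma gradient_eq_of_eqOn_affine {v : Plane → ℝ} {A : Plane →ᵃ[ℝ] ℝ} {s : Set Plane}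
    (h : Set.EqOn v A s) {p : Plane} (hp : p ∈ interior s) :
    gradient v p = (InnerProductSpace.toDual ℝ Plane).symm A.linear.toContinuousLinearMap := by
  have e : v =ᶠ[𝓝 p] A :=
    Filter.eventuallyEq_of_mem (mem_interior_iff_mem_nhds.1 hp) h
  have hA : HasFDerivAt A A.linear.toContinuousLinearMap p := by
    have h1 : (A : Plane → ℝ) = fun q => A.linear.toContinuousLinearMap q + A 0 := by
      ext q
      have := A.map_vadd 0 q
      simpa using this
    rw [h1]
    exact A.linear.toContinuousLinearMap.hasFDerivAt.add_const _
  rw [gradient, e.fderiv_eq, hA.fderiv]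

namespace Triangulation

variable {Ω : Set Plane} {𝒯 : Triangulation Ω} {v : Plane → ℝ}

lemma IsPiecewiseLinear.gradient_eq (hv : 𝒯.IsPiecewiseLinear v) {t : Finset Plane}
    (ht : t ∈ 𝒯.elements) {p : Plane} (hp : p ∈ interior (hull t)) :
    gradient v p = gradient v (bary t) := by
  obtain ⟨A, hA⟩ := hv.2 t ht
  obtain ⟨a, b, c, h⟩ := 𝒯.exists_isTri ht
  rw [gradient_eq_of_eqOn_affine hA hp, gradient_eq_of_eqOn_affine hA h.bary_mem_interior]

lemma IsPiecewiseLinear.sub_eq (hv : 𝒯.IsPiecewiseLinear v) {t : Finset Plane}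
    (ht : t ∈ 𝒯.elements) {p q : Plane} (hp : p ∈ hull t) (hq : q ∈ hull t) :
    v p - v q = ⟪gradient v (bary t), p - q⟫ := by
  obtain ⟨A, hA⟩ := hv.2 t ht
  obtain ⟨a, b, c, h⟩ := 𝒯.exists_isTri ht
  rw [gradient_eq_of_eqOn_affine hA h.bary_mem_interior, hA hp, hA hq]
  have := A.linearMap_vsub p q
  simpa using this.symm

end Triangulation

lemma gradient_inner_eq {v P : Plane → ℝ} {P' : Plane →L[ℝ] ℝ} {s : Set Plane}
    (h : Set.EqOn v P s) {p : Plane} (hp : p ∈ interior s) (hP : HasFDerivAt P P' p) (w : Plane) :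
    ⟪w, gradient v p⟫ = P' w := by
  have e : v =ᶠ[𝓝 p] P := Filter.eventuallyEq_of_mem (mem_interior_iff_mem_nhds.1 hp) h
  rw [real_inner_comm, inner_gradient_left, e.fderiv_eq, hP.fderiv]

/-! ### The residual -/

/-- A test function: it vanishes off the square, and on each element it is `C¹`. -/
structure IsTest (𝒯 : Triangulation unitSquare) (v : Plane → ℝ) (G : Finset Plane → Plane)
    (B I : Finset Plane → ℝ) : Prop where
  zero : ∀ p ∉ unitSquare, v p = 0
  smooth : ∀ t ∈ 𝒯.elements, ∃ (P : Plane → ℝ) (P' : Plane → Plane →L[ℝ] ℝ),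
    (∀ p, HasFDerivAt P (P' p) p) ∧ Continuous P' ∧ Set.EqOn v P (hull t) ∧
    (∀ p ∈ hull t, ‖P' p‖ ≤ B t) ∧ ∫ p in hull t, P' p (G t) = I t

section residual

variable {𝒯 : Triangulation unitSquare} {v : Plane → ℝ} {G : Finset Plane → Plane}
  {B I : Finset Plane → ℝ}

/-- On each closed element the gradient bound and convexity give a Lipschitz estimate; together with
the complement of the square, where `v = 0`, the elements form a finite closed cover of the plane.
-/
lemma IsTest.lipschitz (h : IsTest 𝒯 v G B I) : ∃ L : NNReal, LipschitzWith L v := by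
  have hpos : ∀ t ∈ 𝒯.elements, B t ≤ ∑ s ∈ 𝒯.elements, |B s| := fun t ht =>
    (le_abs_self _).trans (Finset.single_le_sum (f := fun s => |B s|) (fun _ _ => abs_nonneg _) ht)
  refine ⟨⟨∑ s ∈ 𝒯.elements, |B s|, Finset.sum_nonneg fun _ _ => abs_nonneg _⟩, ?_⟩
  refine lipschitzWith_of_closed_cover (𝒜 := insert unitSquareᶜ ((fun t => hull t) '' 𝒯.elements))
    (((𝒯.elements.finite_toSet.image _)).insert _) ?_ ?_ ?_
  · ext p
    simp only [Set.mem_sUnion, Set.mem_univ, iff_true]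
    by_cases hp : p ∈ unitSquare
    · obtain ⟨t, ht, hpt⟩ := 𝒯.exists_mem_hull (subset_closure hp)
      exact ⟨hull t, Or.inr ⟨t, ht, rfl⟩, hpt⟩
    · exact ⟨_, Or.inl rfl, hp⟩
  · rintro A (rfl | ⟨t, _, rfl⟩)
    · exact isOpen_unitSquare.isClosed_compl
    · exact isClosed_hull t
  · rintro A (rfl | ⟨t, ht, rfl⟩)
    · refine LipschitzOnWith.of_dist_le_mul fun p hp q hq => ?_
      rw [h.zero p hp, h.zero q hq, dist_self]
      exact mul_nonneg NNReal.zero_le_coe dist_nonneg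
    · obtain ⟨P, P', hP, -, hvP, hB, -⟩ := h.smooth t ht
      have := Convex.lipschitzOnWith_of_nnnorm_hasFDerivWithin_le (f := P) (f' := P')
        (C := ⟨∑ s ∈ 𝒯.elements, |B s|, Finset.sum_nonneg fun _ _ => abs_nonneg _⟩)
        (fun p _ => (hP p).hasFDerivWithinAt)
        (fun p hp => NNReal.coe_le_coe.1 ((hB p hp).trans (hpos t ht))) (convex_hull t)
      intro p hp q hq
      rw [hvP hp, hvP hq]
      exact this hp hq

/-- The frontiers of the elements are null sets. Elsewhere `v` coincides locally with a `C¹`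
function or with zero. -/
lemma IsTest.ae_hasStrictFDerivAt (h : IsTest 𝒯 v G B I) :
    ∀ᵐ p, ∃ v' : Plane →L[ℝ] ℝ, HasStrictFDerivAt v v' p := by
  have : ∀ᵐ p : Plane, ∀ t ∈ 𝒯.elements, p ∉ frontier (hull t) :=
    (Filter.eventually_all_finset _).2 fun t _ =>
      measure_eq_zero_iff_ae_notMem.1 (volume_frontier_hull t)
  filter_upwards [this] with p hp
  by_cases hpc : p ∈ closure unitSquare
  · obtain ⟨t, ht, hpt⟩ := 𝒯.exists_mem_hull hpc
    have hint : p ∈ interior (hull t) := by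
      by_contra hcon
      exact hp t ht ⟨subset_closure hpt, hcon⟩
    obtain ⟨P, P', hP, hP', hvP, -, -⟩ := h.smooth t ht
    have e : P =ᶠ[𝓝 p] v :=
      Filter.eventuallyEq_of_mem (mem_interior_iff_mem_nhds.1 hint) hvP.symm
    exact ⟨P' p, (hasStrictFDerivAt_of_hasFDerivAt_of_continuousAt
      (Eventually.of_forall hP) hP'.continuousAt).congr_of_eventuallyEq e⟩
  · have e : (fun _ : Plane => (0 : ℝ)) =ᶠ[𝓝 p] v := by
      filter_upwards [isClosed_closure.isOpen_compl.mem_nhds hpc] with q hq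
      exact (h.zero q fun hq' => hq (subset_closure hq')).symm
    exact ⟨0, (hasStrictFDerivAt_const 0 p).congr_of_eventuallyEq e⟩

lemma IsTest.isH10 (h : IsTest 𝒯 v G B I) : IsH10 unitSquare v (gradient v) := by
  obtain ⟨L, hL⟩ := h.lipschitz
  exact isH10_of_lipschitz hL h.zero h.ae_hasStrictFDerivAt

/-- The weak equation replaces `∫ f v` by `∫ ∇u·∇v`, after which each element contributes `∫ ∇v·(∇u
- G)`, estimated by `B t` and the Cauchy–Schwarz inequality. The Galerkin equation plays no part. -/
theorem IsTest.residual_le (h : IsTest 𝒯 v G B I) {f u : Plane → ℝ} {gu : Plane → Plane}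
    (hf : AEStronglyMeasurable f (volume.restrict unitSquare))
    (hfb : ∃ B : ℝ, ∀ p ∈ closure unitSquare, |f p| ≤ B)
    (hu : IsWeakSolution unitSquare f u gu) :
    |∑ t ∈ 𝒯.elements, ((∫ p in hull t, f p * v p) - I t)| ≤
      ∑ t ∈ 𝒯.elements, B t * (Real.sqrt (area (hull t)) *
        Real.sqrt (∫ p in hull t, ‖G t - gu p‖ ^ 2)) := by
  obtain ⟨L, hL⟩ := h.lipschitz
  have hH := h.isH10
  have hfin : IsFiniteMeasure (volume.restrict unitSquare) :=
    ⟨by simpa using volume_unitSquare_ne_top.lt_top⟩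
  have hgu : MemLp gu 2 (volume.restrict unitSquare) := hu.1.2.1
  have hgui : IntegrableOn gu unitSquare := hgu.integrable one_le_two
  have hvc : Continuous v := hL.continuous
  have hfi : IntegrableOn f unitSquare := by
    obtain ⟨C, hC⟩ := hfb
    refine Integrable.of_bound hf C ?_
    filter_upwards [ae_restrict_mem isOpen_unitSquare.measurableSet] with p hp
    exact hC p (subset_closure hp)
  have hvb : ∃ C, ∀ p, ‖v p‖ ≤ C := by
    have hc : HasCompactSupport v :=
      (HasCompactSupport.intro (isCompact_closedBall (0 : Plane) 2)) fun p hp =>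
        h.zero p fun h => hp (unitSquare_subset_closedBall h)
    exact hc.exists_bound_of_continuous hvc
  have hfv : IntegrableOn (fun p => f p * v p) unitSquare := by
    obtain ⟨C, hC⟩ := hvb
    exact hfi.mul_bdd (c := C) hvc.aestronglyMeasurable (Eventually.of_forall hC)
  have hgv : ∀ p, ‖gradient v p‖ ≤ L := fun p => by
    have : ‖gradient v p‖ = ‖fderiv ℝ v p‖ := by simp [gradient]
    rw [this]; exact norm_fderiv_le_of_lipschitz ℝ hL
  have hguv : IntegrableOn (fun p => ⟪gu p, gradient v p⟫) unitSquare := by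
    refine Integrable.mono' (hgui.norm.mul_const L) (hgu.1.inner hH.2.1.1) ?_
    refine Eventually.of_forall fun p => ?_
    rw [Real.norm_eq_abs]
    exact (abs_real_inner_le_norm _ _).trans
      (mul_le_mul_of_nonneg_left (hgv p) (norm_nonneg _))
  have key := hu.2 v (gradient v) hH
  rw [𝒯.setIntegral_unitSquare hfv, 𝒯.setIntegral_unitSquare hguv] at key
  rw [Finset.sum_sub_distrib, ← key, ← Finset.sum_sub_distrib]
  refine (Finset.abs_sum_le_sum_abs _ _).trans (Finset.sum_le_sum fun t ht => ?_)
  obtain ⟨P, P', hP, hP', hvP, hB, hI⟩ := h.smooth t ht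
  have hfint : IsFiniteMeasure (volume.restrict (hull t)) :=
    ⟨by simpa using (isCompact_hull t).measure_lt_top⟩
  have hgut : MemLp gu 2 (volume.restrict (hull t)) := hgu.mono_measure (𝒯.restrict_hull_le ht)
  have hGgu : MemLp (fun p => G t - gu p) 2 (volume.restrict (hull t)) :=
    (memLp_const (G t)).sub hgut
  have e1 : ∫ p in hull t, ⟪gu p, gradient v p⟫ = ∫ p in hull t, P' p (gu p) := by
    rw [← setIntegral_congr_set (interior_hull_ae_eq t),
      ← setIntegral_congr_set (interior_hull_ae_eq t)]
    refine setIntegral_congr_fun isOpen_interior.measurableSet fun p hp => ?_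
    exact gradient_inner_eq hvP hp (hP p) (gu p)
  have hPm : ∀ {w : Plane → Plane}, MemLp w 2 (volume.restrict (hull t)) →
      IntegrableOn (fun p => P' p (w p)) (hull t) := by
    intro w hw
    refine Integrable.mono' ((hw.integrable one_le_two).norm.const_mul (B t)) ?_ ?_
    · exact (isBoundedBilinearMap_apply (𝕜 := ℝ) (E := Plane) (F := ℝ)).continuous
        |>.comp_aestronglyMeasurable (hP'.aestronglyMeasurable.prodMk hw.1)
    · filter_upwards [ae_restrict_mem (isClosed_hull t).measurableSet] with p hp
      exact ((P' p).le_opNorm _).trans (mul_le_mul_of_nonneg_right (hB p hp) (norm_nonneg _))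
  have hB0 : 0 ≤ B t := by
    obtain ⟨a, b, c, habc⟩ := 𝒯.exists_isTri ht
    exact (norm_nonneg _).trans (hB a (subset_hull t habc.left_mem))
  rw [e1, ← hI, ← integral_sub (hPm hgut) (hPm (memLp_const (G t))), ← Real.norm_eq_abs]
  calc ‖∫ p in hull t, (P' p (gu p) - P' p (G t))‖
      ≤ ∫ p in hull t, B t * ‖G t - gu p‖ := by
        refine norm_integral_le_of_norm_le ((hGgu.integrable one_le_two).norm.const_mul (B t)) ?_
        filter_upwards [ae_restrict_mem (isClosed_hull t).measurableSet] with p hp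
        rw [← map_sub, norm_sub_rev (G t)]
        exact ((P' p).le_opNorm _).trans (mul_le_mul_of_nonneg_right (hB p hp) (norm_nonneg _))
    _ = B t * ∫ p in hull t, ‖G t - gu p‖ := integral_const_mul _ _
    _ ≤ _ := mul_le_mul_of_nonneg_left (setIntegral_le_sqrt_mul_sqrt
        (isCompact_hull t).measure_lt_top.ne hGgu.norm (fun _ => norm_nonneg _)) hB0

end residual

/-! ### Sizes and normals -/

lemma norm_sq_plane (u : Plane) : ‖u‖ ^ 2 = u 0 ^ 2 + u 1 ^ 2 := by
  rw [EuclideanSpace.norm_sq_eq, Fin.sum_univ_two]; simp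

lemma inner_plane (u v : Plane) : ⟪u, v⟫ = u 0 * v 0 + u 1 * v 1 := by
  simp [PiLp.inner_apply, Fin.sum_univ_two]; ring

lemma abs_cross_le (u v : Plane) : |cross u v| ≤ ‖u‖ * ‖v‖ := by
  refine abs_le_of_sq_le_sq ?_ (by positivity)
  rw [mul_pow, norm_sq_plane, norm_sq_plane, cross_apply]
  nlinarith [sq_nonneg (u 0 * v 0 + u 1 * v 1)]

lemma norm_dcoord_le (a b c : Plane) : ‖dcoord a b c‖ ≤ dist b c / |dblArea a b c| := by
  refine ContinuousLinearMap.opNorm_le_bound _ (by positivity) fun v => ?_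
  rw [dcoord, smul_apply, smul_eq_mul, Real.norm_eq_abs, abs_mul, abs_inv, dist_comm, dist_eq_norm,
    div_mul_eq_mul_div, inv_mul_eq_div]
  gcongr
  exact abs_cross_le _ _

/-- Rotation of the plane by a right angle. -/
def rot (u : Plane) : Plane := !₂[-u 1, u 0]

lemma inner_rot (u v : Plane) : ⟪rot u, v⟫ = cross u v := by
  rw [inner_plane, cross_apply]; simp [rot]; ring

lemma norm_rot (u : Plane) : ‖rot u‖ = ‖u‖ := by
  rw [← sq_eq_sq₀ (norm_nonneg _) (norm_nonneg _), norm_sq_plane, norm_sq_plane]; simp [rot]; ring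

namespace IsTri

variable {t e : Finset Plane} {a b c : Plane}

lemma outwardNormal_eq (h : IsTri t a b c) (he : (e : Set Plane) = {a, b}) :
    outwardNormal t e = -(dblArea a b c / |dblArea a b c| / dist a b) • rot (b - a) := by
  classical
  have hab : a ≠ b := h.left_ne
  have hn : 0 < ‖b - a‖ := norm_pos_iff.2 (sub_ne_zero.2 hab.symm)
  have he' : e = {a, b} := by ext; rw [← Finset.mem_coe, he]; simp
  have hbe : bary e = (2 : ℝ)⁻¹ • (a + b) := by
    rw [bary, he', Finset.sum_pair hab, Finset.card_pair hab]; norm_num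
  set D := dblArea a b c with hD
  have hD0 : D ≠ 0 := h.ne
  have hW : (vectorSpan ℝ (e : Set Plane))ᗮ.starProjection (bary e - bary t) =
      -(D / (3 * ‖b - a‖ ^ 2)) • rot (b - a) := by
    have hspan : vectorSpan ℝ (e : Set Plane) = Submodule.span ℝ {b - a} := by
      rw [he, vectorSpan_pair_rev]; rfl
    rw [hspan]
    refine (Submodule.eq_starProjection_of_mem_of_inner_eq_zero ?_ ?_)
    · refine Submodule.smul_mem _ _ ?_
      rw [Submodule.mem_orthogonal_singleton_iff_inner_left, inner_rot, cross_apply]; ring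
    · intro w hw
      have hw0 := Submodule.mem_orthogonal_singleton_iff_inner_right.1 hw
      -- `w` is a multiple of the rotated edge vector
      rw [inner_plane] at hw0
      have hn2 := norm_sq_plane (b - a)
      have hn2' : ‖b - a‖ ^ 2 ≠ 0 := by positivity
      have hwr : w = (cross (b - a) w / ‖b - a‖ ^ 2) • rot (b - a) := by
        apply plane_ext
        · simp only [PiLp.smul_apply, smul_eq_mul, rot, cross_apply, Matrix.cons_val_zero]
          rw [div_mul_eq_mul_div, eq_div_iff hn2', hn2]
          linear_combination (b - a) 0 * hw0
        · simp only [PiLp.smul_apply, smul_eq_mul, rot, cross_apply, Matrix.cons_val_one,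
            Matrix.cons_val_fin_one]
          rw [div_mul_eq_mul_div, eq_div_iff hn2', hn2]
          linear_combination (b - a) 1 * hw0
      rw [hwr, inner_smul_right, real_inner_comm, inner_rot]
      refine mul_eq_zero_of_right _ ?_
      have hrr : cross (b - a) (rot (b - a)) = ‖b - a‖ ^ 2 := by
        rw [hn2, cross_apply]; simp [rot]; ring
      rw [map_sub, map_smul, hrr, hbe, h.bary_eq, smul_eq_mul, neg_mul, sub_neg_eq_add]
      have h1 : cross (b - a) ((2 : ℝ)⁻¹ • (a + b) - (3 : ℝ)⁻¹ • (a + b + c)) = - D / 3 := by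
        rw [hD, dblArea_eq, cross_apply]
        simp only [PiLp.sub_apply, PiLp.smul_apply, PiLp.add_apply, smul_eq_mul]
        ring
      rw [h1]; field_simp; ring
  rw [outwardNormal]
  simp only [hW]
  rw [norm_smul, norm_rot, smul_smul, norm_neg, Real.norm_eq_abs, abs_div,
    abs_of_pos (show (0:ℝ) < 3 * ‖b - a‖ ^ 2 by positivity), dist_comm, dist_eq_norm]
  congr 1
  have : |D| ≠ 0 := abs_ne_zero.2 hD0
  field_simp

/-- The gradient of the coordinate of the vertex opposite `e` is the inward normal divided by the
height. This converts integrals of `∇v·G` into normal derivatives on `e`. -/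
lemma dcoord_eq_inner (h : IsTri t a b c) (he : (e : Set Plane) = {a, b}) (w : Plane) :
    dcoord c a b w = -(dist a b / (2 * area (hull t))) * ⟪w, outwardNormal t e⟫ := by
  rw [h.outwardNormal_eq he, inner_smul_right, real_inner_comm, inner_rot, dcoord,
    smul_apply, smul_eq_mul, h.area_eq, ← dblArea_rotate c a b]
  have h1 : dblArea a b c ≠ 0 := h.ne
  have h2 : |dblArea a b c| ≠ 0 := abs_ne_zero.2 h1
  have h3 : dist a b ≠ 0 := dist_ne_zero.2 h.left_ne
  field_simp
  rw [sq_abs]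
  ring

lemma dist_le_bigH (h : IsTri t a b c) : dist a b ≤ bigH t :=
  Metric.dist_le_diam_of_mem (isCompact_hull t).isBounded (subset_hull t h.left_mem)
    (subset_hull t h.rotate.left_mem)

lemma bigH_pos (h : IsTri t a b c) : 0 < bigH t :=
  (dist_pos.2 h.left_ne).trans_le h.dist_le_bigH

lemma norm_dcoord_le (h : IsTri t a b c) : ‖dcoord a b c‖ ≤ bigH t / (2 * area (hull t)) := by
  refine (AnisoFEM.norm_dcoord_le a b c).trans ?_
  rw [h.area_eq, mul_div_cancel₀ _ two_ne_zero]
  gcongr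
  exact h.rotate.dist_le_bigH

lemma two_mul_area_le (h : IsTri t a b c) : 2 * area (hull t) ≤ bigH t ^ 2 := by
  rw [h.area_eq, mul_div_cancel₀ _ two_ne_zero, sq]
  refine (abs_cross_le _ _).trans ?_
  rw [← dist_eq_norm, ← dist_eq_norm, dist_comm, dist_comm c]
  exact mul_le_mul h.dist_le_bigH h.swap_right.dist_le_bigH dist_nonneg h.bigH_pos.le

lemma bigH_le (h : IsTri t a b c) {d : ℝ} (h1 : dist a b ≤ d) (h2 : dist b c ≤ d)
    (h3 : dist c a ≤ d) : bigH t ≤ d := by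
  rw [bigH, hull, convexHull_diam, h.coe]
  have hd : 0 ≤ d := dist_nonneg.trans h1
  refine Metric.diam_le_of_forall_dist_le hd ?_
  rintro x (rfl | rfl | rfl) y (rfl | rfl | rfl) <;> first
    | (rw [dist_self]; exact hd) | assumption | (rw [dist_comm]; assumption)

lemma integral_cubic (h : IsTri t a b c) {F : Plane → ℝ} (k0 k1 k2 k3 k4 k5 k6 k7 k8 k9 : ℝ)
    (hF : ∀ p, F p = k0 + k1 * coord a b c p + k2 * coord b c a p +
      k3 * coord a b c p ^ 2 + k4 * (coord a b c p * coord b c a p) + k5 * coord b c a p ^ 2 +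
      k6 * coord a b c p ^ 3 + k7 * (coord a b c p ^ 2 * coord b c a p) +
      k8 * (coord a b c p * coord b c a p ^ 2) + k9 * coord b c a p ^ 3) :
    ∫ p in hull t, F p = area (hull t) *
    (k0 + k1 / 3 + k2 / 3 + k3 / 6 + k4 / 12 + k5 / 6 + k6 / 10 + k7 / 30 + k8 / 30 +
      k9 / 10) := by
  simp_rw [hF]
  rw [h.hull_eq, integral_triangle_cubic h.ne]

lemma coord_third (h : IsTri t a b c) (p : Plane) :
    coord c a b p = 1 - coord a b c p - coord b c a p := by
  linarith [coord_add h.ne p]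

lemma dcoord_third (h : IsTri t a b c) : dcoord c a b = - dcoord a b c - dcoord b c a := by
  rw [eq_sub_iff_add_eq, eq_neg_iff_add_eq_zero, ← dcoord_add h.ne]; abel

lemma coord_mem_Icc (h : IsTri t a b c) {p : Plane} (hp : p ∈ hull t) :
    0 ≤ coord a b c p ∧ coord a b c p ≤ 1 :=
  ⟨(h.mem_hull_iff.1 hp).1, coord_le_one h.ne (h.hull_eq ▸ hp)⟩

end IsTri

/-! ### Oscillation -/

lemma abs_sub_le_osc {f : Plane → ℝ} {D : Set Plane} {B : ℝ} (hB : ∀ p ∈ D, |f p| ≤ B)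
    {p q : Plane} (hp : p ∈ D) (hq : q ∈ D) : |f p - f q| ≤ osc f D := by
  have ha : BddAbove (f '' D) := ⟨B, by rintro _ ⟨r, hr, rfl⟩; exact (abs_le.1 (hB r hr)).2⟩
  have hb : BddBelow (f '' D) := ⟨-B, by rintro _ ⟨r, hr, rfl⟩; exact (abs_le.1 (hB r hr)).1⟩
  have h1 := le_csSup ha ⟨p, hp, rfl⟩
  have h2 := le_csSup ha ⟨q, hq, rfl⟩
  have h3 := csInf_le hb ⟨p, hp, rfl⟩
  have h4 := csInf_le hb ⟨q, hq, rfl⟩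
  rw [osc, abs_le]; constructor <;> linarith

/-- The data of the continuous problem used in the estimates: the right-hand side is bounded and
measurable. -/
structure IsData (f : Plane → ℝ) : Prop where
  meas : AEStronglyMeasurable f (volume.restrict unitSquare)
  bdd : ∃ B : ℝ, ∀ p ∈ closure unitSquare, |f p| ≤ B

/-- The square of the local error and data oscillation on an element. -/
def etaSq (f uh : Plane → ℝ) (gu : Plane → Plane) (t : Finset Plane) : ℝ :=
  (∫ p in hull t, ‖gradient uh (bary t) - gu p‖ ^ 2) +
    bigH t ^ 2 * osc f (hull t) ^ 2 * area (hull t)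

lemma etaSq_nonneg (f uh : Plane → ℝ) (gu : Plane → Plane) (t : Finset Plane) :
    0 ≤ etaSq f uh gu t := by
  refine add_nonneg (integral_nonneg fun _ => by positivity) ?_
  exact mul_nonneg (by positivity) measureReal_nonneg

lemma sqrt_integral_le_eta (f uh : Plane → ℝ) (gu : Plane → Plane) (t : Finset Plane) :
    Real.sqrt (∫ p in hull t, ‖gradient uh (bary t) - gu p‖ ^ 2) ≤ Real.sqrt (etaSq f uh gu t) := by
  refine Real.sqrt_le_sqrt ?_
  rw [etaSq]
  exact le_add_of_nonneg_right (mul_nonneg (by positivity) measureReal_nonneg)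

lemma bigH_mul_osc_le_eta (f uh : Plane → ℝ) (gu : Plane → Plane) (t : Finset Plane) :
    bigH t * osc f (hull t) * Real.sqrt (area (hull t)) ≤ Real.sqrt (etaSq f uh gu t) := by
  refine Real.le_sqrt_of_sq_le ?_
  rw [mul_pow, mul_pow, Real.sq_sqrt (show 0 ≤ area (hull t) from measureReal_nonneg), etaSq]
  exact le_add_of_nonneg_left (integral_nonneg fun _ => by positivity)

section osc

variable {𝒯 : Triangulation unitSquare} {f : Plane → ℝ} {t : Finset Plane}

lemma IsData.osc_bound (hf : IsData f) (ht : t ∈ 𝒯.elements) {p q : Plane} (hp : p ∈ hull t)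
    (hq : q ∈ hull t) : |f p - f q| ≤ osc f (hull t) := by
  obtain ⟨B, hB⟩ := hf.bdd
  exact abs_sub_le_osc (fun r hr => hB r (𝒯.hull_subset ht hr)) hp hq

lemma IsData.osc_nonneg (hf : IsData f) (ht : t ∈ 𝒯.elements) : 0 ≤ osc f (hull t) := by
  obtain ⟨a, b, c, h⟩ := 𝒯.exists_isTri ht
  exact (abs_nonneg _).trans (hf.osc_bound ht (subset_hull t h.left_mem) (subset_hull t h.left_mem))

lemma IsData.abs_integral_sub_le (hf : IsData f) (ht : t ∈ 𝒯.elements) {z : Plane}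
    (hz : z ∈ hull t) {v : Plane → ℝ} (hv : ContinuousOn v (hull t)) {V : ℝ}
    (hV : ∀ p ∈ hull t, |v p| ≤ V) :
    |(∫ p in hull t, f p * v p) - f z * ∫ p in hull t, v p| ≤
      osc f (hull t) * V * area (hull t) := by
  have hfin : IsFiniteMeasure (volume.restrict (hull t)) :=
    ⟨by simpa using (isCompact_hull t).measure_lt_top⟩
  have hvi : IntegrableOn v (hull t) := hv.integrableOn_compact (isCompact_hull t)
  have hfi : IntegrableOn (fun p => f p * v p) (hull t) := by
    obtain ⟨C, hC⟩ := hf.bdd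
    refine Integrable.bdd_mul (c := C) hvi (hf.meas.mono_measure (𝒯.restrict_hull_le ht)) ?_
    filter_upwards [ae_restrict_mem (isClosed_hull t).measurableSet] with p hp
    exact hC p (𝒯.hull_subset ht hp)
  rw [← integral_const_mul, ← integral_sub hfi (hvi.const_mul _), ← Real.norm_eq_abs]
  refine norm_setIntegral_le_of_norm_le_const (isCompact_hull t).measure_lt_top fun p hp => ?_
  rw [← sub_mul, Real.norm_eq_abs, abs_mul]
  exact mul_le_mul (hf.osc_bound ht hp hz) (hV p hp) (abs_nonneg _) (hf.osc_nonneg ht)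

end osc

/-! ### Interior points -/

-- Convexity of the square reduces the position of a point relative to the boundary to the signs of
-- the weights of its convex combinations.
lemma interior_closure_unitSquare : interior (closure unitSquare) = unitSquare := by
  rw [convex_unitSquare.interior_closure_eq_interior_of_nonempty_interior,
    isOpen_unitSquare.interior_eq]
  rw [isOpen_unitSquare.interior_eq]
  exact ⟨!₂[1/2, 1/2], by norm_num [unitSquare]⟩

lemma combo_mem_unitSquare {x y : Plane} (hx : x ∈ unitSquare) (hy : y ∈ closure unitSquare)
    {r s : ℝ} (hr : 0 < r) (hs : 0 ≤ s) (hrs : r + s = 1) : r • x + s • y ∈ unitSquare := by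
  have := convex_unitSquare.combo_interior_closure_mem_interior
    (by rwa [isOpen_unitSquare.interior_eq]) hy hr hs hrs
  rwa [isOpen_unitSquare.interior_eq] at this

namespace Triangulation

variable (𝒯 : Triangulation unitSquare)

lemma interior_hull_subset {t : Finset Plane} (ht : t ∈ 𝒯.elements) :
    interior (hull t) ⊆ unitSquare := by
  have := interior_mono (𝒯.hull_subset ht)
  rwa [interior_closure_unitSquare] at this

lemma vertex_mem_closure {t : Finset Plane} (ht : t ∈ 𝒯.elements) {a : Plane} (ha : a ∈ t) :
    a ∈ closure unitSquare := 𝒯.hull_subset ht (subset_hull t ha)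

/-- A convex combination of vertices with a positive weight at an interior node is interior. -/
lemma mem_of_coord_pos {t : Finset Plane} (ht : t ∈ 𝒯.elements) {a b c : Plane} (h : IsTri t a b c)
    {p : Plane} (hp : p ∈ hull t) (ha : a ∈ unitSquare) (hpos : 0 < coord a b c p) :
    p ∈ unitSquare := by
  obtain ⟨h1, h2, h3⟩ := h.mem_hull_iff.1 hp
  have hsum := coord_add h.ne p
  rw [eq_coord_smul h.ne p]
  rcases (add_nonneg h2 h3).eq_or_lt with h0 | h0
  · have e2 : coord b c a p = 0 := by linarith
    have e3 : coord c a b p = 0 := by linarith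
    have e1 : coord a b c p = 1 := by linarith
    rw [e1, e2, e3]; simpa using ha
  · set m := coord b c a p + coord c a b p
    have hy : (coord b c a p / m) • b + (coord c a b p / m) • c ∈ closure unitSquare :=
      convex_unitSquare.closure (𝒯.vertex_mem_closure ht h.rotate.left_mem)
        (𝒯.vertex_mem_closure ht h.rotate.rotate.left_mem) (by positivity) (by positivity)
        (by rw [← add_div]; exact div_self h0.ne')
    have := combo_mem_unitSquare ha hy hpos h0.le (by simp only [m]; linarith)
    rw [smul_add, smul_smul, smul_smul, mul_div_cancel₀ _ h0.ne', mul_div_cancel₀ _ h0.ne',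
      ← add_assoc] at this
    exact this

/-- A convex combination of vertices with positive weights at the ends of an interior edge is
interior. -/
lemma mem_of_coord_pos_of_edge {t : Finset Plane} (ht : t ∈ 𝒯.elements) {a b c : Plane}
    (h : IsTri t a b c) {p : Plane} (hp : p ∈ hull t) (hab : openSegment ℝ a b ⊆ unitSquare)
    (h1 : 0 < coord a b c p) (h2 : 0 < coord b c a p) : p ∈ unitSquare := by
  obtain ⟨-, -, h3⟩ := h.mem_hull_iff.1 hp
  have hsum := coord_add h.ne p
  rw [eq_coord_smul h.ne p]
  set m := coord a b c p + coord b c a p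
  have hm : 0 < m := add_pos h1 h2
  have hx : (coord a b c p / m) • a + (coord b c a p / m) • b ∈ unitSquare :=
    hab ⟨_, _, by positivity, by positivity, by rw [← add_div]; exact div_self hm.ne', rfl⟩
  have := combo_mem_unitSquare hx (𝒯.vertex_mem_closure ht h.rotate.rotate.left_mem) hm h3
    (by simp only [m]; linarith)
  rwa [smul_add, smul_smul, smul_smul, mul_div_cancel₀ _ hm.ne', mul_div_cancel₀ _ hm.ne'] at this

/-! ### Hat functions -/

open Classical in
/-- The nodal basis function of the node `z`. -/
def hat (z : Plane) : Plane → ℝ := 𝒯.fe fun q => if q = z then 1 else 0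

lemma hat_eq_coord {t : Finset Plane} (ht : t ∈ 𝒯.elements) {a b c : Plane} (h : IsTri t a b c)
    {p : Plane} (hp : p ∈ hull t) : 𝒯.hat a p = coord a b c p := by
  rw [hat, 𝒯.fe_eq _ ht h hp, if_pos rfl, if_neg h.left_ne.symm, if_neg h.left_ne_right.symm]; ring

lemma hat_eq_zero {t : Finset Plane} (ht : t ∈ 𝒯.elements) {z : Plane} (hz : z ∉ t)
    {p : Plane} (hp : p ∈ hull t) : 𝒯.hat z p = 0 := by
  obtain ⟨a, b, c, h⟩ := 𝒯.exists_isTri ht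
  have ha : a ≠ z := fun e => hz (e ▸ h.left_mem)
  have hb : b ≠ z := fun e => hz (e ▸ h.rotate.left_mem)
  have hc : c ≠ z := fun e => hz (e ▸ h.rotate.rotate.left_mem)
  rw [hat, 𝒯.fe_eq _ ht h hp, if_neg ha, if_neg hb, if_neg hc]; ring

lemma hat_of_notMem (z : Plane) {p : Plane} (hp : p ∉ closure unitSquare) : 𝒯.hat z p = 0 :=
  𝒯.fe_of_notMem _ hp

/-! ### The element estimate -/

lemma sub_of_mem {t T : Finset Plane} (ht : t ∈ 𝒯.elements) {a b c : Plane} (h : IsTri T a b c)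
    (ha : a ∈ t) (hb : b ∈ t) (hc : c ∈ t) : T = t := by
  refine Finset.eq_of_subset_of_card_le (fun p hp => ?_) (by rw [h.card_eq, 𝒯.card_eq t ht])
  rcases h.mem_iff.1 hp with rfl | rfl | rfl <;> assumption

-- The element bubble vanishes on the boundary of `T` and `G T` is constant, which is why all the
-- integrals `I` are zero. The factor 3 counts the terms of the product rule.
open Classical in
lemma isTest_elementBubble {T : Finset Plane} (hT : T ∈ 𝒯.elements) {a b c : Plane}
    (h : IsTri T a b c) (G : Finset Plane → Plane) :
    IsTest 𝒯 (fun p => 𝒯.hat a p * 𝒯.hat b p * 𝒯.hat c p) G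
      (fun t => if t = T then 3 * (bigH T / (2 * area (hull T))) else 0) (fun _ => 0) := by
  have hTv : ∀ p ∈ hull T, 𝒯.hat a p * 𝒯.hat b p * 𝒯.hat c p =
      coord a b c p * coord b c a p * coord c a b p := fun p hp => by
    rw [𝒯.hat_eq_coord hT h hp, 𝒯.hat_eq_coord hT h.rotate hp, 𝒯.hat_eq_coord hT h.rotate.rotate hp]
  have htv : ∀ t ∈ 𝒯.elements, t ≠ T → ∀ p ∈ hull t,
      𝒯.hat a p * 𝒯.hat b p * 𝒯.hat c p = 0 := by
    intro t ht hne p hp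
    by_cases ha : a ∈ t
    · by_cases hb : b ∈ t
      · by_cases hc : c ∈ t
        · exact absurd (𝒯.sub_of_mem ht h ha hb hc).symm hne
        · rw [𝒯.hat_eq_zero ht hc hp, mul_zero]
      · rw [𝒯.hat_eq_zero ht hb hp]; ring
    · rw [𝒯.hat_eq_zero ht ha hp]; ring
  refine ⟨fun p hp => ?_, fun t ht => ?_⟩
  · by_cases hpc : p ∈ closure unitSquare
    · obtain ⟨t, ht, hpt⟩ := 𝒯.exists_mem_hull hpc
      by_cases hne : t = T
      · subst hne
        refine (hTv p hpt).trans ?_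
        by_contra hcon
        obtain ⟨h1, h2, h3⟩ := h.mem_hull_iff.1 hpt
        have hne := mul_ne_zero_iff.1 hcon
        have hne' := mul_ne_zero_iff.1 hne.1
        apply hp
        apply 𝒯.interior_hull_subset ht
        rw [h.hull_eq]
        exact mem_interior_triangle h.ne (lt_of_le_of_ne h1 hne'.1.symm)
          (lt_of_le_of_ne h2 hne'.2.symm) (lt_of_le_of_ne h3 hne.2.symm)
      · exact htv t ht hne p hpt
    · simp [𝒯.hat_of_notMem a hpc]
  · by_cases hne : t = T
    · subst hne
      refine ⟨fun p => coord a b c p * coord b c a p * coord c a b p, fun p =>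
        (coord a b c p * coord b c a p) • dcoord c a b + coord c a b p •
          (coord a b c p • dcoord b c a + coord b c a p • dcoord a b c), fun p => ?_, ?_, hTv, ?_, ?_⟩
      · exact ((hasFDerivAt_coord a b c p).mul (hasFDerivAt_coord b c a p)).mul
          (hasFDerivAt_coord c a b p)
      · have h1 := continuous_coord a b c
        have h2 := continuous_coord b c a
        have h3 := continuous_coord c a b
        fun_prop
      · intro p hp
        simp only [if_true]
        obtain ⟨h1, h1'⟩ := h.coord_mem_Icc hp
        obtain ⟨h2, h2'⟩ := h.rotate.coord_mem_Icc hp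
        obtain ⟨h3, h3'⟩ := h.rotate.rotate.coord_mem_Icc hp
        have d1 := h.norm_dcoord_le
        have d2 := h.rotate.norm_dcoord_le
        have d3 := h.rotate.rotate.norm_dcoord_le
        have hb : ∀ (r : ℝ) (d : Plane →L[ℝ] ℝ), 0 ≤ r → r ≤ 1 → ‖r • d‖ ≤ ‖d‖ := fun r d hr hr' => by
          rw [norm_smul, Real.norm_eq_abs, abs_of_nonneg hr]
          exact mul_le_of_le_one_left (norm_nonneg _) hr'
        refine (norm_add_le _ _).trans ?_
        have e1 := hb _ (dcoord c a b) (mul_nonneg h1 h2) (mul_le_one₀ h1' h2 h2')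
        have e2 := hb _ (coord a b c p • dcoord b c a + coord b c a p • dcoord a b c) h3 h3'
        have e3 := norm_add_le (coord a b c p • dcoord b c a) (coord b c a p • dcoord a b c)
        have e4 := hb _ (dcoord b c a) h1 h1'
        have e5 := hb _ (dcoord a b c) h2 h2'
        linarith
      · have hs := DFunLike.congr_fun h.dcoord_third (G t)
        simp only [sub_apply, neg_apply] at hs
        rw [h.integral_cubic 0 (dcoord b c a (G t)) (dcoord a b c (G t)) (-dcoord b c a (G t))
          (-2 * dcoord b c a (G t) - 2 * dcoord a b c (G t)) (-dcoord a b c (G t)) 0 0 0 0]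
        · ring
        · intro p
          simp only [add_apply, smul_apply, smul_eq_mul]
          rw [h.coord_third p, hs]; ring
    · refine ⟨fun _ => 0, fun _ => 0, fun p => hasFDerivAt_const 0 p, continuous_const,
        fun p hp => htv t ht hne p hp, fun p _ => ?_, ?_⟩
      · rw [if_neg hne, norm_zero]
      · simp

end Triangulation

/-- Localises the residual inequality to the elements in the support of the test function, and
majorises the local errors by `etaSq`. -/
theorem IsTest.residual_le_of_subset {𝒯 : Triangulation unitSquare} {v : Plane → ℝ}
    {uh : Plane → ℝ} {B I : Finset Plane → ℝ}
    (h : IsTest 𝒯 v (fun t => gradient uh (bary t)) B I)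
    {U : Finset (Finset Plane)} (hU : U ⊆ 𝒯.elements)
    (h0 : ∀ t ∈ 𝒯.elements, t ∉ U → (∀ p ∈ hull t, v p = 0) ∧ I t = 0 ∧ B t = 0)
    {f u : Plane → ℝ} {gu : Plane → Plane} (hf : IsData f)
    (hu : IsWeakSolution unitSquare f u gu) :
    |∑ t ∈ U, ((∫ p in hull t, f p * v p) - I t)| ≤
      ∑ t ∈ U, B t * (Real.sqrt (area (hull t)) * Real.sqrt (etaSq f uh gu t)) := by
  have key := h.residual_le hf.meas hf.bdd hu
  rw [← Finset.sum_subset hU, ← Finset.sum_subset hU] at key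
  · refine key.trans (Finset.sum_le_sum fun t ht => ?_)
    obtain ⟨a, b, c, habc⟩ := 𝒯.exists_isTri (hU ht)
    obtain ⟨P, P', -, -, -, hB, -⟩ := h.smooth t (hU ht)
    have hB0 : 0 ≤ B t := (norm_nonneg _).trans (hB a (subset_hull t habc.left_mem))
    exact mul_le_mul_of_nonneg_left (mul_le_mul_of_nonneg_left (sqrt_integral_le_eta f uh gu t)
      (Real.sqrt_nonneg _)) hB0
  · intro t ht htU
    rw [(h0 t ht htU).2.2, zero_mul]
  · intro t ht htU
    rw [(h0 t ht htU).2.1, sub_zero]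
    refine setIntegral_eq_zero_of_forall_eq_zero fun p hp => ?_
    rw [(h0 t ht htU).1 p hp, mul_zero]

namespace Triangulation

variable (𝒯 : Triangulation unitSquare)

/-- Since `|T| ≤ H_T²`, the left side is at most `(H_T / |T|^(1/2)) (H_T osc |T|^(1/2))`. Thus
oscillation scales like the other terms of the bubble estimates. -/
lemma osc_mul_area_le {f uh : Plane → ℝ} {gu : Plane → Plane} (hf : IsData f)
    {t : Finset Plane} (ht : t ∈ 𝒯.elements) : osc f (hull t) * area (hull t) ≤
      bigH t / Real.sqrt (area (hull t)) * Real.sqrt (etaSq f uh gu t) := by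
  obtain ⟨a, b, c, h⟩ := 𝒯.exists_isTri ht
  have hH := h.bigH_pos
  have hA := h.two_mul_area_le
  have ho := hf.osc_nonneg ht
  have h1 := bigH_mul_osc_le_eta f uh gu t
  set s := Real.sqrt (area (hull t)) with hs
  have hs0 : 0 < s := Real.sqrt_pos.2 h.area_pos
  have hss : s ^ 2 = area (hull t) := Real.sq_sqrt h.area_pos.le
  have hη := Real.sqrt_nonneg (etaSq f uh gu t)
  rw [← hss] at hA ⊢
  refine le_trans (b := bigH t / s * (bigH t * osc f (hull t) * s)) ?_
    (mul_le_mul_of_nonneg_left h1 (by positivity))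
  have e : bigH t / s * (bigH t * osc f (hull t) * s) = osc f (hull t) * bigH t ^ 2 := by
    field_simp
  rw [e]
  exact mul_le_mul_of_nonneg_left (by nlinarith) ho

/-- The element bubble has integral `|T|/60`. Its gradient contributes `3/2` and the replacement of
`f` by `f a` contributes `1` times the common quantity on the right, and `60 * (3/2 + 1) = 150`. -/
theorem element_estimate {f u uh : Plane → ℝ} {gu : Plane → Plane} (hf : IsData f)
    (hu : IsWeakSolution unitSquare f u gu) {t : Finset Plane} (ht : t ∈ 𝒯.elements)
    {a b c : Plane} (h : IsTri t a b c) : |f a| * area (hull t) ≤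
      150 * (bigH t / Real.sqrt (area (hull t)) * Real.sqrt (etaSq f uh gu t)) := by
  classical
  have htest := 𝒯.isTest_elementBubble ht h (fun t => gradient uh (bary t))
  have hv : ∀ p ∈ hull t, 𝒯.hat a p * 𝒯.hat b p * 𝒯.hat c p =
      coord a b c p * coord b c a p * coord c a b p := fun p hp => by
    rw [𝒯.hat_eq_coord ht h hp, 𝒯.hat_eq_coord ht h.rotate hp, 𝒯.hat_eq_coord ht h.rotate.rotate hp]
  have hz : ∀ s ∈ 𝒯.elements, s ∉ ({t} : Finset (Finset Plane)) →
      (∀ p ∈ hull s, 𝒯.hat a p * 𝒯.hat b p * 𝒯.hat c p = 0) ∧ (0 : ℝ) = 0 ∧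
      (if s = t then 3 * (bigH t / (2 * area (hull t))) else 0) = 0 := by
    intro s hs hst
    have hst' : s ≠ t := by simpa using hst
    obtain ⟨P, P', hP, -, hvP, hB, -⟩ := htest.smooth s hs
    refine ⟨fun p hp => ?_, rfl, if_neg hst'⟩
    by_cases ha : a ∈ s
    · by_cases hb : b ∈ s
      · by_cases hc : c ∈ s
        · exact absurd (𝒯.sub_of_mem hs h ha hb hc).symm hst'
        · rw [𝒯.hat_eq_zero hs hc hp, mul_zero]
      · rw [𝒯.hat_eq_zero hs hb hp]; ring
    · rw [𝒯.hat_eq_zero hs ha hp]; ring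
  have hres := htest.residual_le_of_subset (Finset.singleton_subset_iff.2 ht) hz hf hu
  simp only [Finset.sum_singleton, sub_zero, if_true] at hres
  have hint : ∫ p in hull t, 𝒯.hat a p * 𝒯.hat b p * 𝒯.hat c p = area (hull t) / 60 := by
    rw [setIntegral_congr_fun (isClosed_hull t).measurableSet hv]
    rw [h.integral_cubic 0 0 0 0 1 0 0 (-1) (-1) 0]
    · ring
    · intro p; rw [h.coord_third p]; ring
  have hosc := hf.abs_integral_sub_le ht (subset_hull t h.left_mem)
    (v := fun p => 𝒯.hat a p * 𝒯.hat b p * 𝒯.hat c p) (V := 1) ?_ ?_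
  · rw [hint, mul_one] at hosc
    have hoa := 𝒯.osc_mul_area_le (uh := uh) (gu := gu) hf ht
    have hs0 : 0 < Real.sqrt (area (hull t)) := Real.sqrt_pos.2 h.area_pos
    have hss : area (hull t) = Real.sqrt (area (hull t)) ^ 2 := (Real.sq_sqrt h.area_pos.le).symm
    have e : 3 * (bigH t / (2 * area (hull t))) * (Real.sqrt (area (hull t)) *
        Real.sqrt (etaSq f uh gu t)) = 3 / 2 * (bigH t / Real.sqrt (area (hull t)) *
        Real.sqrt (etaSq f uh gu t)) := by
      conv_lhs => rw [hss]
      rw [Real.sqrt_sq hs0.le]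
      field_simp
    rw [e] at hres
    have e2 : |f a| * area (hull t) = 60 * |f a * (area (hull t) / 60)| := by
      rw [abs_mul, abs_of_pos (div_pos h.area_pos (by norm_num : (0:ℝ) < 60))]; ring
    rw [e2]
    have := abs_sub_abs_le_abs_sub (f a * (area (hull t) / 60))
      (∫ p in hull t, f p * (𝒯.hat a p * 𝒯.hat b p * 𝒯.hat c p))
    rw [abs_sub_comm] at this
    linarith
  · have h1 := continuous_coord a b c
    have h2 := continuous_coord b c a
    have h3 := continuous_coord c a b
    refine ContinuousOn.congr (f := fun p => coord a b c p * coord b c a p * coord c a b p) ?_ hv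
    fun_prop
  · intro p hp
    rw [hv p hp]
    obtain ⟨h1, h1'⟩ := h.coord_mem_Icc hp
    obtain ⟨h2, h2'⟩ := h.rotate.coord_mem_Icc hp
    obtain ⟨h3, h3'⟩ := h.rotate.rotate.coord_mem_Icc hp
    rw [abs_of_nonneg (by positivity)]
    exact mul_le_one₀ (mul_le_one₀ h1' h2 h2') h3 h3'

/-- On `t` the interpolant is at most `|f a| + osc f`, to which the bound at a vertex and
`osc_mul_area_le` apply, with constant `150 + 1`. The factor `2` in the definition of `smallH`
doubles it to 302. -/
theorem element_residual_estimate {f u uh fI : Plane → ℝ} {gu : Plane → Plane} (hf : IsData f)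
    (hu : IsWeakSolution unitSquare f u gu) (hfI : 𝒯.IsLagrangeInterpolant f fI)
    {t : Finset Plane} (ht : t ∈ 𝒯.elements) :
    smallH t ^ 2 * ∫ p in hull t, fI p ^ 2 ≤ 302 ^ 2 * etaSq f uh gu t := by
  obtain ⟨a, b, c, h⟩ := 𝒯.exists_isTri ht
  have hel := 𝒯.element_estimate (uh := uh) hf hu ht h
  have hoa := 𝒯.osc_mul_area_le (uh := uh) (gu := gu) hf ht
  have hb : ∀ p ∈ hull t, |fI p| ≤ |f a| + osc f (hull t) := by
    intro p hp
    obtain ⟨A, hA⟩ := hfI.1.2 t ht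
    have hva : ∀ z ∈ t, A z = f z := fun z hz => by
      rw [← hA (subset_hull t hz)]; exact hfI.2 z ⟨t, ht, hz⟩
    rw [hA hp, affineMap_eq_coord h.ne, hva a h.left_mem, hva b h.rotate.left_mem,
      hva c h.rotate.rotate.left_mem]
    have o2 := hf.osc_bound ht (subset_hull t h.rotate.left_mem) (subset_hull t h.left_mem)
    have o3 := hf.osc_bound ht (subset_hull t h.rotate.rotate.left_mem) (subset_hull t h.left_mem)
    obtain ⟨h1, h2, h3⟩ := h.mem_hull_iff.1 hp
    have hs := coord_add h.ne p
    have e : coord a b c p * f a + coord b c a p * f b + coord c a b p * f c =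
        f a + coord b c a p * (f b - f a) + coord c a b p * (f c - f a) := by
      linear_combination f a * hs
    rw [e]
    have a1 := abs_add_le (f a + coord b c a p * (f b - f a)) (coord c a b p * (f c - f a))
    have a2 := abs_add_le (f a) (coord b c a p * (f b - f a))
    rw [abs_mul, abs_of_nonneg h3] at a1
    rw [abs_mul, abs_of_nonneg h2] at a2
    have b1 := mul_le_mul_of_nonneg_left o3 h3
    have b2 := mul_le_mul_of_nonneg_left o2 h2
    have b3 : (coord b c a p + coord c a b p) * osc f (hull t) ≤ 1 * osc f (hull t) :=
      mul_le_mul_of_nonneg_right (by linarith) (hf.osc_nonneg ht)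
    linarith
  have hint : ∫ p in hull t, fI p ^ 2 ≤ (|f a| + osc f (hull t)) ^ 2 * area (hull t) := by
    have := norm_setIntegral_le_of_norm_le_const (μ := volume) (s := hull t) (f := fun p => fI p ^ 2)
      (C := (|f a| + osc f (hull t)) ^ 2) (isCompact_hull t).measure_lt_top (fun p hp => by
        rw [Real.norm_eq_abs, abs_pow]
        exact pow_le_pow_left₀ (abs_nonneg _) (hb p hp) 2)
    exact (le_abs_self _).trans this
  have hH := h.bigH_pos
  set s := Real.sqrt (area (hull t)) with hs
  have hs0 : 0 < s := Real.sqrt_pos.2 h.area_pos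
  have hss : area (hull t) = s ^ 2 := (Real.sq_sqrt h.area_pos.le).symm
  set w := |f a| + osc f (hull t)
  have hw : 0 ≤ w := add_nonneg (abs_nonneg _) (hf.osc_nonneg ht)
  set η := Real.sqrt (etaSq f uh gu t)
  have hη : η ^ 2 = etaSq f uh gu t := Real.sq_sqrt (etaSq_nonneg _ _ _ _)
  have hw1 : w * s ^ 2 ≤ 151 * (bigH t / s * η) := by
    rw [← hss]; simp only [w]; linarith
  have hw2 : smallH t * (w * s) ≤ 302 * η := by
    rw [smallH, hss]
    calc 2 * s ^ 2 / bigH t * (w * s) = 2 * s / bigH t * (w * s ^ 2) := by ring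
      _ ≤ 2 * s / bigH t * (151 * (bigH t / s * η)) := by gcongr
      _ = 302 * η := by field_simp; ring
  have hsm : 0 ≤ smallH t := div_nonneg (mul_nonneg zero_le_two h.area_pos.le) hH.le
  calc smallH t ^ 2 * ∫ p in hull t, fI p ^ 2 ≤ smallH t ^ 2 * (w ^ 2 * s ^ 2) := by
        rw [← hss]; gcongr
    _ = (smallH t * (w * s)) ^ 2 := by ring
    _ ≤ (302 * η) ^ 2 := pow_le_pow_left₀ (by positivity) hw2 2
    _ = 302 ^ 2 * etaSq f uh gu t := by rw [mul_pow, hη]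

/-! ### The edge estimate -/

-- The bubble `λ_a λ_b` vanishes on the other two edges of an element and has integral `|ab|/6` over
-- `ab`, so by the divergence theorem only the normal derivative on `e` remains.
open Classical in
lemma isTest_edgeBubble {e : Finset Plane} {a b : Plane} (he : (e : Set Plane) = {a, b})
    (hab : a ≠ b) (hint : openSegment ℝ a b ⊆ unitSquare) (G : Finset Plane → Plane) :
    IsTest 𝒯 (fun p => 𝒯.hat a p * 𝒯.hat b p) G
      (fun t => if e ⊆ t then bigH t / area (hull t) else 0)
      (fun t => if e ⊆ t then dist a b / 6 * ⟪G t, outwardNormal t e⟫ else 0) := by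
  have hmem : ∀ t, e ⊆ t ↔ a ∈ t ∧ b ∈ t := fun t => by
    rw [← Finset.coe_subset, he, Set.insert_subset_iff, Set.singleton_subset_iff]; rfl
  have htv : ∀ t ∈ 𝒯.elements, ¬ e ⊆ t → ∀ p ∈ hull t, 𝒯.hat a p * 𝒯.hat b p = 0 := by
    intro t ht hne p hp
    by_cases ha : a ∈ t
    · have hb : b ∉ t := fun hb => hne ((hmem t).2 ⟨ha, hb⟩)
      rw [𝒯.hat_eq_zero ht hb hp, mul_zero]
    · rw [𝒯.hat_eq_zero ht ha hp, zero_mul]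
  refine ⟨fun p hp => ?_, fun t ht => ?_⟩
  · by_cases hpc : p ∈ closure unitSquare
    · obtain ⟨t, ht, hpt⟩ := 𝒯.exists_mem_hull hpc
      by_cases hne : e ⊆ t
      · obtain ⟨ha, hb⟩ := (hmem t).1 hne
        obtain ⟨c, h⟩ := 𝒯.exists_isTri_of_mem ht ha hb hab
        rw [𝒯.hat_eq_coord ht h hpt, 𝒯.hat_eq_coord ht h.rotate hpt]
        by_contra hcon
        obtain ⟨h1, h2, h3⟩ := h.mem_hull_iff.1 hpt
        have hne := mul_ne_zero_iff.1 hcon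
        exact hp (𝒯.mem_of_coord_pos_of_edge ht h hpt hint (lt_of_le_of_ne h1 hne.1.symm)
          (lt_of_le_of_ne h2 hne.2.symm))
      · exact htv t ht hne p hpt
    · simp [𝒯.hat_of_notMem a hpc]
  · by_cases hne : e ⊆ t
    · obtain ⟨ha, hb⟩ := (hmem t).1 hne
      obtain ⟨c, h⟩ := 𝒯.exists_isTri_of_mem ht ha hb hab
      simp only [if_pos hne]
      refine ⟨fun p => coord a b c p * coord b c a p, fun p =>
          coord a b c p • dcoord b c a + coord b c a p • dcoord a b c, fun p =>
          (hasFDerivAt_coord a b c p).mul (hasFDerivAt_coord b c a p), ?_, fun p hp => ?_, ?_, ?_⟩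
      · have h1 := continuous_coord a b c
        have h2 := continuous_coord b c a
        fun_prop
      · simp only [𝒯.hat_eq_coord ht h hp, 𝒯.hat_eq_coord ht h.rotate hp]
      · intro p hp
        obtain ⟨h1, h1'⟩ := h.coord_mem_Icc hp
        obtain ⟨h2, h2'⟩ := h.rotate.coord_mem_Icc hp
        have d1 := h.norm_dcoord_le
        have d2 := h.rotate.norm_dcoord_le
        refine (norm_add_le _ _).trans ?_
        rw [norm_smul, norm_smul, Real.norm_eq_abs, Real.norm_eq_abs, abs_of_nonneg h1,
          abs_of_nonneg h2]
        have e1 := mul_le_of_le_one_left (norm_nonneg (dcoord b c a)) h1'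
        have e2 := mul_le_of_le_one_left (norm_nonneg (dcoord a b c)) h2'
        have e3 : bigH t / area (hull t) = bigH t / (2 * area (hull t)) +
          bigH t / (2 * area (hull t)) := by field_simp; ring
        linarith
      · have hs := DFunLike.congr_fun h.dcoord_third (G t)
        simp only [sub_apply, neg_apply] at hs
        have hn := h.dcoord_eq_inner he (G t)
        have hA := h.area_pos
        rw [h.integral_cubic 0 (dcoord b c a (G t)) (dcoord a b c (G t)) 0 0 0 0 0 0 0]
        · have e1 : dcoord b c a (G t) = - dcoord c a b (G t) - dcoord a b c (G t) := by linarith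
          rw [e1, hn]; field_simp; ring
        · intro p
          simp only [add_apply, smul_apply, smul_eq_mul]
          ring
    · simp only [if_neg hne]
      refine ⟨fun _ => 0, fun _ => 0, fun p => hasFDerivAt_const 0 p, continuous_const,
        fun p hp => htv t ht hne p hp, fun p _ => by rw [norm_zero], by simp⟩

-- The bubble's gradient contributes `1` and the term with `f` at most `150 + 1`, by
-- `element_estimate` and `osc_mul_area_le`; multiplication by the `6` of the edge integral gives
-- 912. The estimate holds for every interior edge, but is useful only when `H_T` is comparable to
-- `|ab|`.
open Classical in
theorem edge_estimate {f u uh : Plane → ℝ} {gu : Plane → Plane} (hf : IsData f)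
    (hu : IsWeakSolution unitSquare f u gu) {e : Finset Plane} {a b : Plane}
    (he : (e : Set Plane) = {a, b}) (hab : a ≠ b) (hint : openSegment ℝ a b ⊆ unitSquare) :
    |𝒯.jump uh e| * dist a b ≤ 912 * ∑ t ∈ 𝒯.elements with e ⊆ t,
      bigH t / Real.sqrt (area (hull t)) * Real.sqrt (etaSq f uh gu t) := by
  have hmem : ∀ t, e ⊆ t ↔ a ∈ t ∧ b ∈ t := fun t => by
    rw [← Finset.coe_subset, he, Set.insert_subset_iff, Set.singleton_subset_iff]; rfl
  have htest := 𝒯.isTest_edgeBubble he hab hint (fun t => gradient uh (bary t))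
  have hres := htest.residual_le_of_subset (Finset.filter_subset (fun t => e ⊆ t) 𝒯.elements)
    (fun t ht hne => by
      have hne : ¬ e ⊆ t := fun h => hne (Finset.mem_filter.2 ⟨ht, h⟩)
      refine ⟨fun p hp => ?_, if_neg hne, if_neg hne⟩
      by_cases ha : a ∈ t
      · have hb : b ∉ t := fun hb => hne ((hmem t).2 ⟨ha, hb⟩)
        rw [𝒯.hat_eq_zero ht hb hp, mul_zero]
      · rw [𝒯.hat_eq_zero ht ha hp, zero_mul]) hf hu
  rw [Finset.sum_sub_distrib] at hres
  have hI : ∑ t ∈ 𝒯.elements with e ⊆ t, (if e ⊆ t then dist a b / 6 *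
      ⟪gradient uh (bary t), outwardNormal t e⟫ else 0) = dist a b / 6 * 𝒯.jump uh e := by
    rw [jump, Finset.mul_sum]
    exact Finset.sum_congr rfl fun t ht => if_pos (Finset.mem_filter.1 ht).2
  rw [hI] at hres
  have hfv : |∑ t ∈ 𝒯.elements with e ⊆ t, ∫ p in hull t, f p * (𝒯.hat a p * 𝒯.hat b p)| ≤
      ∑ t ∈ 𝒯.elements with e ⊆ t,
        151 * (bigH t / Real.sqrt (area (hull t)) * Real.sqrt (etaSq f uh gu t)) := by
    refine (Finset.abs_sum_le_sum_abs _ _).trans (Finset.sum_le_sum fun t ht => ?_)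
    obtain ⟨ht, hne⟩ := Finset.mem_filter.1 ht
    obtain ⟨ha, hb⟩ := (hmem t).1 hne
    obtain ⟨c, h⟩ := 𝒯.exists_isTri_of_mem ht ha hb hab
    have hv : ∀ p ∈ hull t, 𝒯.hat a p * 𝒯.hat b p = coord a b c p * coord b c a p := fun p hp => by
      rw [𝒯.hat_eq_coord ht h hp, 𝒯.hat_eq_coord ht h.rotate hp]
    have hel := 𝒯.element_estimate (uh := uh) hf hu ht h
    have hoa := 𝒯.osc_mul_area_le (uh := uh) (gu := gu) hf ht
    have hint : ∫ p in hull t, 𝒯.hat a p * 𝒯.hat b p = area (hull t) / 12 := by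
      rw [setIntegral_congr_fun (isClosed_hull t).measurableSet hv]
      rw [h.integral_cubic 0 0 0 0 1 0 0 0 0 0]
      · ring
      · intro p; ring
    have hosc := hf.abs_integral_sub_le ht (subset_hull t h.left_mem)
      (v := fun p => 𝒯.hat a p * 𝒯.hat b p) (V := 1) ?_ ?_
    · rw [hint, mul_one] at hosc
      have := abs_sub_abs_le_abs_sub (∫ p in hull t, f p * (𝒯.hat a p * 𝒯.hat b p))
        (f a * (area (hull t) / 12))
      have e2 : |f a * (area (hull t) / 12)| = |f a| * area (hull t) / 12 := by
        rw [abs_mul, abs_of_pos (div_pos h.area_pos (by norm_num : (0:ℝ) < 12))]; ring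
      have e3 : 0 ≤ |f a| * area (hull t) := mul_nonneg (abs_nonneg _) h.area_pos.le
      rw [e2] at this
      linarith
    · have h1 := continuous_coord a b c
      have h2 := continuous_coord b c a
      refine ContinuousOn.congr (f := fun p => coord a b c p * coord b c a p) ?_ hv
      fun_prop
    · intro p hp
      rw [hv p hp]
      obtain ⟨h1, h1'⟩ := h.coord_mem_Icc hp
      obtain ⟨h2, h2'⟩ := h.rotate.coord_mem_Icc hp
      rw [abs_of_nonneg (by positivity)]
      exact mul_le_one₀ h1' h2 h2'
  have hB : ∑ t ∈ 𝒯.elements with e ⊆ t, (if e ⊆ t then bigH t / area (hull t) else 0) *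
      (Real.sqrt (area (hull t)) * Real.sqrt (etaSq f uh gu t)) = ∑ t ∈ 𝒯.elements with e ⊆ t,
      bigH t / Real.sqrt (area (hull t)) * Real.sqrt (etaSq f uh gu t) := by
    refine Finset.sum_congr rfl fun t ht => ?_
    obtain ⟨ht, hne⟩ := Finset.mem_filter.1 ht
    obtain ⟨ha, hb⟩ := (hmem t).1 hne
    obtain ⟨c, h⟩ := 𝒯.exists_isTri_of_mem ht ha hb hab
    rw [if_pos hne]
    have hs0 : 0 < Real.sqrt (area (hull t)) := Real.sqrt_pos.2 h.area_pos
    have hss : area (hull t) = Real.sqrt (area (hull t)) ^ 2 := (Real.sq_sqrt h.area_pos.le).symm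
    conv_lhs => rw [hss]
    rw [Real.sqrt_sq hs0.le]
    field_simp
  rw [hB] at hres
  rw [← Finset.mul_sum] at hfv
  have := abs_sub_abs_le_abs_sub (dist a b / 6 * 𝒯.jump uh e)
    (∑ t ∈ 𝒯.elements with e ⊆ t, ∫ p in hull t, f p * (𝒯.hat a p * 𝒯.hat b p))
  rw [abs_sub_comm, abs_mul, abs_of_nonneg (div_nonneg dist_nonneg (by norm_num : (0:ℝ) ≤ 6))] at this
  linarith

end Triangulation

namespace Triangulation

variable (𝒯 : Triangulation unitSquare)

/-! ### Test functions attached to a vertical line -/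

open Classical in
/-- The edges on the vertical line with abscissa `X`. -/
def verticalEdges (X : ℝ) : Finset (Finset Plane) := 𝒯.edges.filter fun S => ∀ z ∈ S, z 0 = X

open Classical in
/-- The piecewise linear indicator function of the vertical line with abscissa `X`. -/
def lineHat (X : ℝ) : Plane → ℝ := 𝒯.fe fun q => if q 0 = X then 1 else 0

/-- The test function with nodal values `J` on the vertical line with abscissa `X`, modified so
that its integrals over all elements vanish. -/
def lineTest (X : ℝ) (J : Plane → ℝ) (p : Plane) : ℝ :=
  𝒯.fe J p * (3 - 12 * 𝒯.lineHat X p + 10 * 𝒯.lineHat X p ^ 2)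

section values

variable {𝒯} {X : ℝ} {J : Plane → ℝ} {t : Finset Plane} {a b c p : Plane}

lemma lineTest_eq_zero (hJX : ∀ z, z 0 ≠ X → J z = 0) (ht : t ∈ 𝒯.elements)
    (h : ∀ z ∈ t, z 0 ≠ X) (hp : p ∈ hull t) : 𝒯.lineTest X J p = 0 := by
  obtain ⟨a, b, c, habc⟩ := 𝒯.exists_isTri ht
  rw [lineTest, 𝒯.fe_eq J ht habc hp, hJX a (h a habc.left_mem), hJX b (h b habc.rotate.left_mem),
    hJX c (h c habc.rotate.rotate.left_mem)]
  ring

lemma lineTest_of_one (hJX : ∀ z, z 0 ≠ X → J z = 0) (ht : t ∈ 𝒯.elements) (h : IsTri t a b c)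
    (ha : a 0 = X) (hb : b 0 ≠ X) (hc : c 0 ≠ X) (hp : p ∈ hull t) :
    𝒯.lineTest X J p = J a * (3 * coord a b c p - 12 * coord a b c p ^ 2 +
      10 * coord a b c p ^ 3) := by
  rw [lineTest, lineHat, 𝒯.fe_eq J ht h hp, 𝒯.fe_eq _ ht h hp, if_pos ha, if_neg hb, if_neg hc,
    hJX b hb, hJX c hc]
  ring

lemma third_ne (h : IsTri t a b c) (ha : a 0 = X) (hb : b 0 = X) : c 0 ≠ X := by
  intro hc
  apply h.ne
  rw [dblArea_eq, ha, hb, hc]; ring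

lemma lineTest_of_two (hJX : ∀ z, z 0 ≠ X → J z = 0) (ht : t ∈ 𝒯.elements) (h : IsTri t a b c)
    (ha : a 0 = X) (hb : b 0 = X) (hp : p ∈ hull t) :
    𝒯.lineTest X J p = (J a * coord a b c p + J b * coord b c a p) *
      (1 - 8 * coord c a b p + 10 * coord c a b p ^ 2) := by
  have hc := third_ne h ha hb
  rw [lineTest, lineHat, 𝒯.fe_eq J ht h hp, 𝒯.fe_eq _ ht h hp, if_pos ha, if_pos hb, if_neg hc,
    hJX c hc, h.coord_third p]
  ring

/-- The three possible positions of an element relative to a vertical line. -/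
lemma line_cases (X : ℝ) (ht : t ∈ 𝒯.elements) : (∀ z ∈ t, z 0 ≠ X) ∨
    (∃ a b c, IsTri t a b c ∧ a 0 = X ∧ b 0 ≠ X ∧ c 0 ≠ X) ∨
    (∃ a b c, IsTri t a b c ∧ a 0 = X ∧ b 0 = X) := by
  by_cases h0 : ∀ z ∈ t, z 0 ≠ X
  · exact Or.inl h0
  push Not at h0
  obtain ⟨a, ha, haX⟩ := h0
  obtain ⟨b, c, h⟩ := 𝒯.exists_isTri_of_mem_left ht ha
  by_cases hb : b 0 = X
  · exact Or.inr (Or.inr ⟨a, b, c, h, haX, hb⟩)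
  by_cases hc : c 0 = X
  · exact Or.inr (Or.inr ⟨a, c, b, h.swap_right, haX, hc⟩)
  · exact Or.inr (Or.inl ⟨a, b, c, h, haX, hb, hc⟩)

/-- The polynomial `3λ - 12λ² + 10λ³` is the cubic without constant term that equals `1` at `λ = 1`
and whose integrals vanish both over an element, when `λ` is a barycentric coordinate, and over an
edge on which `λ` runs from `0` to `1`. The mean on elements with two vertices on the line vanishes
as well: `1/3 - 8/12 + 10/30 = 0`. -/
lemma integral_lineTest (hJX : ∀ z, z 0 ≠ X → J z = 0) (ht : t ∈ 𝒯.elements) :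
    ∫ p in hull t, 𝒯.lineTest X J p = 0 := by
  rcases line_cases X ht with h0 | ⟨a, b, c, h, ha, hb, hc⟩ | ⟨a, b, c, h, ha, hb⟩
  · exact setIntegral_eq_zero_of_forall_eq_zero fun p hp => lineTest_eq_zero hJX ht h0 hp
  · rw [setIntegral_congr_fun (isClosed_hull t).measurableSet
      (fun p hp => lineTest_of_one hJX ht h ha hb hc hp),
      h.integral_cubic 0 (3 * J a) 0 (-12 * J a) 0 0 (10 * J a) 0 0 0 (fun p => by ring)]
    ring
  · rw [setIntegral_congr_fun (isClosed_hull t).measurableSet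
      (fun p hp => lineTest_of_two hJX ht h ha hb hp),
      h.integral_cubic 0 (3 * J a) (3 * J b) (-12 * J a) (-12 * J a - 12 * J b) (-12 * J b)
      (10 * J a) (20 * J a + 10 * J b) (10 * J a + 20 * J b) (10 * J b) (fun p => by
        rw [h.coord_third p]; ring)]
    ring

lemma abs_lineTest_le (hJX : ∀ z, z 0 ≠ X → J z = 0) (ht : t ∈ 𝒯.elements) (hp : p ∈ hull t) :
    |𝒯.lineTest X J p| ≤ 3 * ∑ z ∈ t, |J z| := by
  have hq : ∀ s : ℝ, 0 ≤ s → s ≤ 1 → |1 - 8 * s + 10 * s ^ 2| ≤ 3 := fun s h0 h1 => by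
    rw [abs_le]; constructor <;> nlinarith
  rcases line_cases X ht with h0 | ⟨a, b, c, h, ha, hb, hc⟩ | ⟨a, b, c, h, ha, hb⟩
  · rw [lineTest_eq_zero hJX ht h0 hp, abs_zero]
    exact mul_nonneg (by norm_num) (Finset.sum_nonneg fun _ _ => abs_nonneg _)
  · rw [lineTest_of_one hJX ht h ha hb hc hp, h.sum_eq, hJX b hb, hJX c hc]
    obtain ⟨h1, h1'⟩ := h.coord_mem_Icc hp
    have e : J a * (3 * coord a b c p - 12 * coord a b c p ^ 2 + 10 * coord a b c p ^ 3) =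
      (J a * coord a b c p) * (1 - 8 * (1 - coord a b c p) + 10 * (1 - coord a b c p) ^ 2) := by ring
    rw [e, abs_mul, abs_mul, abs_of_nonneg h1, abs_zero, add_zero, add_zero]
    have := hq (1 - coord a b c p) (by linarith) (by linarith)
    have h3 := mul_le_of_le_one_right (abs_nonneg (J a)) h1'
    calc _ ≤ |J a| * 3 := mul_le_mul h3 this (abs_nonneg _) (abs_nonneg _)
      _ = _ := by ring
  · rw [lineTest_of_two hJX ht h ha hb hp, h.sum_eq]
    obtain ⟨h1, h1'⟩ := h.coord_mem_Icc hp
    obtain ⟨h2, h2'⟩ := h.rotate.coord_mem_Icc hp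
    obtain ⟨h3, h3'⟩ := h.rotate.rotate.coord_mem_Icc hp
    rw [abs_mul]
    have a1 := abs_add_le (J a * coord a b c p) (J b * coord b c a p)
    rw [abs_mul, abs_mul, abs_of_nonneg h1, abs_of_nonneg h2] at a1
    have a2 := mul_le_of_le_one_right (abs_nonneg (J a)) h1'
    have a3 := mul_le_of_le_one_right (abs_nonneg (J b)) h2'
    have a4 := abs_nonneg (J c)
    have a5 := abs_nonneg (J a)
    have a6 := abs_nonneg (J b)
    calc _ ≤ (|J a| + |J b|) * 3 :=
          mul_le_mul (by linarith) (hq _ h3 h3') (abs_nonneg _) (by positivity)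
      _ ≤ _ := by linarith

lemma continuousOn_lineTest (hJX : ∀ z, z 0 ≠ X → J z = 0) (ht : t ∈ 𝒯.elements) :
    ContinuousOn (𝒯.lineTest X J) (hull t) := by
  rcases line_cases X ht with h0 | ⟨a, b, c, h, ha, hb, hc⟩ | ⟨a, b, c, h, ha, hb⟩
  · exact continuousOn_const.congr fun p hp => lineTest_eq_zero hJX ht h0 hp
  · have h1 := continuous_coord a b c
    refine ContinuousOn.congr ?_ fun p hp => lineTest_of_one hJX ht h ha hb hc hp
    fun_prop
  · have h1 := continuous_coord a b c
    have h2 := continuous_coord b c a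
    have h3 := continuous_coord c a b
    refine ContinuousOn.congr ?_ fun p hp => lineTest_of_two hJX ht h ha hb hp
    fun_prop

lemma lineTest_of_notMem (hJ : ∀ z ∉ unitSquare, J z = 0) (hp : p ∉ unitSquare) :
    𝒯.lineTest X J p = 0 := by
  by_cases hpc : p ∈ closure unitSquare
  · obtain ⟨t, ht, hpt⟩ := 𝒯.exists_mem_hull hpc
    obtain ⟨a, b, c, h⟩ := 𝒯.exists_isTri ht
    have key : ∀ {a b c : Plane}, IsTri t a b c → coord a b c p * J a = 0 := by
      intro a b c h
      by_cases ha : a ∈ unitSquare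
      · rcases (h.mem_hull_iff.1 hpt).1.eq_or_lt with h0 | h0
        · rw [← h0, zero_mul]
        · exact absurd (𝒯.mem_of_coord_pos ht h hpt ha h0) hp
      · rw [hJ a ha, mul_zero]
    rw [lineTest, 𝒯.fe_eq J ht h hpt, key h, key h.rotate, key h.rotate.rotate]
    ring
  · rw [lineTest, 𝒯.fe_of_notMem _ hpc, zero_mul]

/-- Because the integrals over the non-vertical edges also vanish, the integral of `∇v·G` is zero on
elements with one vertex on the line, and reduces to the vertical edge on elements with two. Here
`9` bounds `|3 - 24λ + 30λ²|` on `[0,1]`, and `15 = 12 + 3` combines the bounds of the polynomial's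
derivative and of the polynomial itself. -/
lemma isTest_lineTest (hJ : ∀ z ∉ unitSquare, J z = 0) (hJX : ∀ z, z 0 ≠ X → J z = 0)
    {G : Finset Plane → Plane} {B I : Finset Plane → ℝ}
    (h0 : ∀ t ∈ 𝒯.elements, (∀ z ∈ t, z 0 ≠ X) → 0 ≤ B t ∧ I t = 0)
    (h1 : ∀ t ∈ 𝒯.elements, ∀ a b c, IsTri t a b c → a 0 = X → b 0 ≠ X → c 0 ≠ X →
      9 * |J a| * ‖dcoord a b c‖ ≤ B t ∧ I t = 0)
    (h2 : ∀ t ∈ 𝒯.elements, ∀ a b c, IsTri t a b c → a 0 = X → b 0 = X →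
      15 * (|J a| + |J b|) * ‖dcoord c a b‖ + 3 * |J b - J a| * ‖dcoord b c a‖ ≤ B t ∧
      I t = - area (hull t) * (J a + J b) * dcoord c a b (G t)) :
    IsTest 𝒯 (𝒯.lineTest X J) G B I := by
  refine ⟨fun p hp => lineTest_of_notMem hJ hp, fun t ht => ?_⟩
  rcases line_cases X ht with ht0 | ⟨a, b, c, h, ha, hb, hc⟩ | ⟨a, b, c, h, ha, hb⟩
  · obtain ⟨hB, hI⟩ := h0 t ht ht0
    refine ⟨fun _ => 0, fun _ => 0, fun p => hasFDerivAt_const 0 p, continuous_const,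
      fun p hp => lineTest_eq_zero hJX ht ht0 hp, fun p _ => by rwa [norm_zero], by simp [hI]⟩
  · obtain ⟨hB, hI⟩ := h1 t ht a b c h ha hb hc
    have hcont := continuous_coord a b c
    refine ⟨fun p => J a * (3 * coord a b c p - 12 * coord a b c p ^ 2 + 10 * coord a b c p ^ 3),
      fun p => (J a * (3 - 24 * coord a b c p + 30 * coord a b c p ^ 2)) • dcoord a b c,
      fun p => ?_, by fun_prop, fun p hp => lineTest_of_one hJX ht h ha hb hc hp, fun p hp => ?_, ?_⟩
    · have hp : HasDerivAt (fun s : ℝ => J a * (3 * s - 12 * s ^ 2 + 10 * s ^ 3))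
          (J a * (3 - 24 * coord a b c p + 30 * coord a b c p ^ 2)) (coord a b c p) := by
        have := ((((hasDerivAt_id (coord a b c p)).const_mul 3).sub
          ((hasDerivAt_pow 2 (coord a b c p)).const_mul 12)).add
          ((hasDerivAt_pow 3 (coord a b c p)).const_mul 10)).const_mul (J a)
        refine this.congr_deriv ?_
        push_cast; ring
      exact hp.comp_hasFDerivAt p (hasFDerivAt_coord a b c p)
    · refine le_trans ?_ hB
      rw [norm_smul, Real.norm_eq_abs, abs_mul]
      obtain ⟨l0, l1⟩ := h.coord_mem_Icc hp
      have : |3 - 24 * coord a b c p + 30 * coord a b c p ^ 2| ≤ 9 := by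
        rw [abs_le]; constructor <;> nlinarith
      refine mul_le_mul_of_nonneg_right ?_ (norm_nonneg _)
      rw [mul_comm]
      exact mul_le_mul_of_nonneg_right this (abs_nonneg _)
    · rw [hI, h.integral_cubic (J a * 3 * dcoord a b c (G t)) (-24 * J a * dcoord a b c (G t)) 0
        (30 * J a * dcoord a b c (G t)) 0 0 0 0 0 0]
      · ring
      · intro p; simp only [smul_apply, smul_eq_mul]; ring
  · obtain ⟨hB, hI⟩ := h2 t ht a b c h ha hb
    have hcont1 := continuous_coord a b c
    have hcont2 := continuous_coord b c a
    have hcont3 := continuous_coord c a b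
    refine ⟨fun p => (J a * coord a b c p + J b * coord b c a p) *
        (1 - 8 * coord c a b p + 10 * coord c a b p ^ 2),
      fun p => (J a * coord a b c p + J b * coord b c a p) •
        ((-8 + 20 * coord c a b p) • dcoord c a b) +
        (1 - 8 * coord c a b p + 10 * coord c a b p ^ 2) • (J a • dcoord a b c + J b • dcoord b c a),
      fun p => ?_, by fun_prop, fun p hp => lineTest_of_two hJX ht h ha hb hp, fun p hp => ?_, ?_⟩
    · have hp : HasDerivAt (fun s : ℝ => 1 - 8 * s + 10 * s ^ 2)
          (-8 + 20 * coord c a b p) (coord c a b p) := by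
        have := (((hasDerivAt_id (coord c a b p)).const_mul 8).const_sub 1).add
          ((hasDerivAt_pow 2 (coord c a b p)).const_mul 10)
        refine this.congr_deriv ?_
        norm_num; ring
      exact (((hasFDerivAt_coord a b c p).const_mul (J a)).add
        ((hasFDerivAt_coord b c a p).const_mul (J b))).mul
        (hp.comp_hasFDerivAt p (hasFDerivAt_coord c a b p))
    · refine le_trans ?_ hB
      obtain ⟨l1, l1'⟩ := h.coord_mem_Icc hp
      obtain ⟨l2, l2'⟩ := h.rotate.coord_mem_Icc hp
      obtain ⟨l3, l3'⟩ := h.rotate.rotate.coord_mem_Icc hp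
      have hq : |1 - 8 * coord c a b p + 10 * coord c a b p ^ 2| ≤ 3 := by
        rw [abs_le]; constructor <;> nlinarith
      have hq' : |-8 + 20 * coord c a b p| ≤ 12 := by
        rw [abs_le]; constructor <;> linarith
      -- Written this way, the large gradient along the short edge is multiplied only by the
      -- difference of the nodal values.
      have hd : J a • dcoord a b c + J b • dcoord b c a =
          -(J a • dcoord c a b) + (J b - J a) • dcoord b c a := by
        rw [h.dcoord_third]; module
      have a1 := abs_add_le (J a * coord a b c p) (J b * coord b c a p)
      rw [abs_mul, abs_mul, abs_of_nonneg l1, abs_of_nonneg l2] at a1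
      have a2 := mul_le_of_le_one_right (abs_nonneg (J a)) l1'
      have a3 := mul_le_of_le_one_right (abs_nonneg (J b)) l2'
      have n1 : ‖(J a * coord a b c p + J b * coord b c a p) •
          ((-8 + 20 * coord c a b p) • dcoord c a b)‖ ≤ (|J a| + |J b|) * (12 * ‖dcoord c a b‖) := by
        rw [norm_smul, norm_smul, Real.norm_eq_abs, Real.norm_eq_abs]
        gcongr
        linarith
      have n2 : ‖(1 - 8 * coord c a b p + 10 * coord c a b p ^ 2) •
          (J a • dcoord a b c + J b • dcoord b c a)‖ ≤
          3 * (|J a| * ‖dcoord c a b‖ + |J b - J a| * ‖dcoord b c a‖) := by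
        rw [norm_smul, Real.norm_eq_abs, hd]
        refine mul_le_mul hq ?_ (norm_nonneg _) (by norm_num)
        refine (norm_add_le _ _).trans ?_
        rw [norm_neg, norm_smul, norm_smul, Real.norm_eq_abs, Real.norm_eq_abs]
      refine (norm_add_le _ _).trans ?_
      have a4 : 0 ≤ |J b| * ‖dcoord c a b‖ := by positivity
      linarith
    · have hs := DFunLike.congr_fun h.dcoord_third (G t)
      simp only [sub_apply, neg_apply] at hs
      set d1 := dcoord a b c (G t)
      set d2 := dcoord b c a (G t)
      rw [hI, hs, h.integral_cubic (3 * (J a * d1 + J b * d2))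
        (12 * J a * (-d1 - d2) - 12 * (J a * d1 + J b * d2))
        (12 * J b * (-d1 - d2) - 12 * (J a * d1 + J b * d2))
        (-20 * J a * (-d1 - d2) + 10 * (J a * d1 + J b * d2))
        (-20 * (J a + J b) * (-d1 - d2) + 20 * (J a * d1 + J b * d2))
        (-20 * J b * (-d1 - d2) + 10 * (J a * d1 + J b * d2)) 0 0 0 0]
      · ring
      · intro p
        simp only [add_apply, smul_apply, smul_eq_mul]
        rw [hs, h.coord_third p]
        simp only [d1, d2]
        ring

end values

end Triangulation

/-! ### The two sides of an interior edge -/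

open Classical in
/-- The edge with endpoints `z` and `p`. -/
def edge (z p : Plane) : Finset Plane := {z, p}

lemma coe_edge (z p : Plane) : (edge z p : Set Plane) = {z, p} := by
  classical
  simp [edge]

lemma mem_edge {z p q : Plane} : q ∈ edge z p ↔ q = z ∨ q = p := by
  rw [← Finset.mem_coe, coe_edge]; simp

lemma edge_comm (z p : Plane) : edge z p = edge p z := by
  ext; rw [mem_edge, mem_edge, or_comm]

lemma edge_subset {z p : Plane} {t : Finset Plane} : edge z p ⊆ t ↔ z ∈ t ∧ p ∈ t := by
  rw [← Finset.coe_subset, coe_edge, Set.insert_subset_iff, Set.singleton_subset_iff]; rfl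

/-- The side of the oriented edge from `z` to `p` on which the triangle `t` lies: `1` on the left
and `-1` on the right. -/
def side (z p : Plane) (t : Finset Plane) : ℝ := ∑ q ∈ t, dblArea z p q / |dblArea z p q|

namespace IsTri

variable {t : Finset Plane} {z p q : Plane}

lemma side_eq (h : IsTri t z p q) : side z p t = dblArea z p q / |dblArea z p q| := by
  have h1 : dblArea z p z = 0 := by rw [dblArea_eq]; ring
  have h2 : dblArea z p p = 0 := by rw [dblArea_eq]; ring
  rw [side, h.sum_eq, h1, h2]; simp

lemma side_eq_one_or (h : IsTri t z p q) : side z p t = 1 ∨ side z p t = -1 := by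
  rw [h.side_eq]
  rcases lt_or_gt_of_ne h.ne with h0 | h0
  · right; rw [abs_of_neg h0, div_neg, div_self h0.ne]
  · left; rw [abs_of_pos h0, div_self h0.ne']

lemma side_mul_pos (h : IsTri t z p q) : 0 < side z p t * dblArea z p q := by
  rw [h.side_eq, div_mul_eq_mul_div]
  exact div_pos (mul_self_pos.2 h.ne) (abs_pos.2 h.ne)

lemma side_add (h : IsTri t z p q) : side z p t + side z q t = 0 := by
  rw [h.side_eq, h.swap_right.side_eq, dblArea_swap_right z p q, abs_neg, neg_div]; ring

lemma outwardNormal_edge (h : IsTri t z p q) :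
    outwardNormal t (edge z p) = -(side z p t / dist z p) • rot (p - z) := by
  rw [h.outwardNormal_eq (coe_edge z p), h.side_eq]

lemma coord_third_line (q z p : Plane) (w r : ℝ) :
    coord q z p ((2 : ℝ)⁻¹ • (z + p) + w • (r • rot (p - z))) =
      w * r * ‖p - z‖ ^ 2 / dblArea z p q := by
  rw [coord_eq, dblArea_rotate q z p, norm_sq_plane]
  simp only [rot, PiLp.add_apply, PiLp.smul_apply, PiLp.sub_apply, smul_eq_mul,
    Matrix.cons_val_zero, Matrix.cons_val_one, Matrix.cons_val_fin_one]
  congr 1; ring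

lemma coord_midpoint (h : IsTri t z p q) : coord z p q ((2 : ℝ)⁻¹ • (z + p)) = 1 / 2 := by
  have e : (2 : ℝ)⁻¹ • (z + p) = (1 / 2 : ℝ) • z + (1 / 2 : ℝ) • p + (0 : ℝ) • q := by module
  rw [e, coord_combo h.ne (by norm_num)]

/-- Points close to the midpoint of an edge, on the side of the triangle, belong to it. -/
lemma eventually_mem_hull (h : IsTri t z p q) :
    ∀ᶠ w in 𝓝[>] (0 : ℝ), (2 : ℝ)⁻¹ • (z + p) + w • (side z p t • rot (p - z)) ∈ hull t ∧
      0 < coord q z p ((2 : ℝ)⁻¹ • (z + p) + w • (side z p t • rot (p - z))) := by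
  set x : ℝ → Plane := fun w => (2 : ℝ)⁻¹ • (z + p) + w • (side z p t • rot (p - z)) with hx
  have hxc : Continuous x := by fun_prop
  have hx0 : x 0 = (2 : ℝ)⁻¹ • (z + p) := by simp [hx]
  have e1 : ∀ᶠ w in 𝓝 (0 : ℝ), 0 < coord z p q (x w) := by
    refine ((continuous_coord z p q).comp hxc).continuousAt.eventually (lt_mem_nhds ?_)
    simp only [Function.comp, hx0, h.coord_midpoint]; norm_num
  have e2 : ∀ᶠ w in 𝓝 (0 : ℝ), 0 < coord p q z (x w) := by
    refine ((continuous_coord p q z).comp hxc).continuousAt.eventually (lt_mem_nhds ?_)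
    simp only [Function.comp, hx0]
    rw [add_comm, coord_swap, h.swap.coord_midpoint]; norm_num
  filter_upwards [nhdsWithin_le_nhds e1, nhdsWithin_le_nhds e2, self_mem_nhdsWithin] with w h1 h2 hw
  have h3 : 0 < coord q z p (x w) := by
    simp only [hx]
    rw [coord_third_line, ← mul_div_mul_right _ _ h.ne]
    have hn : 0 < ‖p - z‖ := norm_pos_iff.2 (sub_ne_zero.2 h.left_ne.symm)
    refine div_pos ?_ (mul_self_pos.2 h.ne)
    have := h.side_mul_pos
    have hw' : 0 < w := hw
    have e : w * side z p t * ‖p - z‖ ^ 2 * dblArea z p q =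
      w * ‖p - z‖ ^ 2 * (side z p t * dblArea z p q) := by ring
    rw [e]; positivity
  exact ⟨h.mem_hull_iff.2 ⟨h1.le, h2.le, h3.le⟩, h3⟩

end IsTri

namespace Triangulation

variable {𝒯 : Triangulation unitSquare} {z p : Plane}

lemma coord_eq_zero_of_mem_inter {t t' : Finset Plane} (ht : t ∈ 𝒯.elements)
    (ht' : t' ∈ 𝒯.elements) {a b c : Plane} (h : IsTri t a b c) (ha : a ∉ t') {x : Plane}
    (hx : x ∈ hull t) (hx' : x ∈ hull t') : coord a b c x = 0 := by
  have h1 : x ∈ convexHull ℝ ((t : Set Plane) ∩ t') := by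
    rw [← 𝒯.conforming t ht t' ht']; exact ⟨hx, hx'⟩
  have hzero : Set.EqOn (coordAffine a b c) (AffineMap.const ℝ Plane (0 : ℝ))
      ((t : Set Plane) ∩ t') := by
    rintro q ⟨hq, hq'⟩
    rcases h.mem_iff.1 hq with rfl | rfl | rfl
    · exact absurd hq' ha
    · simp [coordAffine_apply, coord_left]
    · simp [coordAffine_apply, coord_right]
  have := AffineMap.eqOn_affineSpan hzero (convexHull_subset_affineSpan _ h1)
  simpa [coordAffine_apply] using this

/-- Both triangles contain the points close to the midpoint of the edge on the given side. Such a
point is off the edge, whereas distinct elements sharing the edge meet only where the third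
coordinate vanishes. -/
lemma eq_of_side_eq {t t' : Finset Plane} (ht : t ∈ 𝒯.elements) (ht' : t' ∈ 𝒯.elements)
    (hzp : z ≠ p) (hz : z ∈ t) (hp : p ∈ t) (hz' : z ∈ t') (hp' : p ∈ t')
    (hs : side z p t = side z p t') : t = t' := by
  obtain ⟨q, h⟩ := 𝒯.exists_isTri_of_mem ht hz hp hzp
  obtain ⟨q', h'⟩ := 𝒯.exists_isTri_of_mem ht' hz' hp' hzp
  by_contra hne
  have hq : q ∉ t' := fun hq => hne (𝒯.sub_of_mem ht' h hz' hp' hq)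
  have e := h'.eventually_mem_hull
  rw [← hs] at e
  obtain ⟨w, ⟨h1, h2⟩, h3, -⟩ := (h.eventually_mem_hull.and e).exists
  exact h2.ne' (coord_eq_zero_of_mem_inter ht ht' h.rotate.rotate hq h1 h3)

/-- Points approaching the interior midpoint from the prescribed side are covered by elements, and
by finiteness one element recurs. Being closed it contains the midpoint, so conformity makes both
endpoints of the edge its vertices. -/
lemma exists_side {t₀ : Finset Plane} (ht₀ : t₀ ∈ 𝒯.elements) (hzp : z ≠ p) (hz : z ∈ t₀)
    (hp : p ∈ t₀) (hseg : openSegment ℝ z p ⊆ unitSquare) {s : ℝ} (hs : s = 1 ∨ s = -1) :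
    ∃ t ∈ 𝒯.elements, z ∈ t ∧ p ∈ t ∧ side z p t = s := by
  obtain ⟨q₀, h₀⟩ := 𝒯.exists_isTri_of_mem ht₀ hz hp hzp
  set x : ℝ → Plane := fun w => (2 : ℝ)⁻¹ • (z + p) + w • (s • rot (p - z)) with hx
  have hxc : Continuous x := by fun_prop
  have hx0 : x 0 = (2 : ℝ)⁻¹ • (z + p) := by simp [hx]
  have hm : x 0 ∈ unitSquare := by
    rw [hx0]
    exact hseg ⟨2⁻¹, 2⁻¹, by norm_num, by norm_num, by norm_num, by module⟩
  have h1 : ∀ᶠ w in 𝓝[>] (0 : ℝ), ∃ t ∈ 𝒯.elements, x w ∈ hull t := by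
    refine nhdsWithin_le_nhds ?_
    filter_upwards [hxc.continuousAt.eventually (isOpen_unitSquare.mem_nhds hm)] with w hw
    exact 𝒯.exists_mem_hull (subset_closure hw)
  have h2 : ∃ t ∈ 𝒯.elements, ∃ᶠ w in 𝓝[>] (0 : ℝ), x w ∈ hull t := by
    by_contra hcon
    push Not at hcon
    have h3 := (Filter.eventually_all_finset (l := 𝓝[>] (0 : ℝ)) 𝒯.elements
      (p := fun t w => x w ∉ hull t)).2 fun t ht => hcon t ht
    obtain ⟨w, ⟨t, ht, hw⟩, hw'⟩ := (h1.and h3).exists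
    exact hw' t ht hw
  obtain ⟨t, ht, hfr⟩ := h2
  have hmt : x 0 ∈ hull t := by
    by_contra hcon
    apply hfr
    exact nhdsWithin_le_nhds (hxc.continuousAt.eventually
      ((isClosed_hull t).isOpen_compl.mem_nhds hcon))
  have hm0 : x 0 ∈ hull t₀ := by
    rw [hx0]
    have := (convex_hull t₀) (subset_hull t₀ hz) (subset_hull t₀ hp) (a := 2⁻¹) (b := 2⁻¹)
      (by norm_num) (by norm_num) (by norm_num)
    rwa [← smul_add] at this
  have hzt : z ∈ t := by
    by_contra hcon
    have := coord_eq_zero_of_mem_inter ht₀ ht h₀ hcon hm0 hmt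
    rw [hx0, h₀.coord_midpoint] at this
    norm_num at this
  have hpt : p ∈ t := by
    by_contra hcon
    have := coord_eq_zero_of_mem_inter ht₀ ht h₀.swap hcon hm0 hmt
    rw [hx0, add_comm, h₀.swap.coord_midpoint] at this
    norm_num at this
  refine ⟨t, ht, hzt, hpt, ?_⟩
  obtain ⟨q, h⟩ := 𝒯.exists_isTri_of_mem ht hzt hpt hzp
  obtain ⟨w, hw, hw0⟩ := (hfr.and_eventually self_mem_nhdsWithin).exists
  have hw0 : 0 < w := hw0
  have h3 := (h.mem_hull_iff.1 hw).2.2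
  simp only [hx] at h3
  rw [IsTri.coord_third_line] at h3
  have hn : 0 < ‖p - z‖ := norm_pos_iff.2 (sub_ne_zero.2 hzp.symm)
  have h4 : 0 ≤ s * dblArea z p q := by
    have e : w * s * ‖p - z‖ ^ 2 / dblArea z p q =
        (s * dblArea z p q) * (w * ‖p - z‖ ^ 2 / dblArea z p q ^ 2) := by
      have := h.ne; field_simp
    rw [e] at h3
    have hpos : 0 < w * ‖p - z‖ ^ 2 / dblArea z p q ^ 2 := by
      have := h.ne; positivity
    exact nonneg_of_mul_nonneg_left h3 hpos
  have h5 := h.side_mul_pos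
  rcases h.side_eq_one_or with h6 | h6 <;> rcases hs with rfl | rfl
  · exact h6
  · rw [h6] at h5; linarith
  · rw [h6] at h5; linarith
  · exact h6

-- An interior edge has exactly one element on each side.
open Classical in
lemma sum_side_eq_zero {t₀ : Finset Plane} (ht₀ : t₀ ∈ 𝒯.elements) (hzp : z ≠ p) (hz : z ∈ t₀)
    (hp : p ∈ t₀) (hseg : openSegment ℝ z p ⊆ unitSquare) :
    ∑ t ∈ 𝒯.elements with z ∈ t ∧ p ∈ t, side z p t = 0 := by
  obtain ⟨t₁, ht₁, hz₁, hp₁, hs₁⟩ := exists_side ht₀ hzp hz hp hseg (Or.inl rfl)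
  obtain ⟨t₂, ht₂, hz₂, hp₂, hs₂⟩ := exists_side ht₀ hzp hz hp hseg (Or.inr rfl)
  have hne : t₁ ≠ t₂ := by rintro rfl; rw [hs₁] at hs₂; norm_num at hs₂
  have e : 𝒯.elements.filter (fun t => z ∈ t ∧ p ∈ t) = {t₁, t₂} := by
    ext t
    simp only [Finset.mem_filter, Finset.mem_insert, Finset.mem_singleton]
    constructor
    · rintro ⟨ht, hzt, hpt⟩
      obtain ⟨q, h⟩ := 𝒯.exists_isTri_of_mem ht hzt hpt hzp
      rcases h.side_eq_one_or with h1 | h1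
      · exact Or.inl (eq_of_side_eq ht ht₁ hzp hzt hpt hz₁ hp₁ (h1.trans hs₁.symm))
      · exact Or.inr (eq_of_side_eq ht ht₂ hzp hzt hpt hz₂ hp₂ (h1.trans hs₂.symm))
    · rintro (rfl | rfl)
      · exact ⟨ht₁, hz₁, hp₁⟩
      · exact ⟨ht₂, hz₂, hp₂⟩
  rw [e, Finset.sum_pair hne, hs₁, hs₂]; norm_num

/-! ### The jumps around a node -/

variable (𝒯) in
open Classical in
/-- The nodes joined to the node `z` by an edge. -/
def neighbours (z : Plane) : Finset Plane :=
  ((𝒯.elements.filter fun t => z ∈ t).biUnion id).erase z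

lemma mem_neighbours : p ∈ 𝒯.neighbours z ↔ p ≠ z ∧ ∃ t ∈ 𝒯.elements, z ∈ t ∧ p ∈ t := by
  simp [neighbours, and_assoc]

lemma jump_eq (v : Plane → ℝ) (z p : Plane) : 𝒯.jump v (edge z p) =
    ∑ t ∈ 𝒯.elements with z ∈ t ∧ p ∈ t,
      ⟪gradient v (bary t), outwardNormal t (edge z p)⟫ := by
  rw [jump]
  refine Finset.sum_congr ?_ fun _ _ => rfl
  ext t; simp [edge_subset]

/-- The horizontal unit vector is split into its components along and across the edge. The
tangential derivative is the difference quotient of `v` along the edge, the same for the elements on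
both sides. -/
lemma side_mul_gradient {v : Plane → ℝ} (hv : 𝒯.IsPiecewiseLinear v) {t : Finset Plane}
    (ht : t ∈ 𝒯.elements) (hzp : z ≠ p) (hz : z ∈ t) (hp : p ∈ t) :
    side z p t * gradient v (bary t) 0 =
      (v p - v z) * (p 0 - z 0) / dist z p ^ 2 * side z p t +
      (p 1 - z 1) / dist z p * ⟪gradient v (bary t), outwardNormal t (edge z p)⟫ := by
  obtain ⟨q, h⟩ := 𝒯.exists_isTri_of_mem ht hz hp hzp
  rw [hv.sub_eq ht (subset_hull t hp) (subset_hull t hz), h.outwardNormal_edge, inner_smul_right]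
  have hd : 0 < dist z p := dist_pos.2 hzp
  have hd2 : dist z p ^ 2 = (p 0 - z 0) ^ 2 + (p 1 - z 1) ^ 2 := by
    rw [dist_comm, dist_eq_norm, norm_sq_plane]; simp
  have e : (p 1 - z 1) / dist z p * (-(side z p t / dist z p) *
      ⟪gradient v (bary t), rot (p - z)⟫) = -(p 1 - z 1) * side z p t *
      ⟪gradient v (bary t), rot (p - z)⟫ / dist z p ^ 2 := by
    field_simp
  rw [e, div_mul_eq_mul_div, ← add_div, eq_div_iff (by positivity), hd2, inner_plane, inner_plane]
  simp only [rot, PiLp.sub_apply, Matrix.cons_val_zero, Matrix.cons_val_one,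
    Matrix.cons_val_fin_one]
  ring

-- Sum `side * ∂ₓv` over all pairs of an element at `z` and an edge of it at `z`. For each element
-- the two edges see it on opposite sides, so the total is zero. Summed by edges instead, the
-- tangential parts cancel across an interior edge and the normal parts form the jump; boundary
-- edges drop out since they are horizontal and `v` has equal values at their ends.
open Classical in
theorem sum_neighbours_eq_zero {v : Plane → ℝ} (hv : 𝒯.IsPiecewiseLinear v) (z : Plane)
    (hbd : ∀ p ∈ 𝒯.neighbours z, ¬ openSegment ℝ z p ⊆ unitSquare → p 1 = z 1 ∧ v p = v z) :
    ∑ p ∈ 𝒯.neighbours z with openSegment ℝ z p ⊆ unitSquare,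
      (p 1 - z 1) / dist z p * 𝒯.jump v (edge z p) = 0 := by
  have h1 : ∑ p ∈ 𝒯.neighbours z, ∑ t ∈ 𝒯.elements with z ∈ t ∧ p ∈ t,
      side z p t * gradient v (bary t) 0 = 0 := by
    have e : ∑ p ∈ 𝒯.neighbours z, ∑ t ∈ 𝒯.elements with z ∈ t ∧ p ∈ t,
        side z p t * gradient v (bary t) 0 =
        ∑ t ∈ 𝒯.elements with z ∈ t, ∑ p ∈ t.erase z, side z p t * gradient v (bary t) 0 := by
      refine Finset.sum_comm' fun p t => ?_
      simp only [Finset.mem_filter, Finset.mem_erase, mem_neighbours]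
      constructor
      · rintro ⟨⟨hpz, -⟩, ht, hz, hp⟩
        exact ⟨⟨hpz, hp⟩, ht, hz⟩
      · rintro ⟨⟨hpz, hp⟩, ht, hz⟩
        exact ⟨⟨hpz, t, ht, hz, hp⟩, ht, hz, hp⟩
    rw [e]
    refine Finset.sum_eq_zero fun t ht => ?_
    obtain ⟨ht, hz⟩ := Finset.mem_filter.1 ht
    obtain ⟨q, r, h⟩ := 𝒯.exists_isTri_of_mem_left ht hz
    have he : t.erase z = {q, r} := by
      ext x
      rw [Finset.mem_erase, h.mem_iff, Finset.mem_insert, Finset.mem_singleton]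
      constructor
      · rintro ⟨hx, rfl | h | h⟩
        · exact absurd rfl hx
        · exact Or.inl h
        · exact Or.inr h
      · rintro (rfl | rfl)
        · exact ⟨h.left_ne.symm, Or.inr (Or.inl rfl)⟩
        · exact ⟨h.left_ne_right.symm, Or.inr (Or.inr rfl)⟩
    rw [he, Finset.sum_pair h.mid_ne, ← add_mul, h.side_add, zero_mul]
  -- The same double sum, now arranged by edges.
  rw [← h1, Finset.sum_filter]
  refine Finset.sum_congr rfl fun p hp => ?_
  obtain ⟨hpz, t₀, ht₀, hz₀, hp₀⟩ := mem_neighbours.1 hp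
  have h2 : ∑ t ∈ 𝒯.elements with z ∈ t ∧ p ∈ t, side z p t * gradient v (bary t) 0 =
      (v p - v z) * (p 0 - z 0) / dist z p ^ 2 *
        ∑ t ∈ 𝒯.elements with z ∈ t ∧ p ∈ t, side z p t +
      (p 1 - z 1) / dist z p * 𝒯.jump v (edge z p) := by
    rw [jump_eq, Finset.mul_sum, Finset.mul_sum, ← Finset.sum_add_distrib]
    refine Finset.sum_congr rfl fun t ht => ?_
    obtain ⟨ht, hz, hpt⟩ := Finset.mem_filter.1 ht
    exact side_mul_gradient hv ht hpz.symm hz hpt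
  rw [h2]
  split_ifs with hseg
  · rw [sum_side_eq_zero ht₀ hpz.symm hz₀ hp₀ hseg]; ring
  · obtain ⟨h3, h4⟩ := hbd p hp hseg
    rw [h3, h4]; ring

end Triangulation

/-! ### Elements with a vertical shortest edge -/

lemma dist_sq_plane (a b : Plane) : dist a b ^ 2 = (b 0 - a 0) ^ 2 + (b 1 - a 1) ^ 2 := by
  rw [dist_comm, dist_eq_norm, norm_sq_plane, PiLp.sub_apply, PiLp.sub_apply]

lemma abs_sub_fst_le_dist (a b : Plane) : |b 0 - a 0| ≤ dist a b :=
  abs_le_of_sq_le_sq (by rw [dist_sq_plane]; nlinarith [sq_nonneg (b 1 - a 1)]) dist_nonneg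

lemma abs_sub_snd_le_dist (a b : Plane) : |b 1 - a 1| ≤ dist a b :=
  abs_le_of_sq_le_sq (by rw [dist_sq_plane]; nlinarith [sq_nonneg (b 0 - a 0)]) dist_nonneg

lemma dist_le_abs_add_abs (a b : Plane) : dist a b ≤ |b 0 - a 0| + |b 1 - a 1| := by
  refine le_of_sq_le_sq ?_ (by positivity)
  rw [dist_sq_plane, add_sq, sq_abs, sq_abs]
  have : 0 ≤ 2 * |b 0 - a 0| * |b 1 - a 1| := by positivity
  linarith

lemma dist_eq_of_vertical {a b : Plane} (h : b 0 = a 0) : dist a b = |b 1 - a 1| := by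
  rw [← abs_of_nonneg (dist_nonneg (x := a) (y := b)), ← sq_eq_sq_iff_abs_eq_abs, dist_sq_plane, h]
  ring

/-- The triangle `t` has the vertical shortest edge `a b` and the third vertex `c`. -/
structure IsVert (t : Finset Plane) (a b c : Plane) : Prop where
  tri : IsTri t a b c
  vert : b 0 = a 0
  le_left : dist a b ≤ dist a c
  le_right : dist a b ≤ dist b c

namespace IsVert

variable {t : Finset Plane} {a b c : Plane}

lemma swap (h : IsVert t a b c) : IsVert t b a c :=
  ⟨h.tri.swap, h.vert.symm, by rw [dist_comm]; exact h.le_right, by rw [dist_comm]; exact h.le_left⟩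

lemma abs_dblArea (h : IsVert t a b c) : |dblArea a b c| = dist a b * |c 0 - a 0| := by
  rw [dist_eq_of_vertical h.vert, ← abs_mul, dblArea_eq, h.vert, ← abs_neg]
  congr 1; ring

lemma area_eq (h : IsVert t a b c) : area (hull t) = dist a b * |c 0 - a 0| / 2 := by
  rw [h.tri.area_eq, h.abs_dblArea]

lemma third_ne (h : IsVert t a b c) : c 0 ≠ a 0 :=
  Triangulation.third_ne h.tri rfl h.vert

lemma width_pos (h : IsVert t a b c) : 0 < |c 0 - a 0| := abs_pos.2 (sub_ne_zero.2 h.third_ne)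

lemma dist_pos (h : IsVert t a b c) : 0 < dist a b := _root_.dist_pos.2 h.tri.left_ne

lemma bigH_le (h : IsVert t a b c) : bigH t ≤ 2 * dist a c := by
  have h1 := h.le_left
  have h2 := dist_triangle_left b c a
  have h3 := dist_comm c a
  have h4 := dist_nonneg (x := a) (y := c)
  exact h.tri.bigH_le (by linarith) (by linarith) (by linarith)

lemma norm_dcoord_third (h : IsVert t a b c) : ‖dcoord c a b‖ ≤ |c 0 - a 0|⁻¹ := by
  refine (norm_dcoord_le c a b).trans (le_of_eq ?_)
  rw [← dblArea_rotate, h.abs_dblArea]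
  have := h.dist_pos; have := h.width_pos
  field_simp

lemma norm_dcoord_mid (h : IsVert t a b c) :
    ‖dcoord b c a‖ ≤ dist a c / (dist a b * |c 0 - a 0|) := by
  refine (norm_dcoord_le b c a).trans (le_of_eq ?_)
  rw [dblArea_rotate, h.abs_dblArea, dist_comm]

lemma eq_or_of_mem (h : IsVert t a b c) {p q : Plane} (hp : p ∈ t) (hq : q ∈ t) (hpq : p ≠ q)
    (h0 : q 0 = p 0) : (p = a ∧ q = b) ∨ (p = b ∧ q = a) := by
  have hv := h.vert
  have hc := h.third_ne
  rcases h.tri.mem_iff.1 hp with rfl | rfl | rfl <;> rcases h.tri.mem_iff.1 hq with rfl | rfl | rfl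
  · exact absurd rfl hpq
  · exact Or.inl ⟨rfl, rfl⟩
  · exact absurd h0 hc
  · exact Or.inr ⟨rfl, rfl⟩
  · exact absurd rfl hpq
  · exact absurd (h0.trans hv) hc
  · exact absurd h0.symm hc
  · exact absurd (h0.symm.trans hv) hc
  · exact absurd rfl hpq

/-- A triangle with a vertical edge has no other vertical edge. -/
lemma of_isTri (h : IsVert t a b c) {p q r : Plane} (h' : IsTri t p q r) (h0 : q 0 = p 0) :
    IsVert t p q r := by
  have hr : ∀ {p q : Plane}, IsTri t p q r → p = a → q = b → r = c := by
    rintro p q h' rfl rfl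
    rcases h.tri.mem_iff.1 h'.rotate.rotate.left_mem with e | e | e
    · exact absurd e.symm h'.left_ne_right
    · exact absurd e.symm h'.mid_ne
    · exact e
  rcases h.eq_or_of_mem h'.left_mem h'.rotate.left_mem h'.left_ne h0 with ⟨h1, h2⟩ | ⟨h1, h2⟩
  · obtain rfl := hr h' h1 h2
    rwa [h1, h2]
  · obtain rfl := hr h'.swap h2 h1
    rw [h1, h2]; exact h.swap

end IsVert

/-! ### Areas of patches and the boundary of the square -/

lemma volume_closure_unitSquare_ne_top : volume (closure unitSquare) ≠ ⊤ :=
  ((measure_mono (closure_minimal unitSquare_subset_closedBall Metric.isClosed_closedBall)).trans_lt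
    measure_closedBall_lt_top).ne

namespace Triangulation

variable {𝒯 : Triangulation unitSquare}

lemma nodePatch_subset (z : Plane) : 𝒯.nodePatch z ⊆ closure unitSquare := by
  refine Set.iUnion₂_subset fun t ht => Set.iUnion_subset fun _ => 𝒯.hull_subset ht

lemma area_hull_le_nodePatch {t : Finset Plane} (ht : t ∈ 𝒯.elements) {z : Plane} (hz : z ∈ t) :
    area (hull t) ≤ area (𝒯.nodePatch z) := by
  refine measureReal_mono ?_
    (measure_ne_top_of_subset (𝒯.nodePatch_subset z) volume_closure_unitSquare_ne_top)
  intro p hp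
  exact Set.mem_iUnion₂.2 ⟨t, ht, Set.mem_iUnion.2 ⟨hz, hp⟩⟩

lemma area_edgePatch_le {e : Finset Plane} {z : Plane} (hz : z ∈ e) :
    area (𝒯.edgePatch e) ≤ area (𝒯.nodePatch z) := by
  refine measureReal_mono ?_
    (measure_ne_top_of_subset (𝒯.nodePatch_subset z) volume_closure_unitSquare_ne_top)
  refine Set.iUnion₂_mono fun t _ => ?_
  exact Set.iUnion_subset fun h => Set.subset_iUnion_of_subset (h hz) subset_rfl

/-- A node in the closed element `t` is a vertex of `t`. -/
lemma mem_of_mem_hull {t t' : Finset Plane} (ht : t ∈ 𝒯.elements) (ht' : t' ∈ 𝒯.elements)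
    {p : Plane} (hp : p ∈ t) (hp' : p ∈ hull t') : p ∈ t' := by
  by_contra hcon
  obtain ⟨b, c, h⟩ := 𝒯.exists_isTri_of_mem_left ht hp
  have := coord_eq_zero_of_mem_inter ht ht' h hcon (subset_hull t hp) hp'
  rw [coord_self h.ne] at this
  exact one_ne_zero this

end Triangulation

lemma mem_closure_unitSquare {p : Plane} (hp : p ∈ closure unitSquare) :
    0 ≤ p 0 ∧ p 0 ≤ 1 ∧ 0 ≤ p 1 ∧ p 1 ≤ 1 := by
  have hcl : IsClosed {p : Plane | 0 ≤ p 0 ∧ p 0 ≤ 1 ∧ 0 ≤ p 1 ∧ p 1 ≤ 1} := by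
    have h0 : Continuous fun p : Plane => p 0 := by fun_prop
    have h1 : Continuous fun p : Plane => p 1 := by fun_prop
    exact ((isClosed_le continuous_const h0).inter ((isClosed_le h0 continuous_const).inter
      ((isClosed_le continuous_const h1).inter (isClosed_le h1 continuous_const))))
  refine closure_minimal (fun p (hp : p ∈ unitSquare) => ?_) hcl hp
  exact ⟨hp.1.le, hp.2.1.le, hp.2.2.1.le, hp.2.2.2.le⟩

lemma area_rectangle {a b c d : ℝ} (hab : a ≤ b) (hcd : c ≤ d) :
    area (rectangle a b c d) = (b - a) * (d - c) := by
  have hmp := (EuclideanSpace.volume_preserving_symm_measurableEquiv_toLp (Fin 2))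
  have hset : rectangle a b c d =
      (MeasurableEquiv.toLp 2 (Fin 2 → ℝ)).symm ⁻¹' Set.Icc ![a, c] ![b, d] := by
    ext p
    simp [rectangle, Set.mem_Icc, Pi.le_def, Fin.forall_fin_two]
    tauto
  rw [area, measureReal_def, hset, hmp.measure_preimage measurableSet_Icc.nullMeasurableSet,
    Real.volume_Icc_pi, Fin.prod_univ_two, ENNReal.toReal_mul]
  simp [hab, hcd]

/-- As `z` is off the two vertical sides, the segment can fail to be interior only by running along
the top or bottom side. -/
lemma openSegment_subset_unitSquare_or {z p : Plane} (hz : z ∈ closure unitSquare)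
    (hp : p ∈ closure unitSquare) (h0 : 0 < z 0) (h1 : z 0 < 1) :
    openSegment ℝ z p ⊆ unitSquare ∨ (p 1 = z 1 ∧ z ∉ unitSquare ∧ p ∉ unitSquare) := by
  obtain ⟨z0, z0', z1, z1'⟩ := mem_closure_unitSquare hz
  obtain ⟨p0, p0', p1, p1'⟩ := mem_closure_unitSquare hp
  by_cases hb : (z 1 = 0 ∧ p 1 = 0) ∨ (z 1 = 1 ∧ p 1 = 1)
  · right
    rcases hb with ⟨h, h'⟩ | ⟨h, h'⟩
    · exact ⟨by rw [h, h'], fun hh => hh.2.2.1.ne' h, fun hh => hh.2.2.1.ne' h'⟩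
    · exact ⟨by rw [h, h'], fun hh => hh.2.2.2.ne h, fun hh => hh.2.2.2.ne h'⟩
  · left
    rintro q ⟨r, s, hr, hs, hrs, rfl⟩
    obtain rfl : s = 1 - r := by linarith
    simp only [unitSquare, Set.mem_ofPred_eq, PiLp.add_apply, PiLp.smul_apply, smul_eq_mul]
    have a1 := mul_nonneg hs.le p0
    have a2 := mul_pos hr h0
    have a3 := mul_nonneg hs.le (sub_nonneg.2 p0')
    have a4 := mul_pos hr (sub_pos.2 h1)
    have a5 := mul_nonneg hr.le z1
    have a6 := mul_nonneg hs.le p1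
    have a7 := mul_nonneg hr.le (sub_nonneg.2 z1')
    have a8 := mul_nonneg hs.le (sub_nonneg.2 p1')
    refine ⟨by linarith, by linarith, ?_, ?_⟩
    · refine lt_of_le_of_ne (by linarith) fun he => hb (Or.inl ⟨?_, ?_⟩)
      · exact (mul_eq_zero.1 (by linarith : r * z 1 = 0)).resolve_left hr.ne'
      · exact (mul_eq_zero.1 (by linarith : (1 - r) * p 1 = 0)).resolve_left hs.ne'
    · refine lt_of_le_of_ne (by linarith) fun he => hb (Or.inr ⟨?_, ?_⟩)
      · have := (mul_eq_zero.1 (by linarith : r * (1 - z 1) = 0)).resolve_left hr.ne'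
        linarith
      · have := (mul_eq_zero.1 (by linarith : (1 - r) * (1 - p 1) = 0)).resolve_left hs.ne'
        linarith

/-! ### Consequences of the mesh assumptions -/

namespace IsStructuredMesh

open Triangulation

variable {α₀ : ℝ} {M : ℕ} {K c₀ : ℝ} {n : ℕ} {x : ℕ → ℝ} {𝒯 : Triangulation unitSquare}
  {t t' : Finset Plane} {z p q a b c : Plane}

lemma grid_lt (hm : IsStructuredMesh α₀ M K c₀ n x 𝒯) {i j : ℕ} (hij : i < j) (hj : j ≤ n) :
    x i < x j := by
  induction j, hij using Nat.le_induction with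
  | base => exact hm.grid_strictMono i (by omega)
  | succ k hk ih => exact (ih (by omega)).trans (hm.grid_strictMono k (by omega))

lemma grid_injOn (hm : IsStructuredMesh α₀ M K c₀ n x 𝒯) {i j : ℕ} (hi : i ≤ n) (hj : j ≤ n)
    (h : x i = x j) : i = j := by
  rcases lt_trichotomy i j with hij | hij | hij
  · exact absurd h (hm.grid_lt hij hj).ne
  · exact hij
  · exact absurd h.symm (hm.grid_lt hij hi).ne

lemma exists_isVert (hm : IsStructuredMesh α₀ M K c₀ n x 𝒯) (ht : t ∈ 𝒯.elements) :
    ∃ a b c, IsVert t a b c ∧ ∃ j < n, (a 0 = x j ∧ c 0 = x (j + 1)) ∨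
      (a 0 = x (j + 1) ∧ c 0 = x j) := by
  obtain ⟨i, hi, a, b, c, hcoe, ha, hb, h1, h2, hc⟩ := hm.structured t ht
  have hmem : ∀ q, q ∈ t ↔ q = a ∨ q = b ∨ q = c := fun q => by
    rw [← Finset.mem_coe, hcoe]; simp
  have hab : a ≠ b := by
    rintro rfl
    have h3 := 𝒯.card_eq t ht
    classical
    have h4 : t ⊆ {a, c} := fun q hq => by
      rcases (hmem q).1 hq with rfl | rfl | rfl <;> simp
    have := (Finset.card_le_card h4).trans Finset.card_le_two
    omega
  obtain ⟨r, h⟩ := 𝒯.exists_isTri_of_mem ht ((hmem a).2 (Or.inl rfl))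
    ((hmem b).2 (Or.inr (Or.inl rfl))) hab
  obtain rfl : r = c := by
    rcases (hmem r).1 h.rotate.rotate.left_mem with e | e | e
    · exact absurd e.symm h.left_ne_right
    · exact absurd e.symm h.mid_ne
    · exact e
  refine ⟨a, b, r, ⟨h, hb.1.trans ha.1.symm, h1, h2⟩, ?_⟩
  rcases hc with ⟨hi', hc⟩ | ⟨hi', hc⟩
  · exact ⟨i, by omega, Or.inl ⟨ha.1, hc.1⟩⟩
  · refine ⟨i - 1, by omega, Or.inr ⟨?_, hc.1⟩⟩
    rw [ha.1]; congr 1; omega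

lemma isVert (hm : IsStructuredMesh α₀ M K c₀ n x 𝒯) (ht : t ∈ 𝒯.elements) (h : IsTri t a b c)
    (h0 : b 0 = a 0) : IsVert t a b c := by
  obtain ⟨a', b', c', h', -⟩ := hm.exists_isVert ht
  exact h'.of_isTri h h0

lemma exists_isVert_of_ne (hm : IsStructuredMesh α₀ M K c₀ n x 𝒯) (ht : t ∈ 𝒯.elements)
    (hp : p ∈ t) (hq : q ∈ t) (h0 : q 0 ≠ p 0) : ∃ r, IsVert t p r q ∨ IsVert t q r p := by
  obtain ⟨a, b, c, h, -⟩ := hm.exists_isVert ht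
  have hv := h.vert
  rcases h.tri.mem_iff.1 hp with rfl | rfl | rfl <;> rcases h.tri.mem_iff.1 hq with rfl | rfl | rfl
  · exact absurd rfl h0
  · exact absurd hv h0
  · exact ⟨_, Or.inl h⟩
  · exact absurd hv.symm h0
  · exact absurd rfl h0
  · exact ⟨_, Or.inl h.swap⟩
  · exact ⟨_, Or.inr h⟩
  · exact ⟨_, Or.inr h.swap⟩
  · exact absurd rfl h0

/-- Each element lies between two neighbouring grid lines. -/
lemma exists_slab (hm : IsStructuredMesh α₀ M K c₀ n x 𝒯) (ht : t ∈ 𝒯.elements) :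
    ∃ j < n, ∀ z ∈ t, z 0 = x j ∨ z 0 = x (j + 1) := by
  obtain ⟨a, b, c, h, j, hj⟩ := hm.exists_isVert ht
  have hv := h.vert
  refine ⟨j, hj.1, fun z hz => ?_⟩
  rcases h.tri.mem_iff.1 hz with rfl | rfl | rfl <;> rcases hj.2 with ⟨h1, h2⟩ | ⟨h1, h2⟩ <;>
    simp [h1, h2, hv]

/-- A non-vertical edge joins the third vertex to an end of the shortest edge, and the triangle
inequality bounds the remaining edge by twice its length. -/
lemma bigH_le_two_mul_dist (hm : IsStructuredMesh α₀ M K c₀ n x 𝒯) (ht : t ∈ 𝒯.elements)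
    (hp : p ∈ t) (hq : q ∈ t) (h0 : q 0 ≠ p 0) : bigH t ≤ 2 * dist p q := by
  obtain ⟨r, h | h⟩ := hm.exists_isVert_of_ne ht hp hq h0
  · exact h.bigH_le
  · rw [dist_comm]; exact h.bigH_le

lemma area_le (hm : IsStructuredMesh α₀ M K c₀ n x 𝒯) (ht : t ∈ 𝒯.elements)
    (ht' : t' ∈ 𝒯.elements) (hz : z ∈ t) (hz' : z ∈ t') :
    area (hull t') ≤ K * area (hull t) :=
  (area_hull_le_nodePatch ht' hz').trans (hm.comparable z ⟨t, ht, hz⟩ t ht hz)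

lemma one_le (hm : IsStructuredMesh α₀ M K c₀ n x 𝒯) (ht : t ∈ 𝒯.elements) : 1 ≤ K := by
  obtain ⟨a, b, c, h⟩ := 𝒯.exists_isTri ht
  have := hm.area_le ht ht h.left_mem h.left_mem
  exact le_of_mul_le_mul_right (by linarith) h.area_pos

/-- Elements at a node have a bounded vertical extent. -/
lemma abs_sub_snd_le (hm : IsStructuredMesh α₀ M K c₀ n x 𝒯) (ht : t ∈ 𝒯.elements)
    (h : IsVert t a b c) (hz : z ∈ t) (ht' : t' ∈ 𝒯.elements) (hz' : z ∈ t') (hp : p ∈ t') :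
    |p 1 - z 1| ≤ K ^ 2 * dist a b / 2 := by
  obtain ⟨x₁, x₂, y₁, y₂, hsub, harea⟩ := hm.orientation z ⟨t, ht, hz⟩
  have hK := hm.one_le ht
  have hin : ∀ {t : Finset Plane}, t ∈ 𝒯.elements → z ∈ t → ∀ {q}, q ∈ t →
      q ∈ rectangle x₁ x₂ y₁ y₂ := fun ht hz q hq =>
    hsub (Set.mem_iUnion₂.2 ⟨_, ht, Set.mem_iUnion.2 ⟨hz, subset_hull _ hq⟩⟩)
  have h1 := hin ht hz h.tri.left_mem
  have h2 := hin ht hz h.tri.rotate.rotate.left_mem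
  have h3 := hin ht' hz' hz'
  have h4 := hin ht' hz' hp
  rw [area_rectangle (h1.1.trans h1.2.1) (h1.2.2.1.trans h1.2.2.2)] at harea
  have h5 := hm.comparable z ⟨t, ht, hz⟩ t ht hz
  rw [h.area_eq] at h5
  have hw : |c 0 - a 0| ≤ x₂ - x₁ := by
    rw [abs_le]; constructor <;> linarith [h1.1, h1.2.1, h2.1, h2.2.1]
  have hy : |p 1 - z 1| ≤ y₂ - y₁ := by
    rw [abs_le]; constructor <;> linarith [h3.2.2.1, h3.2.2.2, h4.2.2.1, h4.2.2.2]
  refine hy.trans ?_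
  -- Width times height of the rectangle is at most `K |ω_z| ≤ K² |t|`, and `|t|` is half the short
  -- edge times the width of `t`. The width cancels.
  have h6 : |c 0 - a 0| * (y₂ - y₁) ≤ |c 0 - a 0| * (K ^ 2 * dist a b / 2) := by
    calc _ ≤ (x₂ - x₁) * (y₂ - y₁) :=
          mul_le_mul_of_nonneg_right hw (by linarith [h1.2.2.1, h1.2.2.2])
      _ ≤ K * (K * (dist a b * |c 0 - a 0| / 2)) := harea.trans (by gcongr)
      _ = _ := by ring
  exact le_of_mul_le_mul_left h6 h.width_pos

end IsStructuredMesh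

/-! ### Vertical edges at a node -/

lemma zero_le_of_abs_le {a b : ℝ} (h : |a| ≤ b) : 0 ≤ b := (abs_nonneg a).trans h

namespace Triangulation

variable {𝒯 : Triangulation unitSquare} {z p q : Plane}

lemma neighbours_symm (h : p ∈ 𝒯.neighbours z) : z ∈ 𝒯.neighbours p := by
  obtain ⟨hne, t, ht, hz, hp⟩ := mem_neighbours.1 h
  exact mem_neighbours.2 ⟨hne.symm, t, ht, hp, hz⟩

lemma neighbours_mem_closure (h : p ∈ 𝒯.neighbours z) :
    z ∈ closure unitSquare ∧ p ∈ closure unitSquare := by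
  obtain ⟨-, t, ht, hz, hp⟩ := mem_neighbours.1 h
  exact ⟨𝒯.vertex_mem_closure ht hz, 𝒯.vertex_mem_closure ht hp⟩

lemma snd_ne_of_vertical (hne : p ≠ z) (h0 : p 0 = z 0) : p 1 ≠ z 1 :=
  fun h => hne (plane_ext h0 h)

lemma openSegment_subset_of_vertical (h : p ∈ 𝒯.neighbours z) (h0 : p 0 = z 0) (hz0 : 0 < z 0)
    (hz1 : z 0 < 1) : openSegment ℝ z p ⊆ unitSquare := by
  obtain ⟨hz, hp⟩ := neighbours_mem_closure h
  refine (openSegment_subset_unitSquare_or hz hp hz0 hz1).resolve_right fun hh => ?_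
  exact snd_ne_of_vertical (mem_neighbours.1 h).1 h0 hh.1

/-- There is at most one vertical edge in each direction at a node. -/
lemma eq_of_vertical (hp : p ∈ 𝒯.neighbours z) (hq : q ∈ 𝒯.neighbours z) (hp0 : p 0 = z 0)
    (hq0 : q 0 = z 0) (hpq : 0 < (p 1 - z 1) * (q 1 - z 1)) : p = q := by
  -- If `p` is the nearer of the two, it lies on the edge from `z` to `q`, so it is a vertex of the
  -- element containing that edge. Unless `p = q`, this element would have three collinear vertices.
  have key : ∀ {p q}, p ∈ 𝒯.neighbours z → q ∈ 𝒯.neighbours z → p 0 = z 0 → q 0 = z 0 →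
      0 < (p 1 - z 1) / (q 1 - z 1) → (p 1 - z 1) / (q 1 - z 1) ≤ 1 → p = q := by
    intro p q hp hq hp0 hq0 h1 h2
    obtain ⟨hpz, t, ht, hzt, hpt⟩ := mem_neighbours.1 hp
    obtain ⟨hqz, t', ht', hzt', hqt'⟩ := mem_neighbours.1 hq
    have hd : q 1 - z 1 ≠ 0 := sub_ne_zero.2 (snd_ne_of_vertical hqz hq0)
    have hmem : p ∈ hull t' := by
      refine (convex_hull t').segment_subset (subset_hull t' hzt') (subset_hull t' hqt')
        ⟨1 - (p 1 - z 1) / (q 1 - z 1), (p 1 - z 1) / (q 1 - z 1), by linarith, h1.le, by ring, ?_⟩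
      apply plane_ext
      · simp only [PiLp.add_apply, PiLp.smul_apply, smul_eq_mul]
        rw [hp0, hq0]; ring
      · simp only [PiLp.add_apply, PiLp.smul_apply, smul_eq_mul]
        field_simp; ring
    have hpt' := mem_of_mem_hull ht ht' hpt hmem
    by_contra hne
    obtain ⟨r, h⟩ := 𝒯.exists_isTri_of_mem ht' hzt' hpt' hpz.symm
    have hr := third_ne h rfl hp0
    rcases h.mem_iff.1 hqt' with rfl | rfl | rfl
    · exact hqz rfl
    · exact hne rfl
    · exact hr hq0
  have hp' : p 1 - z 1 ≠ 0 := by rintro h; rw [h, zero_mul] at hpq; exact lt_irrefl _ hpq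
  have hq' : q 1 - z 1 ≠ 0 := by rintro h; rw [h, mul_zero] at hpq; exact lt_irrefl _ hpq
  have e1 : 0 < (p 1 - z 1) / (q 1 - z 1) := by
    rw [div_eq_mul_inv]
    have := mul_pos hpq (sq_pos_of_ne_zero (inv_ne_zero hq'))
    refine this.trans_eq ?_
    field_simp
  rcases le_or_gt ((p 1 - z 1) / (q 1 - z 1)) 1 with h | h
  · exact key hp hq hp0 hq0 e1 h
  · have e2 := inv_lt_one_of_one_lt₀ h
    have e3 := inv_pos.2 e1
    rw [inv_div] at e2 e3
    exact (key hq hp hq0 hp0 e3 e2.le).symm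

variable (𝒯) in
open Classical in
/-- The sum of the absolute values of the jumps over the non-vertical interior edges at a node. -/
def longJumps (v : Plane → ℝ) (z : Plane) : ℝ :=
  ∑ p ∈ 𝒯.neighbours z with openSegment ℝ z p ⊆ unitSquare ∧ p 0 ≠ z 0, |𝒯.jump v (edge z p)|

lemma longJumps_nonneg (v : Plane → ℝ) (z : Plane) : 0 ≤ 𝒯.longJumps v z :=
  Finset.sum_nonneg fun _ _ => abs_nonneg _

-- The relation between the jumps at a node is solved for the vertical edges. The hypothesis on
-- boundary edges holds because `z` is off the vertical sides, so such edges lie on the top or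
-- bottom side, where `v = 0`.
open Classical in
lemma abs_sum_vertical_le {v : Plane → ℝ} (hv : 𝒯.IsFEFunction v) (hz0 : 0 < z 0) (hz1 : z 0 < 1)
    {r : ℝ} (hr : ∀ p ∈ 𝒯.neighbours z, p 0 ≠ z 0 → |p 1 - z 1| / dist z p ≤ r) :
    |∑ p ∈ 𝒯.neighbours z with p 0 = z 0, (p 1 - z 1) / dist z p * 𝒯.jump v (edge z p)| ≤
      r * 𝒯.longJumps v z := by
  have hfr : ∀ p ∈ closure unitSquare, p ∉ unitSquare → v p = 0 := fun p hp hp' =>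
    hv.2 p (by rw [isOpen_unitSquare.frontier_eq]; exact ⟨hp, hp'⟩)
  have h := sum_neighbours_eq_zero hv.1 z (fun p hp hns => by
    obtain ⟨hzc, hpc⟩ := neighbours_mem_closure hp
    rcases openSegment_subset_unitSquare_or hzc hpc hz0 hz1 with h | ⟨h1, h2, h3⟩
    · exact absurd h hns
    · exact ⟨h1, by rw [hfr p hpc h3, hfr z hzc h2]⟩)
  rw [← Finset.sum_filter_add_sum_filter_not _ (fun p : Plane => p 0 = z 0), Finset.filter_filter,
    Finset.filter_filter] at h
  have e : (𝒯.neighbours z).filter (fun p => openSegment ℝ z p ⊆ unitSquare ∧ p 0 = z 0) =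
      (𝒯.neighbours z).filter (fun p => p 0 = z 0) :=
    Finset.filter_congr fun p hp =>
      ⟨fun h => h.2, fun h => ⟨openSegment_subset_of_vertical hp h hz0 hz1, h⟩⟩
  rw [e] at h
  rw [eq_neg_of_add_eq_zero_left h, abs_neg, longJumps, Finset.mul_sum]
  refine (Finset.abs_sum_le_sum_abs _ _).trans (Finset.sum_le_sum fun p hp => ?_)
  obtain ⟨hp, -, hp0⟩ := Finset.mem_filter.1 hp
  rw [abs_mul, abs_div, abs_of_nonneg dist_nonneg]
  exact mul_le_mul_of_nonneg_right (hr p hp hp0) (abs_nonneg _)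

lemma vertical_coeff (hp : p ∈ 𝒯.neighbours z) (hp0 : p 0 = z 0) :
    (0 < p 1 - z 1 ∧ (p 1 - z 1) / dist z p = 1) ∨
    (p 1 - z 1 < 0 ∧ (p 1 - z 1) / dist z p = -1) := by
  rw [dist_eq_of_vertical hp0]
  rcases (sub_ne_zero.2 (snd_ne_of_vertical (mem_neighbours.1 hp).1 hp0)).lt_or_gt with h | h
  · exact Or.inr ⟨h, by rw [abs_of_neg h, div_neg, div_self h.ne]⟩
  · exact Or.inl ⟨h, by rw [abs_of_pos h, div_self h.ne']⟩

/-- The jumps across the vertical edges at a node differ by the jumps across the other edges. -/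
theorem abs_jump_sub_jump_le {v : Plane → ℝ} (hv : 𝒯.IsFEFunction v) (hz0 : 0 < z 0)
    (hz1 : z 0 < 1) {r : ℝ}
    (hr : ∀ p ∈ 𝒯.neighbours z, p 0 ≠ z 0 → |p 1 - z 1| / dist z p ≤ r)
    (hp : p ∈ 𝒯.neighbours z) (hp0 : p 0 = z 0) (hq : q ∈ 𝒯.neighbours z) (hq0 : q 0 = z 0) :
    |𝒯.jump v (edge z p) - 𝒯.jump v (edge z q)| ≤ r * 𝒯.longJumps v z := by
  classical
  have key := abs_sum_vertical_le hv hz0 hz1 hr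
  by_cases hpq : p = q
  · rw [hpq, sub_self, abs_zero]; exact zero_le_of_abs_le key
  have hopp : ∀ {p q}, p ∈ 𝒯.neighbours z → q ∈ 𝒯.neighbours z → p 0 = z 0 → q 0 = z 0 →
      0 < (p 1 - z 1) → 0 < (q 1 - z 1) → p = q := fun hp hq hp0 hq0 h1 h2 =>
    eq_of_vertical hp hq hp0 hq0 (mul_pos h1 h2)
  have hopp' : ∀ {p q}, p ∈ 𝒯.neighbours z → q ∈ 𝒯.neighbours z → p 0 = z 0 → q 0 = z 0 →
      (p 1 - z 1) < 0 → (q 1 - z 1) < 0 → p = q := fun hp hq hp0 hq0 h1 h2 =>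
    eq_of_vertical hp hq hp0 hq0 (mul_pos_of_neg_of_neg h1 h2)
  -- Two distinct vertical edges at `z` point in opposite directions and exhaust the vertical edges
  -- there, so the sum is plus or minus the difference of the two jumps.
  have e : (𝒯.neighbours z).filter (fun p => p 0 = z 0) = {p, q} := by
    ext s
    simp only [Finset.mem_filter, Finset.mem_insert, Finset.mem_singleton]
    constructor
    · rintro ⟨hs, hs0⟩
      rcases vertical_coeff hs hs0 with ⟨h1, -⟩ | ⟨h1, -⟩ <;>
        rcases vertical_coeff hp hp0 with ⟨h2, -⟩ | ⟨h2, -⟩ <;>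
        rcases vertical_coeff hq hq0 with ⟨h3, -⟩ | ⟨h3, -⟩
      · exact Or.inl (hopp hs hp hs0 hp0 h1 h2)
      · exact Or.inl (hopp hs hp hs0 hp0 h1 h2)
      · exact Or.inr (hopp hs hq hs0 hq0 h1 h3)
      · exact absurd (hopp' hp hq hp0 hq0 h2 h3) hpq
      · exact absurd (hopp hp hq hp0 hq0 h2 h3) hpq
      · exact Or.inr (hopp' hs hq hs0 hq0 h1 h3)
      · exact Or.inl (hopp' hs hp hs0 hp0 h1 h2)
      · exact Or.inl (hopp' hs hp hs0 hp0 h1 h2)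
    · rintro (rfl | rfl)
      · exact ⟨hp, hp0⟩
      · exact ⟨hq, hq0⟩
  rw [e, Finset.sum_pair hpq] at key
  rcases vertical_coeff hp hp0 with ⟨h2, h2'⟩ | ⟨h2, h2'⟩ <;>
    rcases vertical_coeff hq hq0 with ⟨h3, h3'⟩ | ⟨h3, h3'⟩
  · exact absurd (hopp hp hq hp0 hq0 h2 h3) hpq
  · rw [h2', h3'] at key
    convert key using 2; ring
  · rw [h2', h3', ← abs_neg] at key
    convert key using 2; ring
  · exact absurd (hopp' hp hq hp0 hq0 h2 h3) hpq

/-- A node on the top or bottom side has a single vertical edge, so the relation bounds the jump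
itself rather than a difference. This is what allows the nodal value zero there. -/
theorem abs_jump_le_of_notMem {v : Plane → ℝ} (hv : 𝒯.IsFEFunction v) (hz0 : 0 < z 0)
    (hz1 : z 0 < 1) {r : ℝ}
    (hr : ∀ p ∈ 𝒯.neighbours z, p 0 ≠ z 0 → |p 1 - z 1| / dist z p ≤ r) (hz : z ∉ unitSquare)
    (hp : p ∈ 𝒯.neighbours z) (hp0 : p 0 = z 0) :
    |𝒯.jump v (edge z p)| ≤ r * 𝒯.longJumps v z := by
  classical
  have key := abs_sum_vertical_le hv hz0 hz1 hr
  have e : (𝒯.neighbours z).filter (fun p => p 0 = z 0) = {p} := by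
    ext s
    simp only [Finset.mem_filter, Finset.mem_singleton]
    constructor
    · rintro ⟨hs, hs0⟩
      obtain ⟨-, -, s1, s2⟩ := mem_closure_unitSquare (neighbours_mem_closure hs).2
      obtain ⟨-, -, p1, p2⟩ := mem_closure_unitSquare (neighbours_mem_closure hp).2
      obtain ⟨-, -, z1, z2⟩ := mem_closure_unitSquare (neighbours_mem_closure hp).1
      have hsne := snd_ne_of_vertical (mem_neighbours.1 hs).1 hs0
      have hpne := snd_ne_of_vertical (mem_neighbours.1 hp).1 hp0
      refine eq_of_vertical hs hp hs0 hp0 ?_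
      rcases z1.eq_or_lt with h | h
      · rw [← h] at hsne hpne ⊢
        rw [sub_zero, sub_zero]
        exact mul_pos (lt_of_le_of_ne s1 hsne.symm) (lt_of_le_of_ne p1 hpne.symm)
      · have h' : z 1 = 1 := by
          by_contra hcon
          exact hz ⟨hz0, hz1, h, lt_of_le_of_ne z2 hcon⟩
        rw [h'] at hsne hpne ⊢
        exact mul_pos_of_neg_of_neg (sub_neg.2 (lt_of_le_of_ne s2 hsne))
          (sub_neg.2 (lt_of_le_of_ne p2 hpne))
    · rintro rfl
      exact ⟨hp, hp0⟩
  rw [e, Finset.sum_singleton, abs_mul] at key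
  rcases vertical_coeff hp hp0 with ⟨h2, h2'⟩ | ⟨h2, h2'⟩
  · rwa [h2', abs_one, one_mul] at key
  · rwa [h2', abs_neg, abs_one, one_mul] at key

/-! ### Jumps across the long edges -/

variable (𝒯) in
open Classical in
/-- The sum of the local errors over the elements at a node. -/
def nodeEta (f uh : Plane → ℝ) (gu : Plane → Plane) (z : Plane) : ℝ :=
  ∑ t ∈ 𝒯.elements with z ∈ t, Real.sqrt (etaSq f uh gu t)

end Triangulation

namespace IsStructuredMesh

open Triangulation

variable {α₀ : ℝ} {M : ℕ} {K c₀ : ℝ} {n : ℕ} {x : ℕ → ℝ} {𝒯 : Triangulation unitSquare}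
  {t t' : Finset Plane} {z p q a b c : Plane}

lemma sqrt_area_le (hm : IsStructuredMesh α₀ M K c₀ n x 𝒯) (ht : t ∈ 𝒯.elements)
    (ht' : t' ∈ 𝒯.elements) (hz : z ∈ t) (hz' : z ∈ t') :
    Real.sqrt (area (hull t')) ≤ K * Real.sqrt (area (hull t)) := by
  have hK := hm.one_le ht
  have h := hm.area_le ht ht' hz hz'
  have h0 : 0 ≤ area (hull t) := measureReal_nonneg
  rw [Real.sqrt_le_left (by positivity), mul_pow, Real.sq_sqrt h0]
  refine h.trans (mul_le_mul_of_nonneg_right ?_ h0)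
  nlinarith

lemma card_le (hm : IsStructuredMesh α₀ M K c₀ n x 𝒯) (ht : t ∈ 𝒯.elements) (hz : z ∈ t)
    [DecidablePred fun t : Finset Plane => z ∈ t] :
    (𝒯.elements.filter fun t => z ∈ t).card ≤ M := by
  have := hm.valence z ⟨t, ht, hz⟩
  have e : {t | t ∈ 𝒯.elements ∧ z ∈ t} =
      ((𝒯.elements.filter fun t => z ∈ t : Finset (Finset Plane)) : Set (Finset Plane)) := by
    ext; simp
  rwa [e, Set.ncard_coe_finset] at this

-- In `edge_estimate` the factor `H_T` is at most twice the length of a non-vertical edge, so the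
-- length cancels; `1824 = 2 * 912`. The factor `K` replaces the area of each element at the edge by
-- that of `t'`.
open Classical in
lemma long_jump_le (hm : IsStructuredMesh α₀ M K c₀ n x 𝒯) {f u uh : Plane → ℝ}
    {gu : Plane → Plane} (hf : IsData f) (hu : IsWeakSolution unitSquare f u gu)
    (hpq : q 0 ≠ p 0) (hint : openSegment ℝ p q ⊆ unitSquare) (ht' : t' ∈ 𝒯.elements)
    (hp : p ∈ t') : |𝒯.jump uh (edge p q)| * Real.sqrt (area (hull t')) ≤
      1824 * K * ∑ t ∈ 𝒯.elements with edge p q ⊆ t, Real.sqrt (etaSq f uh gu t) := by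
  have hne : p ≠ q := fun h => hpq (by rw [h])
  have hd : 0 < dist p q := dist_pos.2 hne
  have h := 𝒯.edge_estimate (uh := uh) hf hu (coe_edge p q) hne hint
  set s' := Real.sqrt (area (hull t')) with hs'
  have h1 : |𝒯.jump uh (edge p q)| * s' * dist p q ≤
      1824 * K * (∑ t ∈ 𝒯.elements with edge p q ⊆ t, Real.sqrt (etaSq f uh gu t)) * dist p q := by
    calc _ = |𝒯.jump uh (edge p q)| * dist p q * s' := by ring
      _ ≤ (912 * ∑ t ∈ 𝒯.elements with edge p q ⊆ t,
          bigH t / Real.sqrt (area (hull t)) * Real.sqrt (etaSq f uh gu t)) * s' :=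
        mul_le_mul_of_nonneg_right h (Real.sqrt_nonneg _)
      _ = 912 * ∑ t ∈ 𝒯.elements with edge p q ⊆ t,
          bigH t * (s' / Real.sqrt (area (hull t))) * Real.sqrt (etaSq f uh gu t) := by
        rw [mul_assoc, Finset.sum_mul]
        congr 1
        refine Finset.sum_congr rfl fun t _ => ?_
        ring
      _ ≤ 912 * ∑ t ∈ 𝒯.elements with edge p q ⊆ t,
          2 * dist p q * K * Real.sqrt (etaSq f uh gu t) := by
        refine mul_le_mul_of_nonneg_left (Finset.sum_le_sum fun t ht => ?_) (by norm_num)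
        obtain ⟨ht, hpt, hqt⟩ : t ∈ 𝒯.elements ∧ p ∈ t ∧ q ∈ t := by
          simpa [edge_subset] using ht
        obtain ⟨a, b, c, habc⟩ := 𝒯.exists_isTri ht
        have hsp : 0 < Real.sqrt (area (hull t)) := Real.sqrt_pos.2 habc.area_pos
        refine mul_le_mul_of_nonneg_right ?_ (Real.sqrt_nonneg _)
        refine mul_le_mul (hm.bigH_le_two_mul_dist ht hpt hqt hpq) ?_
          (div_nonneg (Real.sqrt_nonneg _) hsp.le) (by positivity)
        rw [div_le_iff₀ hsp]
        exact hm.sqrt_area_le ht ht' hpt hp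
      _ = _ := by
        rw [← Finset.mul_sum]; ring
  exact le_of_mul_le_mul_right h1 hd

open Classical in
lemma sq_sum_sqrt_eta_le (hm : IsStructuredMesh α₀ M K c₀ n x 𝒯) {f uh : Plane → ℝ}
    {gu : Plane → Plane} (ht : t ∈ 𝒯.elements) (hz : z ∈ t) {U : Finset (Finset Plane)}
    (hU : U ⊆ 𝒯.elements.filter fun t => z ∈ t) :
    (∑ t ∈ U, Real.sqrt (etaSq f uh gu t)) ^ 2 ≤ M * ∑ t ∈ U, etaSq f uh gu t := by
  have h := sq_sum_le_card_mul_sum_sq (s := U) (f := fun t => Real.sqrt (etaSq f uh gu t))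
  have e : ∀ t, Real.sqrt (etaSq f uh gu t) ^ 2 = etaSq f uh gu t := fun t =>
    Real.sq_sqrt (etaSq_nonneg f uh gu t)
  simp only [e] at h
  refine h.trans (mul_le_mul_of_nonneg_right ?_ (Finset.sum_nonneg fun t _ => etaSq_nonneg f uh gu t))
  exact_mod_cast (Finset.card_le_card hU).trans (hm.card_le ht hz)

open Classical in
/-- The estimator on a long edge. -/
theorem long_edge_estimate (hm : IsStructuredMesh α₀ M K c₀ n x 𝒯) {f u uh : Plane → ℝ}
    {gu : Plane → Plane} (hf : IsData f) (hu : IsWeakSolution unitSquare f u gu)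
    (ht₀ : t ∈ 𝒯.elements) (hp : p ∈ t)
    (hpq : q 0 ≠ p 0) (hint : openSegment ℝ p q ⊆ unitSquare) :
    area (𝒯.edgePatch (edge p q)) * 𝒯.jump uh (edge p q) ^ 2 ≤
      1824 ^ 2 * K ^ 3 * M * ∑ t ∈ 𝒯.elements with edge p q ⊆ t, etaSq f uh gu t := by
  have hK := hm.one_le ht₀
  have h1 := hm.long_jump_le (uh := uh) hf hu hpq hint ht₀ hp
  have h2 : area (𝒯.edgePatch (edge p q)) ≤ K * area (hull t) :=
    (area_edgePatch_le (mem_edge.2 (Or.inl rfl))).trans (hm.comparable p ⟨t, ht₀, hp⟩ t ht₀ hp)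
  have h3 := hm.sq_sum_sqrt_eta_le (f := f) (uh := uh) (gu := gu) ht₀ hp
    (U := 𝒯.elements.filter fun t => edge p q ⊆ t)
    (Finset.monotone_filter_right _ fun t _ h => (edge_subset.1 h).1)
  have h4 := pow_le_pow_left₀ (by positivity) h1 2
  have h0 : 0 ≤ area (hull t) := measureReal_nonneg
  rw [mul_pow, sq_abs, Real.sq_sqrt h0, mul_pow] at h4
  calc _ ≤ K * area (hull t) * 𝒯.jump uh (edge p q) ^ 2 := mul_le_mul_of_nonneg_right h2 (sq_nonneg _)
    _ = K * (𝒯.jump uh (edge p q) ^ 2 * area (hull t)) := by ring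
    _ ≤ K * ((1824 * K) ^ 2 * (M * ∑ t ∈ 𝒯.elements with edge p q ⊆ t, etaSq f uh gu t)) := by
      refine mul_le_mul_of_nonneg_left (h4.trans ?_) (by linarith)
      exact mul_le_mul_of_nonneg_left h3 (sq_nonneg _)
    _ = _ := by ring

lemma card_neighbours_le (hm : IsStructuredMesh α₀ M K c₀ n x 𝒯) (ht : t ∈ 𝒯.elements)
    (hz : z ∈ t) : (𝒯.neighbours z).card ≤ 3 * M := by
  classical
  rw [neighbours]
  refine (Finset.card_le_card (Finset.erase_subset _ _)).trans ?_
  refine (Finset.card_biUnion_le_card_mul _ _ 3 fun t ht => ?_).trans ?_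
  · exact (𝒯.card_eq t (Finset.mem_filter.1 ht).1).le
  · rw [mul_comm]
    exact Nat.mul_le_mul_left 3 (hm.card_le ht hz)

/-- A node has at most `3 * M` neighbours, whence `5472 = 3 * 1824`. -/
lemma longJumps_le (hm : IsStructuredMesh α₀ M K c₀ n x 𝒯) {f u uh : Plane → ℝ}
    {gu : Plane → Plane} (hf : IsData f) (hu : IsWeakSolution unitSquare f u gu)
    (ht : t ∈ 𝒯.elements) (hz : z ∈ t) :
    𝒯.longJumps uh z * Real.sqrt (area (hull t)) ≤
      5472 * K * M * 𝒯.nodeEta f uh gu z := by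
  classical
  have hK := hm.one_le ht
  have hN : 0 ≤ 𝒯.nodeEta f uh gu z := Finset.sum_nonneg fun _ _ => Real.sqrt_nonneg _
  rw [longJumps, Finset.sum_mul]
  calc _ ≤ ∑ p ∈ 𝒯.neighbours z with openSegment ℝ z p ⊆ unitSquare ∧ p 0 ≠ z 0,
        1824 * K * 𝒯.nodeEta f uh gu z := by
        refine Finset.sum_le_sum fun p hp => ?_
        obtain ⟨-, hint, hne⟩ := Finset.mem_filter.1 hp
        refine (hm.long_jump_le hf hu hne hint ht hz).trans ?_
        refine mul_le_mul_of_nonneg_left ?_ (by positivity)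
        exact Finset.sum_le_sum_of_subset_of_nonneg
          (Finset.monotone_filter_right _ fun t _ h => (edge_subset.1 h).1)
          fun _ _ _ => Real.sqrt_nonneg _
    _ ≤ (3 * M : ℕ) * (1824 * K * 𝒯.nodeEta f uh gu z) := by
        rw [Finset.sum_const, nsmul_eq_mul]
        refine mul_le_mul_of_nonneg_right ?_ (by positivity)
        exact_mod_cast (Finset.card_filter_le _ _).trans (hm.card_neighbours_le ht hz)
    _ = _ := by push_cast; ring

end IsStructuredMesh

/-! ### Nodal values of the jumps on a vertical line -/

namespace Triangulation

variable {𝒯 : Triangulation unitSquare} {X : ℝ}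

lemma exists_edge_of_mem_edges {S : Finset Plane} (hS : S ∈ 𝒯.edges) :
    ∃ t ∈ 𝒯.elements, ∃ a b, a ∈ t ∧ b ∈ t ∧ a ≠ b ∧ S = edge a b := by
  classical
  rw [edges, Finset.mem_biUnion] at hS
  obtain ⟨t, ht, hS⟩ := hS
  obtain ⟨hSt, hcard⟩ := Finset.mem_powersetCard.1 hS
  obtain ⟨a, b, hab, rfl⟩ := Finset.card_eq_two.1 hcard
  refine ⟨t, ht, a, b, hSt (by simp), hSt (by simp), hab, ?_⟩
  ext q; rw [mem_edge]; simp

lemma edge_mem_edges {t : Finset Plane} {a b : Plane} (ht : t ∈ 𝒯.elements) (ha : a ∈ t)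
    (hb : b ∈ t) (hab : a ≠ b) : edge a b ∈ 𝒯.edges := by
  classical
  rw [edges, Finset.mem_biUnion]
  refine ⟨t, ht, Finset.mem_powersetCard.2 ⟨edge_subset.2 ⟨ha, hb⟩, ?_⟩⟩
  rw [Finset.card_eq_two]
  refine ⟨a, b, hab, ?_⟩
  ext q; rw [mem_edge]; simp

lemma exists_of_mem_verticalEdges {S : Finset Plane} (hS : S ∈ 𝒯.verticalEdges X) :
    ∃ t ∈ 𝒯.elements, ∃ a b, a ∈ t ∧ b ∈ t ∧ a ≠ b ∧ S = edge a b ∧ a 0 = X ∧ b 0 = X := by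
  classical
  obtain ⟨hS, hX⟩ := Finset.mem_filter.1 hS
  obtain ⟨t, ht, a, b, ha, hb, hab, rfl⟩ := exists_edge_of_mem_edges hS
  exact ⟨t, ht, a, b, ha, hb, hab, rfl, hX a (mem_edge.2 (Or.inl rfl)), hX b (mem_edge.2 (Or.inr rfl))⟩

lemma edge_mem_verticalEdges {t : Finset Plane} {a b : Plane} (ht : t ∈ 𝒯.elements) (ha : a ∈ t)
    (hb : b ∈ t) (hab : a ≠ b) (ha0 : a 0 = X) (hb0 : b 0 = X) : edge a b ∈ 𝒯.verticalEdges X := by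
  classical
  refine Finset.mem_filter.2 ⟨edge_mem_edges ht ha hb hab, fun z hz => ?_⟩
  rcases mem_edge.1 hz with rfl | rfl <;> assumption

lemma sum_edge {a b : Plane} (hab : a ≠ b) (g : Plane → ℝ) : ∑ z ∈ edge a b, g z = g a + g b := by
  classical
  have : edge a b = {a, b} := by ext q; rw [mem_edge]; simp
  rw [this, Finset.sum_pair hab]

lemma diam_edge (a b : Plane) : Metric.diam (edge a b : Set Plane) = dist a b := by
  rw [coe_edge, Metric.diam_pair]

/-- At a node of the line inside the square, `J` is the jump across an arbitrarily chosen vertical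
edge, if there is one. At all other points it is zero, so that the test function vanishes on the
boundary. The choice is immaterial up to long-edge jumps. The slope bound `r` stays free: it is
later taken proportional to the short edge for the gradient, and equal to `1` when the jumps are
compared with `J`. -/
lemma exists_lineJump {v : Plane → ℝ} (hv : 𝒯.IsFEFunction v) (hX0 : 0 < X) (hX1 : X < 1) :
    ∃ J : Plane → ℝ, (∀ z ∉ unitSquare, J z = 0) ∧ (∀ z, z 0 ≠ X → J z = 0) ∧
      (∀ z, J z ≠ 0 → ∃ p ∈ 𝒯.neighbours z, p 0 = z 0 ∧ J z = 𝒯.jump v (edge z p)) ∧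
      ∀ z, z 0 = X → ∀ r : ℝ,
        (∀ p ∈ 𝒯.neighbours z, p 0 ≠ z 0 → |p 1 - z 1| / dist z p ≤ r) →
        ∀ p ∈ 𝒯.neighbours z, p 0 = z 0 → |𝒯.jump v (edge z p) - J z| ≤ r * 𝒯.longJumps v z := by
  classical
  set P : Plane → Prop := fun z => z ∈ unitSquare ∧ z 0 = X ∧ ∃ p ∈ 𝒯.neighbours z, p 0 = z 0
    with hP
  refine ⟨fun z => if h : P z then 𝒯.jump v (edge z h.2.2.choose) else 0, fun z hz => ?_,
    fun z hz => ?_, fun z hz => ?_, fun z hz r hr p hp hp0 => ?_⟩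
  · exact dif_neg fun h => hz h.1
  · exact dif_neg fun h => hz h.2.1
  · by_cases h : P z
    · exact ⟨_, h.2.2.choose_spec.1, h.2.2.choose_spec.2, dif_pos h⟩
    · exact absurd (dif_neg h) hz
  · have z0 : 0 < z 0 := by rwa [hz]
    have z1 : z 0 < 1 := by rwa [hz]
    by_cases h : z ∈ unitSquare
    · have hPz : P z := ⟨h, hz, p, hp, hp0⟩
      simp only [dif_pos hPz]
      exact abs_jump_sub_jump_le hv z0 z1 hr hp hp0 hPz.2.2.choose_spec.1 hPz.2.2.choose_spec.2
    · have hPz : ¬ P z := fun h' => h h'.1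
      simp only [dif_neg hPz, sub_zero]
      exact abs_jump_le_of_notMem hv z0 z1 hr h hp hp0

/-! ### Sums over the elements, edges and nodes of a vertical line -/

variable (𝒯 X) in
open Classical in
/-- The elements touching a vertical line. -/
def lineElements : Finset (Finset Plane) := 𝒯.elements.filter fun t => ∃ z ∈ t, z 0 = X

variable (𝒯 X) in
open Classical in
/-- The nodes on a vertical line. -/
def lineNodes : Finset Plane := (𝒯.elements.biUnion id).filter fun z => z 0 = X

lemma mem_lineElements {t : Finset Plane} :
    t ∈ 𝒯.lineElements X ↔ t ∈ 𝒯.elements ∧ ∃ z ∈ t, z 0 = X := by simp [lineElements]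

lemma mem_lineNodes {z : Plane} :
    z ∈ 𝒯.lineNodes X ↔ (∃ t ∈ 𝒯.elements, z ∈ t) ∧ z 0 = X := by simp [lineNodes]

lemma mem_lineNodes_of_mem {z : Plane} {S : Finset Plane} (hS : S ∈ 𝒯.verticalEdges X)
    (hz : z ∈ S) : z ∈ 𝒯.lineNodes X := by
  obtain ⟨t, ht, a, b, ha, hb, hab, rfl, ha0, hb0⟩ := exists_of_mem_verticalEdges hS
  rcases mem_edge.1 hz with rfl | rfl
  · exact mem_lineNodes.2 ⟨⟨t, ht, ha⟩, ha0⟩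
  · exact mem_lineNodes.2 ⟨⟨t, ht, hb⟩, hb0⟩

open Classical in
lemma sum_lineNodes_verticalEdges (q : Finset Plane → ℝ) :
    ∑ z ∈ 𝒯.lineNodes X, ∑ S ∈ 𝒯.verticalEdges X with z ∈ S, q S =
      2 * ∑ S ∈ 𝒯.verticalEdges X, q S := by
  have h : ∑ z ∈ 𝒯.lineNodes X, ∑ S ∈ 𝒯.verticalEdges X with z ∈ S, q S =
      ∑ S ∈ 𝒯.verticalEdges X, ∑ _z ∈ S, q S := by
    refine Finset.sum_comm' fun z S => ?_
    simp only [Finset.mem_filter]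
    exact ⟨fun h => ⟨h.2.2, h.2.1⟩, fun h => ⟨mem_lineNodes_of_mem h.2 h.1, h.2, h.1⟩⟩
  rw [h, Finset.mul_sum]
  refine Finset.sum_congr rfl fun S hS => ?_
  obtain ⟨t, ht, a, b, ha, hb, hab, rfl, -⟩ := exists_of_mem_verticalEdges hS
  rw [sum_edge hab, two_mul]

open Classical in
lemma sum_lineNodes_elements_le {g : Finset Plane → ℝ} (hg : ∀ t, 0 ≤ g t) :
    ∑ z ∈ 𝒯.lineNodes X, ∑ t ∈ 𝒯.elements with z ∈ t, g t ≤ 3 * ∑ t ∈ 𝒯.lineElements X, g t := by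
  have h : ∑ z ∈ 𝒯.lineNodes X, ∑ t ∈ 𝒯.elements with z ∈ t, g t =
      ∑ t ∈ 𝒯.lineElements X, ∑ _z ∈ t with _z 0 = X, g t := by
    refine Finset.sum_comm' fun z t => ?_
    simp only [Finset.mem_filter, mem_lineNodes, mem_lineElements]
    exact ⟨fun h => ⟨⟨h.2.2, h.1.2⟩, h.2.1, z, h.2.2, h.1.2⟩,
      fun h => ⟨⟨⟨t, h.2.1, h.1.1⟩, h.1.2⟩, h.2.1, h.1.1⟩⟩
  rw [h, Finset.mul_sum]
  refine Finset.sum_le_sum fun t ht => ?_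
  rw [Finset.sum_const, nsmul_eq_mul]
  refine mul_le_mul_of_nonneg_right ?_ (hg t)
  exact_mod_cast (Finset.card_filter_le _ _).trans (𝒯.card_eq t (mem_lineElements.1 ht).1).le

end Triangulation

namespace IsStructuredMesh

open Triangulation

variable {α₀ : ℝ} {M : ℕ} {K c₀ : ℝ} {n : ℕ} {x : ℕ → ℝ} {𝒯 : Triangulation unitSquare}
  {t t' : Finset Plane} {z p q a b c : Plane} {X : ℝ} {i : ℕ}

open Classical in
lemma sum_lineElements_le (hm : IsStructuredMesh α₀ M K c₀ n x 𝒯) {g : Plane → ℝ}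
    (hg : ∀ z, 0 ≤ g z) :
    ∑ t ∈ 𝒯.lineElements X, ∑ z ∈ t with z 0 = X, g z ≤ M * ∑ z ∈ 𝒯.lineNodes X, g z := by
  have h : ∑ t ∈ 𝒯.lineElements X, ∑ z ∈ t with z 0 = X, g z =
      ∑ z ∈ 𝒯.lineNodes X, ∑ _t ∈ 𝒯.elements with z ∈ _t, g z := by
    refine Finset.sum_comm' fun t z => ?_
    simp only [Finset.mem_filter, mem_lineNodes, mem_lineElements]
    exact ⟨fun h => ⟨⟨h.1.1, h.2.1⟩, ⟨t, h.1.1, h.2.1⟩, h.2.2⟩,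
      fun h => ⟨⟨h.1.1, z, h.1.2, h.2.2⟩, h.1.2, h.2.2⟩⟩
  rw [h, Finset.mul_sum]
  refine Finset.sum_le_sum fun z hz => ?_
  obtain ⟨⟨t, ht, hzt⟩, -⟩ := mem_lineNodes.1 hz
  rw [Finset.sum_const, nsmul_eq_mul]
  exact mul_le_mul_of_nonneg_right (by exact_mod_cast hm.card_le ht hzt) (hg z)

lemma sum_verticalEdges_le (hm : IsStructuredMesh α₀ M K c₀ n x 𝒯) {g : Plane → ℝ}
    (hg : ∀ z, 0 ≤ g z) :
    ∑ S ∈ 𝒯.verticalEdges X, ∑ z ∈ S, g z ≤ 3 * M * ∑ z ∈ 𝒯.lineNodes X, g z := by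
  classical
  have h : ∑ S ∈ 𝒯.verticalEdges X, ∑ z ∈ S, g z =
      ∑ z ∈ 𝒯.lineNodes X, ∑ _S ∈ 𝒯.verticalEdges X with z ∈ _S, g z := by
    refine Finset.sum_comm' fun S z => ?_
    simp only [Finset.mem_filter]
    exact ⟨fun h => ⟨h, mem_lineNodes_of_mem h.1 h.2⟩, fun h => h.1⟩
  rw [h, Finset.mul_sum]
  refine Finset.sum_le_sum fun z hz => ?_
  obtain ⟨⟨t, ht, hzt⟩, -⟩ := mem_lineNodes.1 hz
  rw [Finset.sum_const, nsmul_eq_mul]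
  refine mul_le_mul_of_nonneg_right ?_ (hg z)
  have h1 : (𝒯.verticalEdges X).filter (fun S => z ∈ S) ⊆ (𝒯.neighbours z).image (edge z) := by
    intro S hS
    obtain ⟨hS, hzS⟩ := Finset.mem_filter.1 hS
    obtain ⟨t, ht, a, b, ha, hb, hab, rfl, -⟩ := exists_of_mem_verticalEdges hS
    rw [Finset.mem_image]
    rcases mem_edge.1 hzS with rfl | rfl
    · exact ⟨b, mem_neighbours.2 ⟨hab.symm, t, ht, ha, hb⟩, rfl⟩
    · exact ⟨a, mem_neighbours.2 ⟨hab, t, ht, hb, ha⟩, edge_comm _ _⟩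
  exact_mod_cast ((Finset.card_le_card h1).trans Finset.card_image_le).trans
    (hm.card_neighbours_le ht hzt)

/-! ### Geometry near a vertical grid line -/

lemma eq_of_ne_gridLine (hm : IsStructuredMesh α₀ M K c₀ n x 𝒯) (hi : 0 < i) (hin : i < n)
    (ht : t ∈ 𝒯.elements) (hp : p ∈ t) (hq : q ∈ t) (hp0 : p 0 = x i) (hq0 : q 0 ≠ x i) :
    q 0 = x (i + 1) ∨ q 0 = x (i - 1) := by
  obtain ⟨j, hj, hslab⟩ := hm.exists_slab ht
  rcases hslab p hp with h | h
  · obtain rfl := hm.grid_injOn hin.le hj.le (hp0.symm.trans h)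
    exact Or.inl ((hslab q hq).resolve_left hq0)
  · obtain rfl := hm.grid_injOn hin.le (by omega) (hp0.symm.trans h)
    exact Or.inr ((hslab q hq).resolve_right hq0)

lemma grid_mem_Ioo (hm : IsStructuredMesh α₀ M K c₀ n x 𝒯) (hi : 0 < i) (hin : i < n) :
    0 < x i ∧ x i < 1 := by
  have h1 := hm.grid_lt hi hin.le
  have h2 := hm.grid_lt hin le_rfl
  rw [hm.grid_zero] at h1
  rw [hm.grid_last] at h2
  exact ⟨h1, h2⟩

/-- A vertical edge on an inner grid line has an element on either side. -/
lemma exists_right_left (hm : IsStructuredMesh α₀ M K c₀ n x 𝒯) (hi : 0 < i) (hin : i < n)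
    (ht : t ∈ 𝒯.elements) (ha : a ∈ t) (hb : b ∈ t) (hab : a ≠ b) (ha0 : a 0 = x i)
    (hb0 : b 0 = x i) :
    (∃ t' ∈ 𝒯.elements, ∃ c, IsVert t' a b c ∧ c 0 = x (i + 1)) ∧
    (∃ t' ∈ 𝒯.elements, ∃ c, IsVert t' a b c ∧ c 0 = x (i - 1)) := by
  obtain ⟨h0, h1⟩ := hm.grid_mem_Ioo hi hin
  have hint : openSegment ℝ a b ⊆ unitSquare :=
    openSegment_subset_of_vertical (mem_neighbours.2 ⟨hab.symm, t, ht, ha, hb⟩)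
      (hb0.trans ha0.symm) (by rwa [ha0]) (by rwa [ha0])
  have key : ∀ s : ℝ, (s = 1 ∨ s = -1) → ∃ t' ∈ 𝒯.elements, ∃ c, IsVert t' a b c ∧
      (c 0 = x (i + 1) ∨ c 0 = x (i - 1)) ∧ 0 < s * (-(b 1 - a 1) * (c 0 - a 0)) := by
    intro s hs
    obtain ⟨t', ht', ha', hb', hs'⟩ := exists_side ht hab ha hb hint hs
    obtain ⟨c, h⟩ := 𝒯.exists_isTri_of_mem ht' ha' hb' hab
    have hv := hm.isVert ht' h (hb0.trans ha0.symm)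
    refine ⟨t', ht', c, hv, hm.eq_of_ne_gridLine hi hin ht' ha' h.rotate.rotate.left_mem ha0 ?_, ?_⟩
    · rw [← ha0]; exact hv.third_ne
    · have := h.side_mul_pos
      rw [hs', dblArea_eq, hb0, ha0] at this
      rw [ha0]
      convert this using 2; ring
  obtain ⟨t₁, ht₁, c₁, hv₁, hc₁, hs₁⟩ := key 1 (Or.inl rfl)
  obtain ⟨t₂, ht₂, c₂, hv₂, hc₂, hs₂⟩ := key (-1) (Or.inr rfl)
  -- Opposite sides of a vertical edge mean opposite signs of `c 0 - a 0`, so the third vertices lie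
  -- on the two different neighbouring grid lines.
  have hne : c₁ 0 ≠ c₂ 0 := by
    intro h
    rw [h] at hs₁
    linarith
  rcases hc₁ with h1 | h1 <;> rcases hc₂ with h2 | h2
  · exact absurd (h1.trans h2.symm) hne
  · exact ⟨⟨t₁, ht₁, c₁, hv₁, h1⟩, ⟨t₂, ht₂, c₂, hv₂, h2⟩⟩
  · exact ⟨⟨t₂, ht₂, c₂, hv₂, h2⟩, ⟨t₁, ht₁, c₁, hv₁, h1⟩⟩
  · exact absurd (h1.trans h2.symm) hne

/-- The widths of the elements at an inner grid line are comparable. -/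
lemma width_comparable (hm : IsStructuredMesh α₀ M K c₀ n x 𝒯) (hi : 0 < i) (hin : i < n)
    (hE : (𝒯.verticalEdges (x i)).Nonempty) (ht : t ∈ 𝒯.elements) (hp : p ∈ t) (hq : q ∈ t)
    (hp0 : p 0 = x i) (hq0 : q 0 ≠ p 0) :
    x (i + 1) - x i ≤ K * |q 0 - p 0| ∧ |q 0 - p 0| ≤ K * (x (i + 1) - x i) := by
  obtain ⟨S, hS⟩ := hE
  have hK := hm.one_le ht
  obtain ⟨t₀, ht₀, a, b, ha, hb, hab, -, ha0, hb0⟩ := exists_of_mem_verticalEdges hS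
  obtain ⟨⟨t₁, ht₁, c₁, h₁, hc₁⟩, ⟨t₂, ht₂, c₂, h₂, hc₂⟩⟩ :=
    hm.exists_right_left hi hin ht₀ ha hb hab ha0 hb0
  have w₁ : 0 < x (i + 1) - x i := sub_pos.2 (hm.grid_lt (by omega) (by omega))
  have w₂ : 0 < x i - x (i - 1) := sub_pos.2 (hm.grid_lt (by omega) (by omega))
  -- Two elements on either side of one vertical edge have areas in the ratio of their slab widths,
  -- and the areas at a common node are comparable.
  have e1 := hm.area_le ht₁ ht₂ h₁.tri.left_mem h₂.tri.left_mem
  have e2 := hm.area_le ht₂ ht₁ h₂.tri.left_mem h₁.tri.left_mem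
  rw [h₁.area_eq, h₂.area_eq, hc₁, hc₂, ha0, abs_of_pos w₁, abs_sub_comm, abs_of_pos w₂] at e1 e2
  have hd := h₁.dist_pos
  have e1' : x i - x (i - 1) ≤ K * (x (i + 1) - x i) :=
    le_of_mul_le_mul_left (by linarith) hd
  have e2' : x (i + 1) - x i ≤ K * (x i - x (i - 1)) :=
    le_of_mul_le_mul_left (by linarith) hd
  rw [hp0] at hq0 ⊢
  rcases hm.eq_of_ne_gridLine hi hin ht hp hq hp0 hq0 with h | h
  · rw [h, abs_of_pos w₁]
    constructor <;> nlinarith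
  · rw [h, abs_sub_comm, abs_of_pos w₂]
    exact ⟨e2', e1'⟩

/-- The patch has height at most `K² |ab| / 2`, while a non-vertical edge at the node spans a
horizontal distance of at least `w / K`. The bound by `1` is trivial, and needed when the slab is
narrower than the edge. -/
lemma slope_le (hm : IsStructuredMesh α₀ M K c₀ n x 𝒯) (hi : 0 < i) (hin : i < n)
    (hE : (𝒯.verticalEdges (x i)).Nonempty) (ht : t ∈ 𝒯.elements) (h : IsVert t a b c)
    (hz : z ∈ t) (hz0 : z 0 = x i) (hp : p ∈ 𝒯.neighbours z) (hp0 : p 0 ≠ z 0) :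
    |p 1 - z 1| / dist z p ≤ min 1 (K ^ 3 * dist a b / (2 * (x (i + 1) - x i))) := by
  obtain ⟨hne, t', ht', hz', hp'⟩ := mem_neighbours.1 hp
  have hd : 0 < dist z p := dist_pos.2 hne.symm
  have w₁ : 0 < x (i + 1) - x i := sub_pos.2 (hm.grid_lt (by omega) (by omega))
  have hK := hm.one_le ht
  refine le_min ?_ ?_
  · rw [div_le_one hd]; exact abs_sub_snd_le_dist z p
  · have h1 := hm.abs_sub_snd_le ht h hz ht' hz' hp'
    have h2 := (hm.width_comparable hi hin hE ht' hz' hp' hz0 hp0).1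
    have h3 := abs_sub_fst_le_dist z p
    rw [div_le_div_iff₀ hd (by positivity)]
    calc |p 1 - z 1| * (2 * (x (i + 1) - x i))
        ≤ (K ^ 2 * dist a b / 2) * (2 * (K * dist z p)) := by
          refine mul_le_mul h1 ?_ (by positivity) (by positivity)
          have : K * |p 0 - z 0| ≤ K * dist z p := mul_le_mul_of_nonneg_left h3 (by linarith)
          linarith
      _ = _ := by ring

/-- The long edge is at most `K w + K² |ab| / 2`. The first summand is multiplied by the bound of
order `|ab| / w`, the second by the bound `1`. -/
lemma dist_mul_slope_le (hm : IsStructuredMesh α₀ M K c₀ n x 𝒯) (hi : 0 < i) (hin : i < n)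
    (hE : (𝒯.verticalEdges (x i)).Nonempty) (ht : t ∈ 𝒯.elements) (h : IsVert t a b c)
    (ha0 : a 0 = x i) :
    dist a c * min 1 (K ^ 3 * dist a b / (2 * (x (i + 1) - x i))) ≤ K ^ 4 * dist a b := by
  have hK := hm.one_le ht
  have hd := h.dist_pos
  have w₁ : 0 < x (i + 1) - x i := sub_pos.2 (hm.grid_lt (by omega) (by omega))
  have hc := h.tri.rotate.rotate.left_mem
  have h1 := hm.abs_sub_snd_le ht h h.tri.left_mem ht h.tri.left_mem hc
  have h2 := (hm.width_comparable hi hin hE ht h.tri.left_mem hc ha0 h.third_ne).2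
  have h3 := dist_le_abs_add_abs a c
  set r := min 1 (K ^ 3 * dist a b / (2 * (x (i + 1) - x i))) with hr
  have r0 : 0 ≤ r := le_min zero_le_one (by positivity)
  have r1 : r ≤ 1 := min_le_left _ _
  have r2 : r ≤ K ^ 3 * dist a b / (2 * (x (i + 1) - x i)) := min_le_right _ _
  have hK2 : K ^ 2 ≤ K ^ 4 := pow_le_pow_right₀ hK (by norm_num)
  calc dist a c * r ≤ (K * (x (i + 1) - x i) + K ^ 2 * dist a b / 2) * r :=
        mul_le_mul_of_nonneg_right (by linarith) r0
    _ = K * (x (i + 1) - x i) * r + K ^ 2 * dist a b / 2 * r := by ring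
    _ ≤ K * (x (i + 1) - x i) * (K ^ 3 * dist a b / (2 * (x (i + 1) - x i))) +
        K ^ 2 * dist a b / 2 * 1 := by gcongr
    _ = K ^ 4 * dist a b / 2 + K ^ 2 * dist a b / 2 := by field_simp
    _ ≤ _ := by nlinarith

end IsStructuredMesh

/-! ### The jump form on a vertical line -/

namespace Triangulation

variable (𝒯 : Triangulation unitSquare) (X : ℝ)

open Classical in
/-- The contribution of an element to the jump terms on a vertical line, tested with `J`. -/
def lineForm (v J : Plane → ℝ) (t : Finset Plane) : ℝ :=
  ∑ S ∈ 𝒯.verticalEdges X with S ⊆ t, (∑ z ∈ S, J z) * (Metric.diam (S : Set Plane) / 2) *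
    ⟪gradient v (bary t), outwardNormal t S⟫

variable {𝒯 X} {v J : Plane → ℝ} {t : Finset Plane} {a b c : Plane}

/-- On the line the test function is the linear interpolant of `J`, whose integral over an edge `S`
is half its length times the sum of the two nodal values. Collecting the outward normal derivatives
by edges produces the jumps. -/
lemma sum_lineForm (v J : Plane → ℝ) : ∑ t ∈ 𝒯.lineElements X, 𝒯.lineForm X v J t =
    ∑ S ∈ 𝒯.verticalEdges X, (∑ z ∈ S, J z) * (Metric.diam (S : Set Plane) / 2) * 𝒯.jump v S := by
  classical
  simp only [jump, Finset.mul_sum, lineForm]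
  refine Finset.sum_comm' fun t S => ?_
  simp only [Finset.mem_filter, mem_lineElements]
  constructor
  · rintro ⟨⟨ht, -⟩, hS, hSt⟩
    exact ⟨⟨ht, hSt⟩, hS⟩
  · rintro ⟨⟨ht, hSt⟩, hS⟩
    obtain ⟨-, -, a, b, -, -, -, rfl, ha0, -⟩ := exists_of_mem_verticalEdges hS
    exact ⟨⟨ht, a, hSt (mem_edge.2 (Or.inl rfl)), ha0⟩, hS, hSt⟩

lemma lineForm_eq_zero (h : ∀ a b, a ∈ t → b ∈ t → a 0 = X → b 0 = X → a = b) :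
    𝒯.lineForm X v J t = 0 := by
  classical
  refine Finset.sum_eq_zero fun S hS => ?_
  obtain ⟨hS, hSt⟩ := Finset.mem_filter.1 hS
  obtain ⟨-, -, a, b, -, -, hab, rfl, ha0, hb0⟩ := exists_of_mem_verticalEdges hS
  obtain ⟨ha, hb⟩ := edge_subset.1 hSt
  exact absurd (h a b ha hb ha0 hb0) hab

lemma lineForm_eq (ht : t ∈ 𝒯.elements) (h : IsTri t a b c) (ha : a 0 = X) (hb : b 0 = X) :
    𝒯.lineForm X v J t =
      - area (hull t) * (J a + J b) * dcoord c a b (gradient v (bary t)) := by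
  classical
  have hc := third_ne h ha hb
  have e : (𝒯.verticalEdges X).filter (fun S => S ⊆ t) = {edge a b} := by
    ext S
    rw [Finset.mem_filter, Finset.mem_singleton]
    constructor
    · rintro ⟨hS, hSt⟩
      obtain ⟨-, -, p, q, -, -, hpq, rfl, hp0, hq0⟩ := exists_of_mem_verticalEdges hS
      obtain ⟨hp, hq⟩ := edge_subset.1 hSt
      rcases h.mem_iff.1 hp with rfl | rfl | rfl <;> rcases h.mem_iff.1 hq with rfl | rfl | rfl <;>
        first
        | exact absurd rfl hpq
        | exact absurd hp0 hc
        | exact absurd hq0 hc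
        | rfl
        | exact edge_comm _ _
    · rintro rfl
      exact ⟨edge_mem_verticalEdges ht h.left_mem h.rotate.left_mem h.left_ne ha hb,
        edge_subset.2 ⟨h.left_mem, h.rotate.left_mem⟩⟩
  rw [lineForm, e, Finset.sum_singleton, sum_edge h.left_ne, diam_edge,
    h.dcoord_eq_inner (coe_edge a b)]
  have := h.area_pos
  field_simp

end Triangulation

/-! ### The line test function in the residual equation -/

namespace IsStructuredMesh

open Triangulation

variable {α₀ : ℝ} {M : ℕ} {K c₀ : ℝ} {n : ℕ} {x : ℕ → ℝ} {𝒯 : Triangulation unitSquare}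
  {t t' : Finset Plane} {z p q a b c : Plane} {i : ℕ}

lemma inv_width_le (hm : IsStructuredMesh α₀ M K c₀ n x 𝒯) (hi : 0 < i) (hin : i < n)
    (hE : (𝒯.verticalEdges (x i)).Nonempty) (ht : t ∈ 𝒯.elements) (hp : p ∈ t) (hq : q ∈ t)
    (hp0 : p 0 = x i) (hq0 : q 0 ≠ p 0) : |q 0 - p 0|⁻¹ ≤ K / (x (i + 1) - x i) := by
  have w₁ : 0 < x (i + 1) - x i := sub_pos.2 (hm.grid_lt (by omega) (by omega))
  have h := (hm.width_comparable hi hin hE ht hp hq hp0 hq0).1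
  have h0 : 0 < |q 0 - p 0| := abs_pos.2 (sub_ne_zero.2 hq0)
  rw [le_div_iff₀ w₁, inv_mul_le_iff₀ h0]
  linarith

/-- The weights of the nodes in the bound for the gradient of the line test function. -/
def lineWeight (𝒯 : Triangulation unitSquare) (K : ℝ) (v J : Plane → ℝ) (z : Plane) : ℝ :=
  |J z| + K ^ 4 * 𝒯.longJumps v z

/-- The gradient of the third coordinate is of order `1/w`. That of the other coordinate is larger
by the factor `|ac| / |ab|`, but is multiplied by `J b - J a`, which is at most the slope times
long-edge jumps; `dist_mul_slope_le` removes the factor at the cost of `K⁴`. -/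
lemma line_gradient_le (hm : IsStructuredMesh α₀ M K c₀ n x 𝒯) (hi : 0 < i)
    (hin : i < n) (hE : (𝒯.verticalEdges (x i)).Nonempty) {v J : Plane → ℝ}
    (hJd : ∀ z, z 0 = x i → ∀ r : ℝ,
        (∀ p ∈ 𝒯.neighbours z, p 0 ≠ z 0 → |p 1 - z 1| / dist z p ≤ r) →
        ∀ p ∈ 𝒯.neighbours z, p 0 = z 0 → |𝒯.jump v (edge z p) - J z| ≤ r * 𝒯.longJumps v z)
    (ht : t ∈ 𝒯.elements) (hv : IsVert t a b c) (ha : a 0 = x i) (hb : b 0 = x i) :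
    15 * (|J a| + |J b|) * ‖dcoord c a b‖ + 3 * |J b - J a| * ‖dcoord b c a‖ ≤
      15 * ((lineWeight 𝒯 K v J a + lineWeight 𝒯 K v J b) * |c 0 - a 0|⁻¹) := by
  have w₁ : 0 < x (i + 1) - x i := sub_pos.2 (hm.grid_lt (by omega) (by omega))
  have hK := hm.one_le ht
  have hd := hv.dist_pos
  have hw := hv.width_pos
  set r := min 1 (K ^ 3 * dist a b / (2 * (x (i + 1) - x i))) with hr
  have r0 : 0 ≤ r := le_min zero_le_one (by positivity)
  have hna : b ∈ 𝒯.neighbours a :=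
    mem_neighbours.2 ⟨hv.tri.left_ne.symm, t, ht, hv.tri.left_mem, hv.tri.rotate.left_mem⟩
  have d1 := hJd a ha r (fun p hp hp0 =>
    hm.slope_le hi hin hE ht hv hv.tri.left_mem ha hp hp0) b hna (hb.trans ha.symm)
  have d2 := hJd b hb r (fun p hp hp0 =>
    hm.slope_le hi hin hE ht hv hv.tri.rotate.left_mem hb hp hp0) a (neighbours_symm hna)
    (ha.trans hb.symm)
  rw [edge_comm b a] at d2
  have d3 : |J b - J a| ≤ r * (𝒯.longJumps v a + 𝒯.longJumps v b) := by
    have := abs_sub_le (J b) (𝒯.jump v (edge a b)) (J a)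
    rw [abs_sub_comm (J b) (𝒯.jump v (edge a b))] at this
    linarith
  have h1 := hv.norm_dcoord_third
  have h3 := hv.norm_dcoord_mid
  have h4 := hm.dist_mul_slope_le hi hin hE ht hv ha
  have la := 𝒯.longJumps_nonneg v a
  have lb := 𝒯.longJumps_nonneg v b
  have h6 : |J b - J a| * ‖dcoord b c a‖ ≤
      K ^ 4 * (𝒯.longJumps v a + 𝒯.longJumps v b) * |c 0 - a 0|⁻¹ := by
    calc _ ≤ r * (𝒯.longJumps v a + 𝒯.longJumps v b) *
          (dist a c / (dist a b * |c 0 - a 0|)) :=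
          mul_le_mul d3 h3 (norm_nonneg _) (mul_nonneg r0 (add_nonneg la lb))
      _ = (dist a c * r) * ((𝒯.longJumps v a + 𝒯.longJumps v b) /
          (dist a b * |c 0 - a 0|)) := by ring
      _ ≤ (K ^ 4 * dist a b) * ((𝒯.longJumps v a + 𝒯.longJumps v b) /
          (dist a b * |c 0 - a 0|)) :=
          mul_le_mul_of_nonneg_right h4 (div_nonneg (add_nonneg la lb) (mul_pos hd hw).le)
      _ = _ := by field_simp
  have h7 : (|J a| + |J b|) * ‖dcoord c a b‖ ≤ (|J a| + |J b|) * |c 0 - a 0|⁻¹ :=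
    mul_le_mul_of_nonneg_left h1 (by positivity)
  have h8 : 0 ≤ K ^ 4 * (𝒯.longJumps v a + 𝒯.longJumps v b) * |c 0 - a 0|⁻¹ := by positivity
  have e : (lineWeight 𝒯 K v J a + lineWeight 𝒯 K v J b) * |c 0 - a 0|⁻¹ =
      (|J a| + |J b|) * |c 0 - a 0|⁻¹ +
      K ^ 4 * (𝒯.longJumps v a + 𝒯.longJumps v b) * |c 0 - a 0|⁻¹ := by
    rw [lineWeight, lineWeight]; ring
  rw [e, mul_assoc 15, mul_assoc 3]
  linarith

open Classical in
lemma isTest_lineTest_structured (hm : IsStructuredMesh α₀ M K c₀ n x 𝒯) (hi : 0 < i)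
    (hin : i < n) (hE : (𝒯.verticalEdges (x i)).Nonempty) {v J : Plane → ℝ}
    (hJ : ∀ z ∉ unitSquare, J z = 0) (hJX : ∀ z, z 0 ≠ x i → J z = 0)
    (hJd : ∀ z, z 0 = x i → ∀ r : ℝ,
        (∀ p ∈ 𝒯.neighbours z, p 0 ≠ z 0 → |p 1 - z 1| / dist z p ≤ r) →
        ∀ p ∈ 𝒯.neighbours z, p 0 = z 0 → |𝒯.jump v (edge z p) - J z| ≤ r * 𝒯.longJumps v z) :
    IsTest 𝒯 (𝒯.lineTest (x i) J) (fun t => gradient v (bary t))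
      (fun t => 15 * K / (x (i + 1) - x i) * ∑ z ∈ t with z 0 = x i, lineWeight 𝒯 K v J z)
      (𝒯.lineForm (x i) v J) := by
  have w₁ : 0 < x (i + 1) - x i := sub_pos.2 (hm.grid_lt (by omega) (by omega))
  have hK : 1 ≤ K := by
    obtain ⟨S, hS⟩ := hE
    obtain ⟨t, ht, -⟩ := exists_of_mem_verticalEdges hS
    exact hm.one_le ht
  have hA : ∀ z, 0 ≤ lineWeight 𝒯 K v J z := fun z => by
    have := 𝒯.longJumps_nonneg v z
    rw [lineWeight]; positivity
  have hJA : ∀ z, |J z| ≤ lineWeight 𝒯 K v J z := fun z => by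
    have := 𝒯.longJumps_nonneg v z
    rw [lineWeight]
    have : 0 ≤ K ^ 4 * 𝒯.longJumps v z := by positivity
    linarith
  refine isTest_lineTest hJ hJX (fun t ht h0 => ⟨?_, ?_⟩) (fun t ht a b c h ha hb hc => ⟨?_, ?_⟩)
    (fun t ht a b c h ha hb => ⟨?_, lineForm_eq ht h ha hb⟩)
  · exact mul_nonneg (by positivity) (Finset.sum_nonneg fun z _ => hA z)
  · exact lineForm_eq_zero fun a b ha hb ha0 hb0 => absurd ha0 (h0 a ha)
  · have hbc : c 0 = b 0 := by
      obtain ⟨j, hj, hslab⟩ := hm.exists_slab ht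
      rcases hslab a h.left_mem with e | e
      · have hne : ∀ q ∈ t, q 0 ≠ x i → q 0 = x (j + 1) := fun q hq h' =>
          (hslab q hq).resolve_left fun e' => h' (by rw [e', ← e, ha])
        rw [hne b h.rotate.left_mem hb, hne c h.rotate.rotate.left_mem hc]
      · have hne : ∀ q ∈ t, q 0 ≠ x i → q 0 = x j := fun q hq h' =>
          (hslab q hq).resolve_right fun e' => h' (by rw [e', ← e, ha])
        rw [hne b h.rotate.left_mem hb, hne c h.rotate.rotate.left_mem hc]
    have hv := hm.isVert ht h.rotate hbc
    have h1 := hv.norm_dcoord_third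
    rw [abs_sub_comm] at h1
    have h2 := hm.inv_width_le hi hin hE ht h.left_mem h.rotate.left_mem ha (by rwa [ha])
    have h3 : lineWeight 𝒯 K v J a ≤ ∑ z ∈ t with z 0 = x i, lineWeight 𝒯 K v J z :=
      Finset.single_le_sum (f := lineWeight 𝒯 K v J) (fun z _ => hA z)
        (Finset.mem_filter.2 ⟨h.left_mem, ha⟩)
    have h4 : 0 ≤ K / (x (i + 1) - x i) := by positivity
    calc 9 * |J a| * ‖dcoord a b c‖ ≤
          15 * (∑ z ∈ t with z 0 = x i, lineWeight 𝒯 K v J z) * (K / (x (i + 1) - x i)) := by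
          refine mul_le_mul ?_ (h1.trans h2) (norm_nonneg _) ?_
          · have := hJA a; have := abs_nonneg (J a); linarith
          · have := hA a; linarith
      _ = _ := by ring
  · refine lineForm_eq_zero fun p q hp hq hp0 hq0 => ?_
    have key : ∀ p ∈ t, p 0 = x i → p = a := fun p hp hp0 => by
      rcases h.mem_iff.1 hp with rfl | rfl | rfl
      · rfl
      · exact absurd hp0 hb
      · exact absurd hp0 hc
    rw [key p hp hp0, key q hq hq0]
  · have hv := hm.isVert ht h (hb.trans ha.symm)
    have h1 := hm.line_gradient_le hi hin hE hJd ht hv ha hb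
    have h2 := hm.inv_width_le hi hin hE ht h.left_mem h.rotate.rotate.left_mem ha hv.third_ne
    have h5 : lineWeight 𝒯 K v J a + lineWeight 𝒯 K v J b ≤
        ∑ z ∈ t with z 0 = x i, lineWeight 𝒯 K v J z := by
      rw [← sum_edge h.left_ne]
      refine Finset.sum_le_sum_of_subset_of_nonneg (fun z hz => ?_) fun z _ _ => hA z
      rcases mem_edge.1 hz with rfl | rfl
      · exact Finset.mem_filter.2 ⟨h.left_mem, ha⟩
      · exact Finset.mem_filter.2 ⟨h.rotate.left_mem, hb⟩
    calc _ ≤ 15 * ((lineWeight 𝒯 K v J a + lineWeight 𝒯 K v J b) * |c 0 - a 0|⁻¹) := h1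
      _ ≤ 15 * ((∑ z ∈ t with z 0 = x i, lineWeight 𝒯 K v J z) * (K / (x (i + 1) - x i))) := by
          have := hA a; have := hA b
          refine mul_le_mul_of_nonneg_left (mul_le_mul h5 h2 (by positivity) (by linarith))
            (by norm_num)
      _ = _ := by ring

open Classical in
/-- The line test function in the residual equation. -/
lemma line_residual_le (hm : IsStructuredMesh α₀ M K c₀ n x 𝒯) (hi : 0 < i)
    (hin : i < n) (hE : (𝒯.verticalEdges (x i)).Nonempty) {f u v J : Plane → ℝ}
    {gu : Plane → Plane} (hf : IsData f) (hu : IsWeakSolution unitSquare f u gu)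
    (hJ : ∀ z ∉ unitSquare, J z = 0) (hJX : ∀ z, z 0 ≠ x i → J z = 0)
    (hJd : ∀ z, z 0 = x i → ∀ r : ℝ,
        (∀ p ∈ 𝒯.neighbours z, p 0 ≠ z 0 → |p 1 - z 1| / dist z p ≤ r) →
        ∀ p ∈ 𝒯.neighbours z, p 0 = z 0 → |𝒯.jump v (edge z p) - J z| ≤ r * 𝒯.longJumps v z) :
    (x (i + 1) - x i) * |∑ S ∈ 𝒯.verticalEdges (x i),
      (∑ z ∈ S, J z) * (Metric.diam (S : Set Plane) / 2) * 𝒯.jump v S| ≤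
    18 * K * ∑ t ∈ 𝒯.lineElements (x i), (∑ z ∈ t with z 0 = x i, lineWeight 𝒯 K v J z) *
      (Real.sqrt (area (hull t)) * Real.sqrt (etaSq f v gu t)) := by
  have w₁ : 0 < x (i + 1) - x i := sub_pos.2 (hm.grid_lt (by omega) (by omega))
  have htest := hm.isTest_lineTest_structured hi hin hE hJ hJX hJd
  have hK : 1 ≤ K := by
    obtain ⟨S, hS⟩ := hE
    obtain ⟨t, ht, -⟩ := exists_of_mem_verticalEdges hS
    exact hm.one_le ht
  have hA : ∀ z, 0 ≤ lineWeight 𝒯 K v J z := fun z => by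
    have := 𝒯.longJumps_nonneg v z
    rw [lineWeight]; positivity
  have hJA : ∀ z, |J z| ≤ lineWeight 𝒯 K v J z := fun z => by
    have := 𝒯.longJumps_nonneg v z
    rw [lineWeight]
    have : 0 ≤ K ^ 4 * 𝒯.longJumps v z := by positivity
    linarith
  have hres := htest.residual_le_of_subset (U := 𝒯.lineElements (x i))
    (fun t ht => (mem_lineElements.1 ht).1) (fun t ht hn => by
      have hn' : ∀ z ∈ t, z 0 ≠ x i := fun z hz hz0 => hn (mem_lineElements.2 ⟨ht, z, hz, hz0⟩)
      refine ⟨fun p hp => lineTest_eq_zero hJX ht hn' hp,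
        lineForm_eq_zero fun a b ha hb ha0 hb0 => absurd ha0 (hn' a ha), ?_⟩
      rw [Finset.filter_false_of_mem hn', Finset.sum_empty, mul_zero]) hf hu
  set w := x (i + 1) - x i with hw
  set B := fun t : Finset Plane => ∑ z ∈ t with z 0 = x i, lineWeight 𝒯 K v J z with hB
  have hB0 : ∀ t, 0 ≤ B t := fun t => Finset.sum_nonneg fun z _ => hA z
  rw [Finset.sum_sub_distrib, sum_lineForm] at hres
  set Q := ∑ S ∈ 𝒯.verticalEdges (x i),
      (∑ z ∈ S, J z) * (Metric.diam (S : Set Plane) / 2) * 𝒯.jump v S with hQ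
  have hfv : ∀ t ∈ 𝒯.lineElements (x i), |∫ p in hull t, f p * 𝒯.lineTest (x i) J p| ≤
      3 * K / w * B t * (Real.sqrt (area (hull t)) * Real.sqrt (etaSq f v gu t)) := by
    intro t ht
    obtain ⟨ht, z, hz, hz0⟩ := mem_lineElements.1 ht
    -- The vanishing mean of the test function eliminates `f` itself; only the oscillation is left.
    have h1 := hf.abs_integral_sub_le ht (subset_hull t hz) (continuousOn_lineTest hJX ht)
      (fun p hp => abs_lineTest_le hJX ht hp)
    rw [integral_lineTest hJX ht, mul_zero, sub_zero] at h1
    have h2 : ∑ z ∈ t, |J z| ≤ B t := by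
      simp only [hB]
      rw [← Finset.sum_filter_of_ne (p := fun z : Plane => z 0 = x i)]
      · exact Finset.sum_le_sum fun z _ => hJA z
      · intro z _ h
        by_contra hcon
        exact h (by rw [hJX z hcon, abs_zero])
    have h3 := bigH_mul_osc_le_eta f v gu t
    have h4 := hf.osc_nonneg ht
    obtain ⟨a, b, c, hv, -⟩ := hm.exists_isVert ht
    -- The width is at most of order `H_T`, so the oscillation weighted with `H_T` pays for the
    -- factor `1/w` wanted here.
    have hWH : w ≤ K * bigH t := by
      have hq : ∃ q ∈ t, q 0 ≠ z 0 := by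
        by_contra hcon
        push Not at hcon
        exact hv.third_ne ((hcon c hv.tri.rotate.rotate.left_mem).trans
          (hcon a hv.tri.left_mem).symm)
      obtain ⟨q, hqt, hq0⟩ := hq
      have h5 := (hm.width_comparable hi hin hE ht hz hqt hz0 hq0).1
      have h6 : |q 0 - z 0| ≤ bigH t := (abs_sub_fst_le_dist z q).trans
        (Metric.dist_le_diam_of_mem (isCompact_hull t).isBounded (subset_hull t hz)
          (subset_hull t hqt))
      exact h5.trans (mul_le_mul_of_nonneg_left h6 (by linarith))
    have hs : Real.sqrt (area (hull t)) * Real.sqrt (area (hull t)) = area (hull t) :=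
      Real.mul_self_sqrt measureReal_nonneg
    have h7 : osc f (hull t) * area (hull t) ≤
        K / w * (Real.sqrt (area (hull t)) * Real.sqrt (etaSq f v gu t)) := by
      rw [div_mul_eq_mul_div, le_div_iff₀ w₁]
      calc _ = osc f (hull t) * area (hull t) * w := rfl
        _ ≤ osc f (hull t) * area (hull t) * (K * bigH t) :=
          mul_le_mul_of_nonneg_left hWH (mul_nonneg h4 measureReal_nonneg)
        _ = osc f (hull t) * (Real.sqrt (area (hull t)) * Real.sqrt (area (hull t))) *
            (K * bigH t) := by rw [hs]
        _ = K * (Real.sqrt (area (hull t)) *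
            (bigH t * osc f (hull t) * Real.sqrt (area (hull t)))) := by ring
        _ ≤ _ := by gcongr
    calc _ ≤ osc f (hull t) * (3 * ∑ z ∈ t, |J z|) * area (hull t) := h1
      _ = 3 * (∑ z ∈ t, |J z|) * (osc f (hull t) * area (hull t)) := by ring
      _ ≤ 3 * B t * (K / w * (Real.sqrt (area (hull t)) * Real.sqrt (etaSq f v gu t))) := by
        refine mul_le_mul (by linarith) h7 (mul_nonneg h4 measureReal_nonneg) ?_
        have := hB0 t; linarith
      _ = _ := by ring
  -- The gradient term contributes 15 and the oscillation term 3 to the constant 18.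
  have h1 : |Q| ≤ ∑ t ∈ 𝒯.lineElements (x i), 18 * K / w * (B t *
      (Real.sqrt (area (hull t)) * Real.sqrt (etaSq f v gu t))) := by
    have h2 := (Finset.abs_sum_le_sum_abs (fun t => ∫ p in hull t, f p * 𝒯.lineTest (x i) J p)
      (𝒯.lineElements (x i))).trans (Finset.sum_le_sum hfv)
    have h3 := abs_sub_abs_le_abs_sub Q
      (∑ t ∈ 𝒯.lineElements (x i), ∫ p in hull t, f p * 𝒯.lineTest (x i) J p)
    rw [abs_sub_comm] at h3
    have h4 : |Q| ≤ (∑ t ∈ 𝒯.lineElements (x i), 3 * K / w * B t *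
        (Real.sqrt (area (hull t)) * Real.sqrt (etaSq f v gu t))) +
        ∑ t ∈ 𝒯.lineElements (x i), 15 * K / w * B t *
        (Real.sqrt (area (hull t)) * Real.sqrt (etaSq f v gu t)) := by linarith
    refine h4.trans_eq ?_
    rw [← Finset.sum_add_distrib]
    refine Finset.sum_congr rfl fun t _ => ?_
    ring
  calc w * |Q| ≤ w * ∑ t ∈ 𝒯.lineElements (x i), 18 * K / w * (B t *
      (Real.sqrt (area (hull t)) * Real.sqrt (etaSq f v gu t))) :=
        mul_le_mul_of_nonneg_left h1 w₁.le
    _ = _ := by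
      rw [← Finset.mul_sum, ← mul_assoc, mul_div_cancel₀ _ w₁.ne']

end IsStructuredMesh

/-! ### The estimate on one grid line -/

namespace IsStructuredMesh

open Triangulation

variable {α₀ : ℝ} {M : ℕ} {K c₀ : ℝ} {n : ℕ} {x : ℕ → ℝ} {𝒯 : Triangulation unitSquare}
  {t t' : Finset Plane} {z p q a b c : Plane} {i : ℕ}

lemma one_le_valence (hm : IsStructuredMesh α₀ M K c₀ n x 𝒯) (ht : t ∈ 𝒯.elements) :
    (1 : ℝ) ≤ M := by
  classical
  obtain ⟨a, b, c, h⟩ := 𝒯.exists_isTri ht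
  have h1 := hm.card_le ht h.left_mem
  have h2 : 0 < (𝒯.elements.filter fun t => a ∈ t).card :=
    Finset.card_pos.2 ⟨t, Finset.mem_filter.2 ⟨ht, h.left_mem⟩⟩
  exact_mod_cast h2.trans_le h1

lemma sum_nodeEta_sq_le (hm : IsStructuredMesh α₀ M K c₀ n x 𝒯) (X : ℝ) (f v : Plane → ℝ)
    (gu : Plane → Plane) : ∑ z ∈ 𝒯.lineNodes X, 𝒯.nodeEta f v gu z ^ 2 ≤
      3 * M * ∑ t ∈ 𝒯.lineElements X, etaSq f v gu t := by
  classical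
  have h1 : ∑ z ∈ 𝒯.lineNodes X, 𝒯.nodeEta f v gu z ^ 2 ≤
      ∑ z ∈ 𝒯.lineNodes X, M * ∑ t ∈ 𝒯.elements with z ∈ t, etaSq f v gu t := by
    refine Finset.sum_le_sum fun z hz => ?_
    obtain ⟨⟨t, ht, hzt⟩, -⟩ := mem_lineNodes.1 hz
    exact hm.sq_sum_sqrt_eta_le ht hzt subset_rfl
  rw [← Finset.mul_sum] at h1
  have h2 := 𝒯.sum_lineNodes_elements_le (X := X) (fun t => etaSq_nonneg f v gu t)
  calc _ ≤ _ := h1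
    _ ≤ M * (3 * ∑ t ∈ 𝒯.lineElements X, etaSq f v gu t) :=
      mul_le_mul_of_nonneg_left h2 (Nat.cast_nonneg M)
    _ = _ := by ring

/-- The area of the element to the right of a vertical edge. -/
lemma exists_area_eq (hm : IsStructuredMesh α₀ M K c₀ n x 𝒯) (hi : 0 < i) (hin : i < n)
    (hp : p ∈ 𝒯.neighbours z) (hz0 : z 0 = x i) (hp0 : p 0 = x i) :
    ∃ t ∈ 𝒯.elements, z ∈ t ∧ p ∈ t ∧
      area (hull t) = (x (i + 1) - x i) * dist z p / 2 := by
  obtain ⟨hne, t, ht, hz, hpt⟩ := mem_neighbours.1 hp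
  obtain ⟨⟨t', ht', c, h, hc⟩, -⟩ := hm.exists_right_left hi hin ht hz hpt hne.symm hz0 hp0
  refine ⟨t', ht', h.tri.left_mem, h.tri.rotate.left_mem, ?_⟩
  rw [h.area_eq, hc, hz0, abs_of_pos (sub_pos.2 (hm.grid_lt (by omega) (by omega)))]
  ring

-- A nonzero `J z` is the jump across a vertical edge `S` at `z`. The element to the right of `S`
-- has area `w |S| / 2`, comparable to that of `t`.
open Classical in
lemma lineJump_mul_sqrt_area_le (hm : IsStructuredMesh α₀ M K c₀ n x 𝒯) (hi : 0 < i) (hin : i < n)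
    {v J : Plane → ℝ}
    (hJe : ∀ z, J z ≠ 0 → ∃ p ∈ 𝒯.neighbours z, p 0 = z 0 ∧ J z = 𝒯.jump v (edge z p))
    (ht : t ∈ 𝒯.elements) (hz : z ∈ t) (hz0 : z 0 = x i) :
    |J z| * Real.sqrt (area (hull t)) ≤ K * Real.sqrt (∑ S ∈ 𝒯.verticalEdges (x i) with z ∈ S,
      (x (i + 1) - x i) * Metric.diam (S : Set Plane) * 𝒯.jump v S ^ 2) := by
  have w₁ : 0 < x (i + 1) - x i := sub_pos.2 (hm.grid_lt (by omega) (by omega))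
  have hK := hm.one_le ht
  by_cases hJ : J z = 0
  · rw [hJ, abs_zero, zero_mul]
    positivity
  obtain ⟨p, hp, hp0, hJp⟩ := hJe z hJ
  obtain ⟨t', ht', hz', hp', harea⟩ := hm.exists_area_eq hi hin hp hz0 (hp0.trans hz0)
  have h1 := hm.sqrt_area_le ht' ht hz' hz
  have hS : edge z p ∈ (𝒯.verticalEdges (x i)).filter fun S => z ∈ S :=
    Finset.mem_filter.2 ⟨edge_mem_verticalEdges ht' hz' hp' (mem_neighbours.1 hp).1.symm hz0
      (hp0.trans hz0), mem_edge.2 (Or.inl rfl)⟩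
  have h2 := Finset.single_le_sum (f := fun S : Finset Plane =>
    (x (i + 1) - x i) * Metric.diam (S : Set Plane) * 𝒯.jump v S ^ 2)
    (fun S _ => mul_nonneg (mul_nonneg w₁.le Metric.diam_nonneg) (sq_nonneg _)) hS
  simp only [diam_edge] at h2
  have h3 : |J z| * Real.sqrt (area (hull t')) ≤
      Real.sqrt (∑ S ∈ 𝒯.verticalEdges (x i) with z ∈ S,
      (x (i + 1) - x i) * Metric.diam (S : Set Plane) * 𝒯.jump v S ^ 2) := by
    refine Real.le_sqrt_of_sq_le (le_trans ?_ h2)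
    have h0 : 0 ≤ area (hull t') := measureReal_nonneg
    rw [mul_pow, sq_abs, Real.sq_sqrt h0, hJp, harea]
    have : 0 ≤ 𝒯.jump v (edge z p) ^ 2 * ((x (i + 1) - x i) * dist z p / 2) := by positivity
    linarith
  calc _ ≤ |J z| * (K * Real.sqrt (area (hull t'))) := mul_le_mul_of_nonneg_left h1 (abs_nonneg _)
    _ = K * (|J z| * Real.sqrt (area (hull t'))) := by ring
    _ ≤ _ := mul_le_mul_of_nonneg_left h3 (by linarith)

/-- The contribution of a vertical edge, up to the jumps across long edges. -/
lemma vertical_jump_sq_le (hm : IsStructuredMesh α₀ M K c₀ n x 𝒯) (hi : 0 < i) (hin : i < n)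
    {f u v J : Plane → ℝ} {gu : Plane → Plane} (hf : IsData f)
    (hu : IsWeakSolution unitSquare f u gu)
    (hJd : ∀ z, z 0 = x i → ∀ r : ℝ,
        (∀ p ∈ 𝒯.neighbours z, p 0 ≠ z 0 → |p 1 - z 1| / dist z p ≤ r) →
        ∀ p ∈ 𝒯.neighbours z, p 0 = z 0 → |𝒯.jump v (edge z p) - J z| ≤ r * 𝒯.longJumps v z)
    {S : Finset Plane} (hS : S ∈ 𝒯.verticalEdges (x i)) :
    (x (i + 1) - x i) * Metric.diam (S : Set Plane) * 𝒯.jump v S ^ 2 ≤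
      2 * ((x (i + 1) - x i) * ((∑ z ∈ S, J z) * (Metric.diam (S : Set Plane) / 2) *
        𝒯.jump v S)) + (5472 * K * M) ^ 2 * ∑ z ∈ S, 𝒯.nodeEta f v gu z ^ 2 := by
  have w₁ : 0 < x (i + 1) - x i := sub_pos.2 (hm.grid_lt (by omega) (by omega))
  obtain ⟨t₀, ht₀, a, b, ha, hb, hab, rfl, ha0, hb0⟩ := exists_of_mem_verticalEdges hS
  have hna : b ∈ 𝒯.neighbours a := mem_neighbours.2 ⟨hab.symm, t₀, ht₀, ha, hb⟩
  obtain ⟨t, ht, hat, hbt, harea⟩ := hm.exists_area_eq hi hin hna ha0 hb0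
  have hsl : ∀ z, ∀ p ∈ 𝒯.neighbours z, p 0 ≠ z 0 → |p 1 - z 1| / dist z p ≤ 1 :=
    fun z p hp _ => div_le_one_of_le₀ (abs_sub_snd_le_dist z p) dist_nonneg
  have d1 := hJd a ha0 1 (hsl a) b hna (hb0.trans ha0.symm)
  have d2 := hJd b hb0 1 (hsl b) a (neighbours_symm hna) (ha0.trans hb0.symm)
  rw [edge_comm b a] at d2
  rw [one_mul] at d1 d2
  have hsq : ∀ z ∈ t, (x (i + 1) - x i) * dist a b * 𝒯.longJumps v z ^ 2 ≤
      2 * ((5472 * K * M) ^ 2 * 𝒯.nodeEta f v gu z ^ 2) := by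
    intro z hz
    have h0 : 0 ≤ area (hull t) := measureReal_nonneg
    have h1 := pow_le_pow_left₀ (mul_nonneg (𝒯.longJumps_nonneg v z) (Real.sqrt_nonneg _))
      (hm.longJumps_le (uh := v) hf hu ht hz) 2
    rw [mul_pow, Real.sq_sqrt h0, harea, mul_pow (5472 * K * M)] at h1
    linarith
  have h1 := hsq a hat
  have h2 := hsq b hbt
  rw [sum_edge hab, sum_edge hab, diam_edge]
  set j := 𝒯.jump v (edge a b)
  set la := 𝒯.longJumps v a
  set lb := 𝒯.longJumps v b
  set W := (x (i + 1) - x i) * dist a b with hW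
  have hW0 : 0 ≤ W := by positivity
  -- Since `|j - J a| ≤ la` and `|j - J b| ≤ lb`, expand `(2j - (J a + J b))² ≤ (la + lb)² ≤ 2(la² +
  -- lb²)`. The form tested with `J` thus controls the squared jumps.
  have key : j ^ 2 ≤ (J a + J b) * j + (la ^ 2 + lb ^ 2) / 2 := by
    have h3 : |2 * j - (J a + J b)| ≤ la + lb := by
      have e : 2 * j - (J a + J b) = (j - J a) + (j - J b) := by ring
      rw [e]
      exact (abs_add_le _ _).trans (add_le_add d1 d2)
    have h4 := pow_le_pow_left₀ (abs_nonneg _) h3 2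
    rw [sq_abs] at h4
    nlinarith [sq_nonneg (la - lb), sq_nonneg (J a + J b)]
  have h5 := mul_le_mul_of_nonneg_left key hW0
  have h6 : 2 * ((x (i + 1) - x i) * ((J a + J b) * (dist a b / 2) * j)) =
      W * ((J a + J b) * j) := by rw [hW]; ring
  rw [h6]
  linarith

-- Young's inequality separates nodal jumps from local errors. The denominator `144 * K * M` is
-- chosen for the later absorption, where summation over the elements and nodes of the line costs `2
-- * M` and the residual inequality `36 * K`.
open Classical in
lemma lineWeight_sum_le (hm : IsStructuredMesh α₀ M K c₀ n x 𝒯) (hi : 0 < i) (hin : i < n)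
    {f u v J : Plane → ℝ} {gu : Plane → Plane} (hf : IsData f)
    (hu : IsWeakSolution unitSquare f u gu)
    (hJe : ∀ z, J z ≠ 0 → ∃ p ∈ 𝒯.neighbours z, p 0 = z 0 ∧ J z = 𝒯.jump v (edge z p))
    (ht : t ∈ 𝒯.elements) :
    (∑ z ∈ t with z 0 = x i, lineWeight 𝒯 K v J z) *
      (Real.sqrt (area (hull t)) * Real.sqrt (etaSq f v gu t)) ≤
    (∑ z ∈ t with z 0 = x i, ((∑ S ∈ 𝒯.verticalEdges (x i) with z ∈ S,
      (x (i + 1) - x i) * Metric.diam (S : Set Plane) * 𝒯.jump v S ^ 2) / (144 * K * M) +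
      5472 * K ^ 5 * M * 𝒯.nodeEta f v gu z ^ 2)) +
    3 * (36 * K ^ 3 * M + 5472 * K ^ 5 * M) * etaSq f v gu t := by
  have hK := hm.one_le ht
  have hM := hm.one_le_valence ht
  have w₁ : 0 < x (i + 1) - x i := sub_pos.2 (hm.grid_lt (by omega) (by omega))
  set e := Real.sqrt (etaSq f v gu t) with he
  have he2 : e ^ 2 = etaSq f v gu t := Real.sq_sqrt (etaSq_nonneg f v gu t)
  have he0 : 0 ≤ e := Real.sqrt_nonneg _
  rw [← he2]
  set C := 36 * K ^ 3 * M + 5472 * K ^ 5 * M with hC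
  have hC0 : 0 ≤ C := by positivity
  have hcard : (((t.filter fun z => z 0 = x i).card : ℕ) : ℝ) ≤ 3 := by
    exact_mod_cast (Finset.card_filter_le _ _).trans (𝒯.card_eq t ht).le
  have hterm : ∀ z ∈ t.filter (fun z => z 0 = x i),
      lineWeight 𝒯 K v J z * (Real.sqrt (area (hull t)) * e) ≤
      ((∑ S ∈ 𝒯.verticalEdges (x i) with z ∈ S,
      (x (i + 1) - x i) * Metric.diam (S : Set Plane) * 𝒯.jump v S ^ 2) / (144 * K * M) +
      5472 * K ^ 5 * M * 𝒯.nodeEta f v gu z ^ 2) + C * e ^ 2 := by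
    intro z hz
    obtain ⟨hz, hz0⟩ := Finset.mem_filter.1 hz
    have h1 := hm.lineJump_mul_sqrt_area_le hi hin hJe ht hz hz0
    have h2 := hm.longJumps_le (uh := v) hf hu ht hz
    set Q := ∑ S ∈ 𝒯.verticalEdges (x i) with z ∈ S,
      (x (i + 1) - x i) * Metric.diam (S : Set Plane) * 𝒯.jump v S ^ 2 with hQ
    have hQ0 : 0 ≤ Q := Finset.sum_nonneg fun S _ =>
      mul_nonneg (mul_nonneg w₁.le Metric.diam_nonneg) (sq_nonneg _)
    have hQ2 : Real.sqrt Q ^ 2 = Q := Real.sq_sqrt hQ0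
    set y := Real.sqrt Q
    set s := Real.sqrt (area (hull t))
    set R := 𝒯.nodeEta f v gu z
    -- Completing the square, with the jump term given the prescribed small weight.
    have h3 : K * y * e ≤ Q / (144 * K * M) + 36 * K ^ 3 * M * e ^ 2 := by
      rw [← sub_nonneg]
      have : Q / (144 * K * M) + 36 * K ^ 3 * M * e ^ 2 - K * y * e =
          (y - 72 * K ^ 2 * M * e) ^ 2 / (144 * K * M) := by
        rw [← hQ2]
        field_simp
        ring
      rw [this]
      positivity
    have h4 : R * e ≤ R ^ 2 + e ^ 2 := by nlinarith [sq_nonneg (R - e), sq_nonneg R, sq_nonneg e]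
    have h5 : 0 ≤ 5472 * K ^ 5 * M := by positivity
    have h6 := mul_le_mul_of_nonneg_left h4 h5
    calc lineWeight 𝒯 K v J z * (s * e) = (|J z| * s) * e + K ^ 4 * (𝒯.longJumps v z * s) * e := by
          rw [lineWeight]; ring
      _ ≤ (K * y) * e + K ^ 4 * (5472 * K * M * R) * e := by gcongr
      _ = K * y * e + 5472 * K ^ 5 * M * (R * e) := by ring
      _ ≤ _ := by rw [hC]; linarith
  rw [Finset.sum_mul]
  refine (Finset.sum_le_sum hterm).trans ?_
  rw [Finset.sum_add_distrib, Finset.sum_const, nsmul_eq_mul, mul_assoc 3]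
  have := mul_le_mul_of_nonneg_right hcard (mul_nonneg hC0 (sq_nonneg e))
  linarith

/-- The constant in the estimate for the vertical edges. -/
def lineConst (K : ℝ) (M : ℕ) : ℝ :=
  36 * K * (16416 * K ^ 5 * M ^ 3 + 3 * (36 * K ^ 3 * M + 5472 * K ^ 5 * M)) +
    9 * M ^ 2 * (5472 * K * M) ^ 2

/-- The estimator on the vertical edges of an inner grid line. -/
theorem line_estimate (hm : IsStructuredMesh α₀ M K c₀ n x 𝒯) (hi : 0 < i) (hin : i < n)
    {f u v : Plane → ℝ} {gu : Plane → Plane} (hf : IsData f)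
    (hu : IsWeakSolution unitSquare f u gu) (hv : 𝒯.IsFEFunction v) :
    ∑ S ∈ 𝒯.verticalEdges (x i), area (𝒯.edgePatch S) * 𝒯.jump v S ^ 2 ≤
      K * lineConst K M * ∑ t ∈ 𝒯.lineElements (x i), etaSq f v gu t := by
  classical
  rcases (𝒯.verticalEdges (x i)).eq_empty_or_nonempty with hE | hE
  · rw [hE, Finset.sum_empty]
    by_cases hT : (𝒯.lineElements (x i)).Nonempty
    · obtain ⟨t, ht⟩ := hT
      have hK := hm.one_le (mem_lineElements.1 ht).1
      refine mul_nonneg ?_ (Finset.sum_nonneg fun t _ => etaSq_nonneg f v gu t)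
      rw [lineConst]; positivity
    · rw [Finset.not_nonempty_iff_eq_empty.1 hT, Finset.sum_empty, mul_zero]
  have w₁ : 0 < x (i + 1) - x i := sub_pos.2 (hm.grid_lt (by omega) (by omega))
  obtain ⟨h0, h1⟩ := hm.grid_mem_Ioo hi hin
  obtain ⟨J, hJ, hJX, hJe, hJd⟩ := exists_lineJump hv h0 h1
  obtain ⟨t₀, ht₀⟩ : ∃ t, t ∈ 𝒯.elements := by
    obtain ⟨S, hS⟩ := hE
    obtain ⟨t, ht, -⟩ := exists_of_mem_verticalEdges hS
    exact ⟨t, ht⟩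
  have hK := hm.one_le ht₀
  have hM := hm.one_le_valence ht₀
  set w := x (i + 1) - x i with hw
  set N := ∑ t ∈ 𝒯.lineElements (x i), etaSq f v gu t with hN
  set q : Finset Plane → ℝ := fun S => w * Metric.diam (S : Set Plane) * 𝒯.jump v S ^ 2 with hq
  have hq0 : ∀ S, 0 ≤ q S := fun S =>
    mul_nonneg (mul_nonneg w₁.le Metric.diam_nonneg) (sq_nonneg _)
  have hres := hm.line_residual_le (v := v) hi hin hE hf hu hJ hJX hJd
  set P := ∑ t ∈ 𝒯.lineElements (x i), (∑ z ∈ t with z 0 = x i, lineWeight 𝒯 K v J z) *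
      (Real.sqrt (area (hull t)) * Real.sqrt (etaSq f v gu t)) with hP
  have hR := hm.sum_nodeEta_sq_le (x i) f v gu
  rw [← hN] at hR
  have hP' : P ≤ 1 / (72 * K) * ∑ S ∈ 𝒯.verticalEdges (x i), q S +
      (16416 * K ^ 5 * M ^ 3 + 3 * (36 * K ^ 3 * M + 5472 * K ^ 5 * M)) * N := by
    have e1 : P ≤ (∑ t ∈ 𝒯.lineElements (x i), ∑ z ∈ t with z 0 = x i,
        ((∑ S ∈ 𝒯.verticalEdges (x i) with z ∈ S, q S) / (144 * K * M) +
        5472 * K ^ 5 * M * 𝒯.nodeEta f v gu z ^ 2)) +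
        3 * (36 * K ^ 3 * M + 5472 * K ^ 5 * M) * N := by
      rw [hN, Finset.mul_sum, ← Finset.sum_add_distrib]
      exact Finset.sum_le_sum fun t ht =>
        hm.lineWeight_sum_le hi hin hf hu hJe (mem_lineElements.1 ht).1
    have e2 := hm.sum_lineElements_le (X := x i) (g := fun z =>
        (∑ S ∈ 𝒯.verticalEdges (x i) with z ∈ S, q S) / (144 * K * M) +
        5472 * K ^ 5 * M * 𝒯.nodeEta f v gu z ^ 2) (fun z => by
          have : 0 ≤ ∑ S ∈ 𝒯.verticalEdges (x i) with z ∈ S, q S :=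
            Finset.sum_nonneg fun S _ => hq0 S
          positivity)
    rw [Finset.sum_add_distrib, ← Finset.sum_div, sum_lineNodes_verticalEdges,
      ← Finset.mul_sum] at e2
    have e3 : (M : ℝ) * (5472 * K ^ 5 * M * ∑ z ∈ 𝒯.lineNodes (x i), 𝒯.nodeEta f v gu z ^ 2) ≤
        M * (5472 * K ^ 5 * M * (3 * M * N)) := by gcongr
    -- The `2` counts the ends of a vertical edge.
    have e4 : (M : ℝ) * (2 * (∑ S ∈ 𝒯.verticalEdges (x i), q S) / (144 * K * M)) =
        1 / (72 * K) * ∑ S ∈ 𝒯.verticalEdges (x i), q S := by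
      field_simp
      ring
    rw [mul_add, e4] at e2
    calc P ≤ _ := e1
      _ ≤ _ := add_le_add_left (e2.trans (add_le_add_right e3 _)) _
      _ = _ := by ring
  have hQ : ∑ S ∈ 𝒯.verticalEdges (x i), q S ≤ 36 * K * P + 9 * M ^ 2 * (5472 * K * M) ^ 2 * N := by
    have e1 := Finset.sum_le_sum fun S hS =>
      hm.vertical_jump_sq_le (J := J) (v := v) (S := S) hi hin hf hu hJd hS
    rw [Finset.sum_add_distrib, ← Finset.mul_sum, ← Finset.mul_sum, ← Finset.mul_sum] at e1
    have e2 := hm.sum_verticalEdges_le (X := x i) (g := fun z => 𝒯.nodeEta f v gu z ^ 2)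
      (fun z => sq_nonneg _)
    have e3 : ∑ S ∈ 𝒯.verticalEdges (x i), ∑ z ∈ S, 𝒯.nodeEta f v gu z ^ 2 ≤
        3 * M * (3 * M * N) := e2.trans (mul_le_mul_of_nonneg_left hR (by positivity))
    have e4 := mul_le_mul_of_nonneg_left e3 (sq_nonneg (5472 * K * M))
    have e5 := (mul_le_mul_of_nonneg_left (le_abs_self (∑ S ∈ 𝒯.verticalEdges (x i),
      (∑ z ∈ S, J z) * (Metric.diam (S : Set Plane) / 2) * 𝒯.jump v S)) w₁.le).trans hres
    calc _ ≤ _ := e1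
      _ ≤ 2 * (18 * K * P) + (5472 * K * M) ^ 2 * (3 * M * (3 * M * N)) := by linarith
      _ = _ := by ring
  -- Absorption: `36 * K` times `1 / (72 * K)` leaves half of the sum on the right, which is moved
  -- to the left.
  have hQ' : ∑ S ∈ 𝒯.verticalEdges (x i), q S ≤ 2 * lineConst K M * N := by
    have e1 := mul_le_mul_of_nonneg_left hP' (by linarith : 0 ≤ 36 * K)
    have e2 : 36 * K * (1 / (72 * K) * ∑ S ∈ 𝒯.verticalEdges (x i), q S) =
        1 / 2 * ∑ S ∈ 𝒯.verticalEdges (x i), q S := by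
      field_simp
      ring
    rw [mul_add, e2] at e1
    rw [lineConst]
    linarith
  have hpatch : ∀ S ∈ 𝒯.verticalEdges (x i),
      area (𝒯.edgePatch S) * 𝒯.jump v S ^ 2 ≤ K / 2 * q S := by
    intro S hS
    obtain ⟨t, ht, a, b, ha, hb, hab, rfl, ha0, hb0⟩ := exists_of_mem_verticalEdges hS
    obtain ⟨t', ht', ha', hb', harea⟩ := hm.exists_area_eq hi hin
      (mem_neighbours.2 ⟨hab.symm, t, ht, ha, hb⟩) ha0 hb0
    have e1 := (𝒯.area_edgePatch_le (mem_edge.2 (Or.inl rfl) : a ∈ edge a b)).trans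
      (hm.comparable a ⟨t', ht', ha'⟩ t' ht' ha')
    rw [harea] at e1
    have e2 := mul_le_mul_of_nonneg_right e1 (sq_nonneg (𝒯.jump v (edge a b)))
    simp only [hq, diam_edge]
    linarith
  calc _ ≤ ∑ S ∈ 𝒯.verticalEdges (x i), K / 2 * q S := Finset.sum_le_sum hpatch
    _ = K / 2 * ∑ S ∈ 𝒯.verticalEdges (x i), q S := by rw [Finset.mul_sum]
    _ ≤ K / 2 * (2 * lineConst K M * N) := mul_le_mul_of_nonneg_left hQ' (by linarith)
    _ = _ := by ring

end IsStructuredMesh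

/-! ### From local estimates to an open set -/

lemma openSegment_subset_hull_edge {a b : Plane} (hab : a ≠ b) :
    openSegment ℝ a b ⊆ hull (edge a b) \ (edge a b : Set Plane) := by
  intro p hp
  refine ⟨?_, fun h => ?_⟩
  · rw [hull, coe_edge, convexHull_pair]
    exact openSegment_subset_segment ℝ a b hp
  · rw [coe_edge] at h
    rcases h with rfl | h
    · exact hab (left_mem_openSegment_iff.1 hp)
    · rw [Set.mem_singleton_iff.1 h] at hp
      exact hab (right_mem_openSegment_iff.1 hp)

lemma midpoint_mem_openSegment (a b : Plane) : (2 : ℝ)⁻¹ • a + (2 : ℝ)⁻¹ • b ∈ openSegment ℝ a b :=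
  ⟨2⁻¹, 2⁻¹, by norm_num, by norm_num, by norm_num, rfl⟩

namespace Triangulation

variable {𝒯 : Triangulation unitSquare}

lemma gradient_ae_eq {v : Plane → ℝ} (hv : 𝒯.IsPiecewiseLinear v) {t : Finset Plane}
    (ht : t ∈ 𝒯.elements) (gu : Plane → Plane) :
    (fun p => ‖gradient v p - gu p‖ ^ 2) =ᵐ[volume.restrict (hull t)]
      fun p => ‖gradient v (bary t) - gu p‖ ^ 2 := by
  rw [← Measure.restrict_congr_set (interior_hull_ae_eq t)]
  filter_upwards [ae_restrict_mem isOpen_interior.measurableSet] with p hp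
  rw [hv.gradient_eq ht hp]

lemma integrableOn_error {v : Plane → ℝ} (hv : 𝒯.IsPiecewiseLinear v) {gu : Plane → Plane}
    (hgu : MemLp gu 2 (volume.restrict unitSquare)) :
    IntegrableOn (fun p => ‖gradient v p - gu p‖ ^ 2) unitSquare := by
  refine IntegrableOn.mono_set_ae ?_ 𝒯.unitSquare_ae_eq.symm.le
  rw [integrableOn_finset_iUnion]
  intro t ht
  refine Integrable.congr ?_ (gradient_ae_eq hv ht gu).symm
  have : IsFiniteMeasure (volume.restrict (hull t)) :=
    ⟨by simpa using (isCompact_hull t).measure_lt_top⟩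
  exact ((memLp_const (gradient v (bary t))).sub
    (hgu.mono_measure (𝒯.restrict_hull_le ht))).integrable_norm_pow two_ne_zero

/-- The local errors of the elements in `D` are bounded by the error on `D`. -/
lemma sum_etaSq_le {f v : Plane → ℝ} {gu : Plane → Plane} (hv : 𝒯.IsPiecewiseLinear v)
    (hgu : MemLp gu 2 (volume.restrict unitSquare)) {D : Set Plane} (hDΩ : D ⊆ unitSquare)
    {U : Finset (Finset Plane)} (hU : U ⊆ 𝒯.elements) (hD : ∀ t ∈ U, interior (hull t) ⊆ D) :
    ∑ t ∈ U, etaSq f v gu t ≤ 𝒯.errorOsc f v gu D ^ 2 := by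
  have h1 := 𝒯.sum_setIntegral_hull_le hU hD (fun p => sq_nonneg ‖gradient v p - gu p‖)
    ((integrableOn_error hv hgu).mono_set hDΩ)
  have h2 : ∀ t ∈ U, area (hull t ∩ D) = area (hull t) := fun t ht => by
    refine measureReal_congr ?_
    filter_upwards [hull_ae_le (hD t ht)] with p hp
    exact propext ⟨fun h => h.1, fun h => ⟨h, hp h⟩⟩
  have h3 : ∑ t ∈ U, bigH t ^ 2 * osc f (hull t) ^ 2 * area (hull t) ≤
      ∑ t ∈ 𝒯.elements, bigH t ^ 2 * osc f (hull t) ^ 2 * area (hull t ∩ D) := by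
    have h : ∑ t ∈ U, bigH t ^ 2 * osc f (hull t) ^ 2 * area (hull t) =
        ∑ t ∈ U, bigH t ^ 2 * osc f (hull t) ^ 2 * area (hull t ∩ D) :=
      Finset.sum_congr rfl fun t ht => by rw [h2 t ht]
    rw [h]
    exact Finset.sum_le_sum_of_subset_of_nonneg hU fun t _ _ =>
      mul_nonneg (by positivity) measureReal_nonneg
  have h4 : ∑ t ∈ U, ∫ p in hull t, ‖gradient v p - gu p‖ ^ 2 =
      ∑ t ∈ U, ∫ p in hull t, ‖gradient v (bary t) - gu p‖ ^ 2 :=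
    Finset.sum_congr rfl fun t ht => integral_congr_ae (gradient_ae_eq hv (hU ht) gu)
  rw [h4] at h1
  simp only [etaSq]
  rw [Finset.sum_add_distrib, errorOsc]
  set A := ∫ p in D, ‖gradient v p - gu p‖ ^ 2
  set B := ∑ t ∈ 𝒯.elements, bigH t ^ 2 * osc f (hull t) ^ 2 * area (hull t ∩ D)
  have hA : 0 ≤ A := integral_nonneg fun p => by positivity
  have hB : 0 ≤ B := Finset.sum_nonneg fun t _ =>
      mul_nonneg (by positivity) measureReal_nonneg
  rw [add_sq, Real.sq_sqrt hA, Real.sq_sqrt hB]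
  have : 0 ≤ 2 * Real.sqrt A * Real.sqrt B := by positivity
  linarith

lemma element_terms_le {f u v fI : Plane → ℝ} {gu : Plane → Plane} (hf : IsData f)
    (hu : IsWeakSolution unitSquare f u gu) (hfI : 𝒯.IsLagrangeInterpolant f fI)
    {D : Set Plane} {U : Finset (Finset Plane)} (hU : U ⊆ 𝒯.elements)
    (hD : ∀ t ∈ 𝒯.elements, t ∉ U → hull t ∩ D = ∅) :
    ∑ t ∈ 𝒯.elements, smallH t ^ 2 * ∫ p in hull t ∩ D, fI p ^ 2 ≤
      302 ^ 2 * ∑ t ∈ U, etaSq f v gu t := by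
  rw [← Finset.sum_subset hU fun t ht htU => by
    rw [hD t ht htU, setIntegral_empty, mul_zero], Finset.mul_sum]
  refine Finset.sum_le_sum fun t ht => ?_
  refine le_trans ?_ (𝒯.element_residual_estimate (uh := v) hf hu hfI (hU ht))
  refine mul_le_mul_of_nonneg_left ?_ (sq_nonneg _)
  refine setIntegral_mono_set ?_ (Eventually.of_forall fun p => sq_nonneg _)
    Set.inter_subset_left.eventuallyLE
  exact ((hfI.1.1.mono (𝒯.hull_subset (hU ht))).pow 2).integrableOn_compact (isCompact_hull t)

end Triangulation

namespace IsStructuredMesh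

open Triangulation

variable {α₀ : ℝ} {M : ℕ} {K c₀ : ℝ} {n : ℕ} {x : ℕ → ℝ} {𝒯 : Triangulation unitSquare}
  {t : Finset Plane} {z p q a b c : Plane} {i : ℕ}

/-- Each element touches at most three grid lines. -/
lemma sum_lines_le (hm : IsStructuredMesh α₀ M K c₀ n x 𝒯) {I : Finset ℕ} (hI : ∀ i ∈ I, i ≤ n)
    {U : Finset (Finset Plane)} (hU : U ⊆ 𝒯.elements)
    (hIU : ∀ i ∈ I, 𝒯.lineElements (x i) ⊆ U) {g : Finset Plane → ℝ} (hg : ∀ t, 0 ≤ g t) :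
    ∑ i ∈ I, ∑ t ∈ 𝒯.lineElements (x i), g t ≤ 3 * ∑ t ∈ U, g t := by
  classical
  have h : ∑ i ∈ I, ∑ t ∈ 𝒯.lineElements (x i), g t =
      ∑ t ∈ U, ∑ _i ∈ I with t ∈ 𝒯.lineElements (x _i), g t := by
    refine Finset.sum_comm' fun i t => ?_
    simp only [Finset.mem_filter]
    exact ⟨fun h => ⟨h, hIU i h.1 h.2⟩, fun h => h.1⟩
  rw [h, Finset.mul_sum]
  refine Finset.sum_le_sum fun t ht => ?_
  rw [Finset.sum_const, nsmul_eq_mul]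
  refine mul_le_mul_of_nonneg_right ?_ (hg t)
  -- Distinct grid lines touching `t` have distinct abscissae, each of them that of a vertex of `t`;
  -- hence the count of three.
  have hinj : Set.InjOn x (I.filter fun i => t ∈ 𝒯.lineElements (x i) : Finset ℕ) :=
    fun i hi j hj hij => hm.grid_injOn (hI i (Finset.mem_filter.1 hi).1)
      (hI j (Finset.mem_filter.1 hj).1) hij
  have hsub : (I.filter fun i => t ∈ 𝒯.lineElements (x i)).image x ⊆ t.image fun z => z 0 := by
    intro y hy
    obtain ⟨i, hi, rfl⟩ := Finset.mem_image.1 hy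
    obtain ⟨-, z, hz, hz0⟩ := mem_lineElements.1 (Finset.mem_filter.1 hi).2
    exact Finset.mem_image.2 ⟨z, hz, hz0⟩
  have := (Finset.card_le_card hsub).trans Finset.card_image_le
  rw [Finset.card_image_of_injOn hinj, 𝒯.card_eq t (hU ht)] at this
  exact_mod_cast this

open Classical in
/-- Each element has three edges. -/
lemma sum_edges_le {E U : Finset (Finset Plane)} (hU : U ⊆ 𝒯.elements) (hE : E ⊆ 𝒯.edges)
    (hEU : ∀ S ∈ E, ∀ t ∈ 𝒯.elements, S ⊆ t → t ∈ U)
    {g : Finset Plane → ℝ} (hg : ∀ t, 0 ≤ g t) :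
    ∑ S ∈ E, ∑ t ∈ 𝒯.elements with S ⊆ t, g t ≤ 3 * ∑ t ∈ U, g t := by
  have h : ∑ S ∈ E, ∑ t ∈ 𝒯.elements with S ⊆ t, g t = ∑ t ∈ U, ∑ _S ∈ E with _S ⊆ t, g t := by
    refine Finset.sum_comm' fun S t => ?_
    simp only [Finset.mem_filter]
    exact ⟨fun h => ⟨⟨h.1, h.2.2⟩, hEU S h.1 t h.2.1 h.2.2⟩, fun h => ⟨h.1.1, hU h.2, h.1.2⟩⟩
  rw [h, Finset.mul_sum]
  refine Finset.sum_le_sum fun t ht => ?_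
  rw [Finset.sum_const, nsmul_eq_mul]
  refine mul_le_mul_of_nonneg_right ?_ (hg t)
  have hsub : E.filter (fun S => S ⊆ t) ⊆ t.powersetCard 2 := fun S hS => by
    obtain ⟨hS, hSt⟩ := Finset.mem_filter.1 hS
    obtain ⟨t', ht', hSt'⟩ := Finset.mem_biUnion.1 (hE hS)
    exact Finset.mem_powersetCard.2 ⟨hSt, (Finset.mem_powersetCard.1 hSt').2⟩
  have := Finset.card_le_card hsub
  rw [Finset.card_powersetCard, 𝒯.card_eq t (hU ht)] at this
  exact_mod_cast this

/-- The square of the constant in the main theorem. -/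
def mainConst (K : ℝ) (M : ℕ) : ℝ :=
  3 * (1824 ^ 2 * K ^ 3 * M) + 3 * (K * lineConst K M) + 302 ^ 2

/-- The estimate on an open set `D` that is a union of slabs between grid lines, where `I` is the
set of the indices of the grid lines inside `D`. -/
theorem estimator_le (hm : IsStructuredMesh α₀ M K c₀ n x 𝒯) {f u v fI : Plane → ℝ}
    {gu : Plane → Plane} (hf : IsData f) (hu : IsWeakSolution unitSquare f u gu)
    (hv : 𝒯.IsFEFunction v) (hfI : 𝒯.IsLagrangeInterpolant f fI) {D : Set Plane}
    (hDΩ : D ⊆ unitSquare) {I : Finset ℕ} (hI : ∀ i ∈ I, 0 < i ∧ i < n)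
    (hD : ∀ t ∈ 𝒯.elements, interior (hull t) ⊆ D ∨ hull t ∩ D = ∅)
    (hID : ∀ i ∈ I, ∀ t ∈ 𝒯.lineElements (x i), interior (hull t) ⊆ D)
    (hDI : ∀ t ∈ 𝒯.elements, ∀ a ∈ t, ∀ b ∈ t, b 0 = a 0 → openSegment ℝ a b ⊆ D →
      ∃ i ∈ I, a 0 = x i) :
    𝒯.estimator v fI D ≤ (|mainConst K M| + 1) * 𝒯.errorOsc f v gu D := by
  classical
  have hE0 : 0 ≤ 𝒯.errorOsc f v gu D := add_nonneg (Real.sqrt_nonneg _) (Real.sqrt_nonneg _)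
  set U := 𝒯.elements.filter fun t => interior (hull t) ⊆ D with hU
  have hUel : U ⊆ 𝒯.elements := Finset.filter_subset _ _
  have hη : ∀ t, 0 ≤ etaSq f v gu t := etaSq_nonneg f v gu
  obtain ⟨t₀, ht₀⟩ : ∃ t, t ∈ 𝒯.elements := by
    have h : squareCenter ∈ closure unitSquare := subset_closure (by
      simp only [unitSquare, squareCenter, Set.mem_ofPred_eq]; norm_num)
    obtain ⟨t, ht, -⟩ := 𝒯.exists_mem_hull h
    exact ⟨t, ht⟩
  have hK := hm.one_le ht₀
  set q : Finset Plane → ℝ := fun S => area (𝒯.edgePatch S) * 𝒯.jump v S ^ 2 with hq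
  have hq0 : ∀ S, 0 ≤ q S := fun S => mul_nonneg measureReal_nonneg (sq_nonneg _)
  -- The edges are split into vertical ones, handled line by line, and long ones, handled one at a
  -- time.
  set V := (𝒯.edgesIn D).filter fun S => ∃ X : ℝ, ∀ z ∈ S, z 0 = X with hV
  set L := (𝒯.edgesIn D).filter fun S => ¬ ∃ X : ℝ, ∀ z ∈ S, z 0 = X with hL
  have hin : ∀ S ∈ 𝒯.edgesIn D, ∃ t ∈ 𝒯.elements, ∃ a b, a ∈ t ∧ b ∈ t ∧ a ≠ b ∧
      S = edge a b ∧ openSegment ℝ a b ⊆ D := by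
    intro S hS
    obtain ⟨hS, hSD⟩ := Finset.mem_filter.1 hS
    obtain ⟨t, ht, a, b, ha, hb, hab, rfl⟩ := exists_edge_of_mem_edges hS
    exact ⟨t, ht, a, b, ha, hb, hab, rfl, (openSegment_subset_hull_edge hab).trans hSD⟩
  have hlong : ∑ S ∈ L, q S ≤ 3 * (1824 ^ 2 * K ^ 3 * M) * ∑ t ∈ U, etaSq f v gu t := by
    have h1 : ∀ S ∈ L, q S ≤
        1824 ^ 2 * K ^ 3 * M * ∑ t ∈ 𝒯.elements with S ⊆ t, etaSq f v gu t := by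
      intro S hS
      obtain ⟨hS, hX⟩ := Finset.mem_filter.1 hS
      obtain ⟨t, ht, a, b, ha, hb, hab, rfl, hseg⟩ := hin S hS
      refine hm.long_edge_estimate hf hu ht ha (fun h => hX ⟨a 0, fun z hz => ?_⟩)
        (hseg.trans hDΩ)
      rcases mem_edge.1 hz with rfl | rfl
      · rfl
      · exact h
    have h2 := sum_edges_le (E := L) hUel ((Finset.filter_subset _ _).trans
      (Finset.filter_subset _ _)) (fun S hS t ht hSt => by
        obtain ⟨-, -, a, b, -, -, hab, rfl, hseg⟩ := hin S (Finset.mem_filter.1 hS).1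
        obtain ⟨ha, hb⟩ := edge_subset.1 hSt
        -- An element with an edge in `D` meets `D` at the midpoint of that edge, so by the
        -- dichotomy its interior lies in `D`.
        have hmid := midpoint_mem_openSegment a b
        refine Finset.mem_filter.2 ⟨ht, (hD t ht).resolve_right fun he => ?_⟩
        have : (2 : ℝ)⁻¹ • a + (2 : ℝ)⁻¹ • b ∈ hull t ∩ D :=
          ⟨(convex_hull t).openSegment_subset (subset_hull t ha) (subset_hull t hb) hmid,
            hseg hmid⟩
        rw [he] at this
        exact this) hη
    calc _ ≤ _ := Finset.sum_le_sum h1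
      _ = 1824 ^ 2 * K ^ 3 * M * ∑ S ∈ L, ∑ t ∈ 𝒯.elements with S ⊆ t, etaSq f v gu t := by
        rw [Finset.mul_sum]
      _ ≤ 1824 ^ 2 * K ^ 3 * M * (3 * ∑ t ∈ U, etaSq f v gu t) :=
        mul_le_mul_of_nonneg_left h2 (by positivity)
      _ = _ := by ring
  have hvert : ∑ S ∈ V, q S ≤ 3 * (K * lineConst K M) * ∑ t ∈ U, etaSq f v gu t := by
    have h1 : V ⊆ I.biUnion fun i => 𝒯.verticalEdges (x i) := by
      intro S hS
      obtain ⟨hS, X, hX⟩ := Finset.mem_filter.1 hS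
      obtain ⟨t, ht, a, b, ha, hb, hab, rfl, hseg⟩ := hin S hS
      have e1 := hX a (mem_edge.2 (Or.inl rfl))
      have e2 := hX b (mem_edge.2 (Or.inr rfl))
      obtain ⟨i, hi, hai⟩ := hDI t ht a ha b hb (e2.trans e1.symm) hseg
      exact Finset.mem_biUnion.2 ⟨i, hi, edge_mem_verticalEdges ht ha hb hab hai
        (e2.trans (e1.symm.trans hai))⟩
    have h2 := hm.sum_lines_le (fun i hi => (hI i hi).2.le) hUel (fun i hi t ht =>
      Finset.mem_filter.2 ⟨(mem_lineElements.1 ht).1, hID i hi t ht⟩) hη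
    have hC : 0 ≤ K * lineConst K M := by
      rw [lineConst]; positivity
    calc _ ≤ ∑ S ∈ I.biUnion fun i => 𝒯.verticalEdges (x i), q S :=
          Finset.sum_le_sum_of_subset_of_nonneg h1 fun S _ _ => hq0 S
      _ = ∑ i ∈ I, ∑ S ∈ 𝒯.verticalEdges (x i), q S := by
          refine Finset.sum_biUnion fun i hi j hj hij => Finset.disjoint_left.2 fun S hS hS' => ?_
          obtain ⟨-, -, a, b, -, -, -, rfl, ha0, -⟩ := exists_of_mem_verticalEdges hS
          have ha0' := (Finset.mem_filter.1 hS').2 a (mem_edge.2 (Or.inl rfl))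
          exact hij (hm.grid_injOn (hI i hi).2.le (hI j hj).2.le (ha0.symm.trans ha0'))
      _ ≤ ∑ i ∈ I, K * lineConst K M * ∑ t ∈ 𝒯.lineElements (x i), etaSq f v gu t :=
          Finset.sum_le_sum fun i hi => hm.line_estimate (hI i hi).1 (hI i hi).2 hf hu hv
      _ = K * lineConst K M * ∑ i ∈ I, ∑ t ∈ 𝒯.lineElements (x i), etaSq f v gu t := by
          rw [Finset.mul_sum]
      _ ≤ K * lineConst K M * (3 * ∑ t ∈ U, etaSq f v gu t) := mul_le_mul_of_nonneg_left h2 hC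
      _ = _ := by ring
  have helem := 𝒯.element_terms_le (v := v) hf hu hfI hUel fun t ht htU =>
    (hD t ht).resolve_left fun h => htU (Finset.mem_filter.2 ⟨ht, h⟩)
  have herr := sum_etaSq_le (f := f) hv.1 hu.1.2.1 hDΩ hUel fun t ht => (Finset.mem_filter.1 ht).2
  have hsum : ∑ t ∈ U, etaSq f v gu t ≥ 0 := Finset.sum_nonneg fun t _ => hη t
  rw [estimator]
  refine Real.sqrt_le_iff.2 ⟨mul_nonneg (by positivity) hE0, ?_⟩
  have hsplit : ∑ S ∈ 𝒯.edgesIn D, area (𝒯.edgePatch S) * 𝒯.jump v S ^ 2 =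
      ∑ S ∈ V, q S + ∑ S ∈ L, q S := (Finset.sum_filter_add_sum_filter_not _ _ _).symm
  rw [hsplit]
  calc _ ≤ mainConst K M * ∑ t ∈ U, etaSq f v gu t := by
        rw [mainConst]; linarith
    _ ≤ |mainConst K M| * 𝒯.errorOsc f v gu D ^ 2 :=
        mul_le_mul (le_abs_self _) herr hsum (abs_nonneg _)
    -- For `m ≥ 0` one has `m ≤ (m + 1)²`, which avoids a square root in the final constant.
    _ ≤ (|mainConst K M| + 1) ^ 2 * 𝒯.errorOsc f v gu D ^ 2 := by
        refine mul_le_mul_of_nonneg_right ?_ (sq_nonneg _)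
        nlinarith [abs_nonneg (mainConst K M)]
    _ = _ := by ring

end IsStructuredMesh

/-! ### Strips and the whole square -/

lemma interior_subset_fst {s : Set Plane} {l r : ℝ} (h : ∀ p ∈ s, l ≤ p 0 ∧ p 0 ≤ r) :
    ∀ p ∈ interior s, l < p 0 ∧ p 0 < r := by
  intro p hp
  have hsurj : Function.Surjective (EuclideanSpace.proj (𝕜 := ℝ) (0 : Fin 2)) :=
    fun y => ⟨!₂[y, 0], by simp⟩
  have h1 : s ⊆ (EuclideanSpace.proj (𝕜 := ℝ) (0 : Fin 2)) ⁻¹' Set.Icc l r := fun p hp => h p hp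
  have h2 := interior_mono h1 hp
  rw [ContinuousLinearMap.interior_preimage _ hsurj, interior_Icc] at h2
  exact h2

namespace IsStructuredMesh

open Triangulation

variable {α₀ : ℝ} {M : ℕ} {K c₀ : ℝ} {n : ℕ} {x : ℕ → ℝ} {𝒯 : Triangulation unitSquare}
  {t : Finset Plane} {i j : ℕ}

lemma grid_le (hm : IsStructuredMesh α₀ M K c₀ n x 𝒯) (hij : i ≤ j) (hj : j ≤ n) : x i ≤ x j := by
  rcases hij.eq_or_lt with rfl | h
  · exact le_rfl
  · exact (hm.grid_lt h hj).le

lemma hull_subset_slab (hm : IsStructuredMesh α₀ M K c₀ n x 𝒯) (hj : j < n)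
    (hslab : ∀ z ∈ t, z 0 = x j ∨ z 0 = x (j + 1)) : ∀ p ∈ hull t, x j ≤ p 0 ∧ p 0 ≤ x (j + 1) := by
  have hle := (hm.grid_strictMono j hj).le
  have hc : Convex ℝ ((EuclideanSpace.proj (𝕜 := ℝ) (0 : Fin 2)) ⁻¹' Set.Icc (x j) (x (j + 1))) :=
    (convex_Icc _ _).linear_preimage (EuclideanSpace.proj (𝕜 := ℝ) (0 : Fin 2)).toLinearMap
  refine fun p hp => convexHull_min (fun z hz => ?_) hc hp
  change x j ≤ z 0 ∧ z 0 ≤ x (j + 1)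
  rcases hslab z hz with h | h <;> rw [h]
  · exact ⟨le_rfl, hle⟩
  · exact ⟨hle, le_rfl⟩

lemma strip_subset (hm : IsStructuredMesh α₀ M K c₀ n x 𝒯) (hi : i ≤ n) :
    strip n x i ⊆ unitSquare := by
  rintro p ⟨h1, h2, h3, h4⟩
  have a1 := hm.grid_le (Nat.zero_le (i - 1)) (by omega)
  have a2 := hm.grid_le (min_le_right (i + 1) n) le_rfl
  rw [hm.grid_zero] at a1
  rw [hm.grid_last] at a2
  exact ⟨a1.trans_lt h1, h2.trans_le a2, h3, h4⟩

lemma interior_subset_strip (hm : IsStructuredMesh α₀ M K c₀ n x 𝒯) (ht : t ∈ 𝒯.elements)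
    (hj : j < n) (hslab : ∀ z ∈ t, z 0 = x j ∨ z 0 = x (j + 1)) (h1 : i ≤ j + 1) (h2 : j ≤ i) :
    interior (hull t) ⊆ strip n x i := by
  intro p hp
  obtain ⟨-, -, p1, p2⟩ := 𝒯.interior_hull_subset ht hp
  obtain ⟨a1, a2⟩ := interior_subset_fst (hm.hull_subset_slab hj hslab) p hp
  exact ⟨(hm.grid_le (by omega) (by omega)).trans_lt a1,
    a2.trans_le (hm.grid_le (by omega) (by omega)), p1, p2⟩

lemma strip_dichotomy (hm : IsStructuredMesh α₀ M K c₀ n x 𝒯) (hi : i ≤ n)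
    (ht : t ∈ 𝒯.elements) :
    interior (hull t) ⊆ strip n x i ∨ hull t ∩ strip n x i = ∅ := by
  obtain ⟨j, hj, hslab⟩ := hm.exists_slab ht
  by_cases h1 : i ≤ j + 1
  · by_cases h2 : j ≤ i
    · exact Or.inl (hm.interior_subset_strip ht hj hslab h1 h2)
    · refine Or.inr (Set.eq_empty_iff_forall_notMem.2 fun p ⟨hp, hp'⟩ => ?_)
      have a1 := (hm.hull_subset_slab hj hslab p hp).1
      have a2 := hm.grid_le (i := min (i + 1) n) (j := j) (by omega) hj.le
      exact absurd hp'.2.1 (not_lt.2 (a2.trans a1))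
  · refine Or.inr (Set.eq_empty_iff_forall_notMem.2 fun p ⟨hp, hp'⟩ => ?_)
    have a1 := (hm.hull_subset_slab hj hslab p hp).2
    have a2 := hm.grid_le (i := j + 1) (j := i - 1) (by omega) (by omega)
    exact absurd hp'.1 (not_lt.2 (a1.trans a2))

/-- The points of a vertical edge with one vertex on a grid line lie on that line. -/
lemma exists_line_of_vertical (hm : IsStructuredMesh α₀ M K c₀ n x 𝒯) (ht : t ∈ 𝒯.elements)
    {a b : Plane} (ha : a ∈ t) (h0 : b 0 = a 0) {D : Set Plane} (hD : openSegment ℝ a b ⊆ D) :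
    ∃ k ≤ n, a 0 = x k ∧ ∃ p ∈ D, p 0 = x k := by
  obtain ⟨j, hj, hslab⟩ := hm.exists_slab ht
  obtain ⟨k, hk, hak⟩ : ∃ k ≤ n, a 0 = x k := by
    rcases hslab a ha with h | h
    · exact ⟨j, hj.le, h⟩
    · exact ⟨j + 1, hj, h⟩
  refine ⟨k, hk, hak, _, hD (midpoint_mem_openSegment a b), ?_⟩
  simp only [PiLp.add_apply, PiLp.smul_apply, smul_eq_mul]
  rw [h0, ← hak]; ring

/-- The only grid line inside the strip is `x = x i`, and for `i = 0` or `i = n` there is none; the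
index set is empty in these cases. -/
theorem estimator_strip_le (hm : IsStructuredMesh α₀ M K c₀ n x 𝒯) {f u v fI : Plane → ℝ}
    {gu : Plane → Plane} (hf : IsData f) (hu : IsWeakSolution unitSquare f u gu)
    (hv : 𝒯.IsFEFunction v) (hfI : 𝒯.IsLagrangeInterpolant f fI) (hi : i ≤ n) :
    𝒯.estimator v fI (strip n x i) ≤
      (|mainConst K M| + 1) * 𝒯.errorOsc f v gu (strip n x i) := by
  refine hm.estimator_le hf hu hv hfI (hm.strip_subset hi)
    (I := (Finset.range n).filter fun k => k = i ∧ 0 < k) (fun k hk => ?_)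
    (fun t ht => hm.strip_dichotomy hi ht) (fun k hk t ht => ?_) (fun t ht a ha b hb h0 hD => ?_)
  · simp only [Finset.mem_filter, Finset.mem_range] at hk
    exact ⟨hk.2.2, hk.1⟩
  · simp only [Finset.mem_filter, Finset.mem_range] at hk
    obtain ⟨hkn, rfl, hk0⟩ := hk
    obtain ⟨ht, z, hz, hz0⟩ := mem_lineElements.1 ht
    obtain ⟨j, hj, hslab⟩ := hm.exists_slab ht
    have : k = j ∨ k = j + 1 := by
      rcases hslab z hz with h | h
      · exact Or.inl (hm.grid_injOn hi hj.le (hz0.symm.trans h))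
      · exact Or.inr (hm.grid_injOn hi hj (hz0.symm.trans h))
    exact hm.interior_subset_strip ht hj hslab (by omega) (by omega)
  · obtain ⟨k, hk, hak, p, hp, hpk⟩ := hm.exists_line_of_vertical ht ha h0 hD
    obtain ⟨p0, p1, -⟩ := hp
    rw [hpk] at p0 p1
    -- Together with `k < min (i + 1) n` this forces `k = i` with `0 < i < n`. For `i = 0` the
    -- truncated subtraction gives `0 < k < 1`, which is impossible, so the boundary line never
    -- occurs.
    have h1 : i - 1 < k := by
      by_contra hcon
      exact absurd p0 (not_lt.2 (hm.grid_le (by omega) (by omega)))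
    have h2 : k < min (i + 1) n := by
      by_contra hcon
      exact absurd p1 (not_lt.2 (hm.grid_le (by omega) hk))
    refine ⟨k, ?_, hak⟩
    simp only [Finset.mem_filter, Finset.mem_range]
    omega

theorem estimator_unitSquare_le (hm : IsStructuredMesh α₀ M K c₀ n x 𝒯) {f u v fI : Plane → ℝ}
    {gu : Plane → Plane} (hf : IsData f) (hu : IsWeakSolution unitSquare f u gu)
    (hv : 𝒯.IsFEFunction v) (hfI : 𝒯.IsLagrangeInterpolant f fI) :
    𝒯.estimator v fI unitSquare ≤ (|mainConst K M| + 1) * 𝒯.errorOsc f v gu unitSquare := by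
  refine hm.estimator_le hf hu hv hfI subset_rfl
    (I := (Finset.range n).filter fun k => 0 < k) (fun k hk => ?_)
    (fun t ht => Or.inl (𝒯.interior_hull_subset ht))
    (fun k hk t ht => 𝒯.interior_hull_subset (mem_lineElements.1 ht).1)
    (fun t ht a ha b hb h0 hD => ?_)
  · simp only [Finset.mem_filter, Finset.mem_range] at hk
    exact ⟨hk.2, hk.1⟩
  · obtain ⟨k, hk, hak, p, hp, hpk⟩ := hm.exists_line_of_vertical ht ha h0 hD
    obtain ⟨p0, p1, -⟩ := hp
    rw [hpk] at p0 p1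
    refine ⟨k, ?_, hak⟩
    simp only [Finset.mem_filter, Finset.mem_range]
    refine ⟨lt_of_le_of_ne hk ?_, Nat.pos_of_ne_zero ?_⟩
    · rintro rfl
      rw [hm.grid_last] at p1
      exact lt_irrefl _ p1
    · rintro rfl
      rw [hm.grid_zero] at p0
      exact lt_irrefl _ p0

end IsStructuredMesh

end

end AnisoFEM

open AnisoFEM in
theorem mainTheorem2 (α₀ : ℝ) (hα₀ : α₀ < Real.pi) (M : ℕ) (K c₀ : ℝ) (hc₀ : 0 < c₀) :
    ∃ C : ℝ, 0 < C ∧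
      ∀ (n : ℕ) (x : ℕ → ℝ) (𝒯 : Triangulation unitSquare),
        IsStructuredMesh α₀ M K c₀ n x 𝒯 →
      ∀ f : Plane → ℝ,
        AEStronglyMeasurable f (volume.restrict unitSquare) →
        (∃ B : ℝ, ∀ p ∈ closure unitSquare, |f p| ≤ B) →
      ∀ (u : Plane → ℝ) (gu : Plane → Plane) (uh fI : Plane → ℝ),
        IsWeakSolution unitSquare f u gu →
        𝒯.IsFESolution f uh →
        𝒯.IsLagrangeInterpolant f fI →
        (∀ i ≤ n, 𝒯.estimator uh fI (strip n x i) ≤ C * 𝒯.errorOsc f uh gu (strip n x i)) ∧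
        𝒯.estimator uh fI unitSquare ≤ C * 𝒯.errorOsc f uh gu unitSquare := by
  -- The constant is fixed before any mesh is given, hence before `1 ≤ K` is known; the absolute
  -- value makes it positive for every `K`.
  refine ⟨|IsStructuredMesh.mainConst K M| + 1, by positivity, ?_⟩
  intro n x 𝒯 hm f hmeas hbdd u gu uh fI hu huh hfI
  exact ⟨fun i hi => hm.estimator_strip_le ⟨hmeas, hbdd⟩ hu huh.1 hfI hi,
    hm.estimator_unitSquare_le ⟨hmeas, hbdd⟩ hu huh.1 hfI⟩
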